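/- Let $d\in\mathbb N$, $m>0$, $T>0$ and $x_-,x_+\in\mathbb R^d$. Let $w$ be a standard Brownian motion on $\mathbb R^d$, let $v_0\sim\mathcal N\bigl(0,\tfrac1{2m}I\bigr)$ be independent of $w$, and let $(x,v)$ have continuous paths on $[0,T]$ and solve (the case $f\equiv0$ of the second order Langevin equation) $$dx(t)=v(t)\,dt,\quad x(0)=x_-,\qquad m\,dv(t)=-v(t)\,dt+dw(t),\quad v(0)=v_0 .$$ Let $Q_0^{0,x_-;T,x_+}$ denote the law on $L^2([0,T],\mathbb R^d)$ of the path $(x(t))_{0\le t\le T}$ conditioned on $x(T)=x_+$, that is, the value at $x_+$ of a weakly continuous regular conditional distribution $y\mapsto\mathrm{Law}(x\mid x(T)=y)$. Let $\mathcal L=-m^2\partial_t^4+\partial_t^2$ on $L^2([0,T],\mathbb R^d)$ with domain $$\mathcal D(\mathcal L)=\bigl\{u\in H^4([0,T],\mathbb R^d) : u(0)=u(T)=0,\; m\,\partial_t^2u(0)=\partial_tu(0),\; m\,\partial_t^2u(T)=-\partial_tu(T)\bigr\},$$ where $H^4$ is the Sobolev space of functions with weak derivatives up to order four in $L^2$.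 Then: 1. $\mathcal L$ is self-adjoint and negative definite ($\langle\mathcal Lu,u\rangle<0$ for $0\ne u\in\mathcal D(\mathcal L)$), and $-\mathcal L$ has an everywhere defined bounded inverse $-\mathcal L^{-1}$. 2. There is exactly one $\bar x\in C^4([0,T],\mathbb R^d)$ with $-m^2\bar x''''+\bar x''=0$ on $[0,T]$, $\bar x(0)=x_-$, $\bar x(T)=x_+$, $m\,\bar x''(0)=\bar x'(0)$ and $m\,\bar x''(T)=-\bar x'(T)$. 3. $Q_0^{0,x_-;T,x_+}$ exists, is unique, and is the Gaussian measure $\mathcal N(\bar x,-\mathcal L^{-1})$ on $L^2([0,T],\mathbb R^d)$, with mean $\bar x$ and covariance operator $-\mathcal L^{-1}$. 4. The covariance operator is the integral operator $(-\mathcal L^{-1}g)(s)=\int_0^TG(s,t)\,g(t)\,dt$, where $G\colon[0,T]^2\to\mathbb R$ is the Green's function of $-\mathcal L$: $G$ is continuous and, for each $s\in[0,T]$, $G(s,\cdot)\in C^2([0,T])$ satisfies $m^2\partial_t^4G(s,\cdot)-\partial_t^2G(s,\cdot)=\delta_s$ in the sense of distributions on $(0,T)$ (so the right-hand side vanishes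 on $(0,T)$ if $s\in\{0,T\}$), $G(s,0)=G(s,T)=0$, $m\,\partial_t^2G(s,0)=\partial_tG(s,0)$ and $m\,\partial_t^2G(s,T)=-\partial_tG(s,T)$. -/

import Mathlib

open MeasureTheory ProbabilityTheory Set Filter
open scoped NNReal RealInnerProductSpace BoundedContinuousFunction

noncomputable section

namespace LangevinBridge

/-! ### The space `L²([0,T], ℝᵈ)` -/

/-- The Euclidean space `ℝᵈ`. -/
abbrev E (d : ℕ) : Type := EuclideanSpace ℝ (Fin d)

/-- The Hilbert space `L²([0,T], ℝᵈ)`. -/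
abbrev L2 (d : ℕ) (T : ℝ) : Type := Lp (E d) 2 (volume.restrict (Icc (0 : ℝ) T))

/-- `L²([0,T], ℝᵈ)` carries its Borel σ-algebra. -/
instance instMeasurableSpaceL2 (d : ℕ) (T : ℝ) : MeasurableSpace (L2 d T) := borel _

instance instBorelSpaceL2 (d : ℕ) (T : ℝ) : BorelSpace (L2 d T) := ⟨rfl⟩

open Classical in
/-- The element of `L²([0,T], ℝᵈ)` given by a path (and `0` if the path is not square
integrable, which does not happen for paths that are continuous on `[0,T]`). -/
def toL2 {d : ℕ} (T : ℝ) (x : ℝ → E d) : L2 d T :=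
  if h : MemLp x 2 (volume.restrict (Icc (0 : ℝ) T)) then h.toLp x else 0

/-! ### The Langevin equation and its conditioned law -/

/-- A standard Brownian motion on `ℝᵈ`: the components are independent one-dimensional standard
Brownian motions. -/
structure IsBrownianVector {Ω : Type*} [MeasurableSpace Ω] {d : ℕ}
    (W : ℝ≥0 → Ω → E d) (P : Measure Ω) : Prop where
  component : ∀ i : Fin d, IsBrownianReal (fun t ω => W t ω i) P
  indep : iIndepFun (fun (i : Fin d) (ω : Ω) (t : ℝ≥0) => W t ω i) P

/-- The normal distribution `𝒩(0, 1/(2m))` on `ℝᵈ`, with covariance matrix `(1/(2m)) I`. -/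
def velocityLaw (d : ℕ) (m : ℝ) : Measure (E d) :=
  (stdGaussian (E d)).map (fun y => (Real.sqrt (2 * m))⁻¹ • y)

/-- `(x, v)` is a solution on `[0,T]` of
`dx = v dt`, `m dv = f(x) dt - v dt + dW`, `x(0) = x₀`, `v(0) ∼ 𝒩(0, 1/(2m))`,
where `W` is a standard Brownian motion independent of `v(0)`.  Since the noise is additive, the
equation is a pathwise integral equation. -/
structure IsLangevinSolution {Ω : Type*} [MeasurableSpace Ω] {d : ℕ} (m T : ℝ)
    (f : E d → E d) (x₀ : E d) (P : Measure Ω)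
    (W : ℝ≥0 → Ω → E d) (x v : ℝ → Ω → E d) : Prop where
  brownian : IsBrownianVector W P
  velocity_law : HasLaw (v 0) (velocityLaw d m) P
  velocity_indep : IndepFun (v 0) (fun ω t => W t ω) P
  aemeasurable_position : ∀ t ∈ Icc (0 : ℝ) T, AEMeasurable (x t) P
  aemeasurable_velocity : ∀ t ∈ Icc (0 : ℝ) T, AEMeasurable (v t) P
  continuous_position : ∀ᵐ ω ∂P, ContinuousOn (fun t => x t ω) (Icc 0 T)
  continuous_velocity : ∀ᵐ ω ∂P, ContinuousOn (fun t => v t ω) (Icc 0 T)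
  integrable_drift : ∀ᵐ ω ∂P, IntervalIntegrable (fun t => f (x t ω)) volume 0 T
  position_eq : ∀ᵐ ω ∂P, ∀ t ∈ Icc (0 : ℝ) T, x t ω = x₀ + ∫ s in (0 : ℝ)..t, v s ω
  velocity_eq : ∀ᵐ ω ∂P, ∀ t ∈ Icc (0 : ℝ) T,
    m • v t ω = m • v 0 ω + (∫ s in (0 : ℝ)..t, f (x s ω)) - (∫ s in (0 : ℝ)..t, v s ω)
      + W t.toNNReal ω

/-- `Q` is the law of `X` conditioned on `Y = y`, in the sense of the weakly continuous regular
conditional distribution: there is a Markov kernel `κ`, weakly continuous in its parameter, which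
is a regular conditional distribution of `X` given `Y`, and `Q = κ y`.  (If the law of `Y` has
full support, such a kernel is determined at every point.) -/
def IsConditionedLaw {Ω 𝓧 𝓨 : Type*} [MeasurableSpace Ω]
    [TopologicalSpace 𝓧] [MeasurableSpace 𝓧] [TopologicalSpace 𝓨] [MeasurableSpace 𝓨]
    (P : Measure Ω) (X : Ω → 𝓧) (Y : Ω → 𝓨) (y : 𝓨) (Q : Measure 𝓧) : Prop :=
  ∃ κ : Kernel 𝓨 𝓧, IsMarkovKernel κ ∧
    (∀ F : 𝓧 →ᵇ ℝ, Continuous fun z => ∫ u, F u ∂(κ z)) ∧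
    HasCondDistrib X Y κ P ∧ κ y = Q

/-- `Q` is the target distribution of the Langevin bridge on `L²([0,T], ℝᵈ)`: the law of the path
`(x(t))_{0 ≤ t ≤ T}` conditioned on `x(T) = xplus`, where `x` is the position component of a solution
of the Langevin equation. -/
def IsTargetLaw {Ω : Type*} [MeasurableSpace Ω] {d : ℕ} (T : ℝ) (P : Measure Ω)
    (x : ℝ → Ω → E d) (xplus : E d) (Q : Measure (L2 d T)) : Prop :=
  IsConditionedLaw P (fun ω => toL2 T (fun t => x t ω)) (x T) xplus Q

/-- `μ` is the Gaussian measure `𝒩(a, C)` on a Hilbert space. -/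
structure IsGaussianWith {H : Type*} [NormedAddCommGroup H] [InnerProductSpace ℝ H]
    [MeasurableSpace H] [BorelSpace H] (μ : Measure H) (a : H) (C : H →L[ℝ] H) : Prop where
  gaussian : IsGaussian μ
  mean : ∫ u, u ∂μ = a
  covariance : ∀ g h : H, covarianceBilin μ g h = ⟪C g, h⟫

/-! ### The differential operator -/

/-- `φ` is a test function on the open interval `(0,T)`. -/
structure IsTestFunction (T : ℝ) (φ : ℝ → ℝ) : Prop where
  smooth : ContDiff ℝ (⊤ : ℕ∞) φ
  compact : HasCompactSupport φ
  support : tsupport φ ⊆ Ioo 0 T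

/-- `g ∈ L²` is the weak derivative of order `k` of `u ∈ L²` on `(0,T)`. -/
def IsWeakDeriv {d : ℕ} {T : ℝ} (k : ℕ) (u g : L2 d T) : Prop :=
  ∀ φ : ℝ → ℝ, IsTestFunction T φ →
    ∫ t in Icc (0 : ℝ) T, iteratedDeriv k φ t • u t
      = (-1 : ℝ) ^ k • ∫ t in Icc (0 : ℝ) T, φ t • g t

lemma integrable_smul_L2 {d : ℕ} {T : ℝ} {ψ : ℝ → ℝ} (hψ : Continuous ψ) (u : L2 d T) :
    IntegrableOn (fun t => ψ t • u t) (Icc (0 : ℝ) T) := by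
  have hu : IntegrableOn (fun t => u t) (Icc (0 : ℝ) T) :=
    (Lp.memLp u).integrable (by norm_num)
  exact hu.continuousOn_smul hψ.continuousOn isCompact_Icc

lemma IsTestFunction.continuous_iteratedDeriv {T : ℝ} {φ : ℝ → ℝ} (h : IsTestFunction T φ)
    (k : ℕ) : Continuous (iteratedDeriv k φ) :=
  h.smooth.continuous_iteratedDeriv k (by exact_mod_cast le_top)

lemma isWeakDeriv_zero {d : ℕ} {T : ℝ} (k : ℕ) : IsWeakDeriv k (0 : L2 d T) 0 := by
  intro φ _
  have h0 := Lp.coeFn_zero (E d) 2 (volume.restrict (Icc (0 : ℝ) T))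
  have key : ∀ ψ : ℝ → ℝ, ∫ t in Icc (0 : ℝ) T, ψ t • (0 : L2 d T) t = 0 := fun ψ => by
    rw [integral_congr_ae (g := fun _ => (0 : E d)) (by filter_upwards [h0] with t ht; rw [ht]; simp)]
    simp
  rw [key, key, smul_zero]

lemma IsWeakDeriv.add {d : ℕ} {T : ℝ} {k : ℕ} {u u' g g' : L2 d T}
    (h : IsWeakDeriv k u g) (h' : IsWeakDeriv k u' g') :
    IsWeakDeriv k (u + u') (g + g') := by
  intro φ hφ
  have key : ∀ ψ : ℝ → ℝ, Continuous ψ → ∀ a b : L2 d T,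
      ∫ t in Icc (0 : ℝ) T, ψ t • (a + b : L2 d T) t
        = (∫ t in Icc (0 : ℝ) T, ψ t • a t) + ∫ t in Icc (0 : ℝ) T, ψ t • b t := by
    intro ψ hψ a b
    rw [← integral_add (integrable_smul_L2 hψ a) (integrable_smul_L2 hψ b)]
    refine integral_congr_ae ?_
    filter_upwards [Lp.coeFn_add a b] with t ht
    rw [ht, Pi.add_apply, smul_add]
  rw [key _ (hφ.continuous_iteratedDeriv k), key _ hφ.smooth.continuous, h φ hφ, h' φ hφ, smul_add]

lemma IsWeakDeriv.smul {d : ℕ} {T : ℝ} {k : ℕ} {u g : L2 d T} (c : ℝ)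
    (h : IsWeakDeriv k u g) : IsWeakDeriv k (c • u) (c • g) := by
  intro φ hφ
  have key : ∀ ψ : ℝ → ℝ, ∀ a : L2 d T,
      ∫ t in Icc (0 : ℝ) T, ψ t • (c • a : L2 d T) t
        = c • ∫ t in Icc (0 : ℝ) T, ψ t • a t := by
    intro ψ a
    rw [← integral_smul]
    refine integral_congr_ae ?_
    filter_upwards [Lp.coeFn_smul c a] with t ht
    simp only [ht, Pi.smul_apply]
    rw [smul_comm]
  rw [key, key, h φ hφ, smul_comm]

/-- Weak derivatives are unique. -/
lemma IsWeakDeriv.unique {d : ℕ} {T : ℝ} {k : ℕ} {u g g' : L2 d T}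
    (h : IsWeakDeriv k u g) (h' : IsWeakDeriv k u g') : g = g' := by
  have hz : IsWeakDeriv k (0 : L2 d T) (g - g') := by
    have := h.add (h'.smul (-1))
    simpa [sub_eq_add_neg] using this
  have hint : ∀ w : L2 d T, IntegrableOn (fun t => w t) (Icc (0 : ℝ) T) := fun w =>
    (Lp.memLp w).integrable (by norm_num)
  have hae : ∀ᵐ t : ℝ, t ∈ Ioo (0 : ℝ) T → (g - g' : L2 d T) t = 0 := by
    refine IsOpen.ae_eq_zero_of_integral_contDiff_smul_eq_zero isOpen_Ioo
      ((hint _).mono_set Ioo_subset_Icc_self).locallyIntegrableOn ?_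
    intro φ h1 h2 h3
    have e := hz φ ⟨h1, h2, h3⟩
    have h0 := Lp.coeFn_zero (E d) 2 (volume.restrict (Icc (0 : ℝ) T))
    rw [integral_congr_ae (g := fun _ => (0 : E d))
      (by filter_upwards [h0] with t ht; rw [ht]; simp)] at e
    simp only [integral_zero] at e
    have e2 : ∫ t in Icc (0 : ℝ) T, φ t • (g - g' : L2 d T) t = 0 := by
      rcases smul_eq_zero.1 e.symm with h | h
      · exact absurd h (pow_ne_zero _ (by norm_num))
      · exact h
    rw [← e2]
    refine (setIntegral_eq_integral_of_forall_compl_eq_zero ?_).symm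
    intro t ht
    have : φ t = 0 := image_eq_zero_of_notMem_tsupport
      (fun hh => ht (Ioo_subset_Icc_self (h3 hh)))
    simp [this]
  have : (g - g' : L2 d T) = 0 := by
    refine Lp.ext ?_
    have h0 := Lp.coeFn_zero (E d) 2 (volume.restrict (Icc (0 : ℝ) T))
    have hmem : ∀ᵐ t ∂(volume.restrict (Icc (0 : ℝ) T)), t ∈ Ioo (0 : ℝ) T := by
      rw [← Measure.restrict_congr_set (Ioo_ae_eq_Icc (μ := volume) (a := (0 : ℝ)) (b := T))]
      exact ae_restrict_mem measurableSet_Ioo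
    filter_upwards [h0, hmem, ae_restrict_of_ae hae] with t h1 h2 h3
    rw [h3 h2, h1]; rfl
  exact sub_eq_zero.1 this

/-- The weak derivative of order `k` as an unbounded operator on `L²([0,T], ℝᵈ)`, with its maximal
domain. -/
def weakDeriv (d : ℕ) (T : ℝ) (k : ℕ) : L2 d T →ₗ.[ℝ] L2 d T where
  domain :=
    { carrier := {u | ∃ g, IsWeakDeriv k u g}
      zero_mem' := ⟨0, isWeakDeriv_zero k⟩
      add_mem' := fun ⟨g, hg⟩ ⟨g', hg'⟩ => ⟨g + g', hg.add hg'⟩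
      smul_mem' := fun c _ ⟨g, hg⟩ => ⟨c • g, hg.smul c⟩ }
  toFun :=
    { toFun := fun u => Classical.choose u.2
      map_add' := fun u u' => (Classical.choose_spec (u + u').2).unique
        ((Classical.choose_spec u.2).add (Classical.choose_spec u'.2))
      map_smul' := fun c u => (Classical.choose_spec (c • u).2).unique
        ((Classical.choose_spec u.2).smul c) }

lemma weakDeriv_spec {d : ℕ} {T : ℝ} {k : ℕ} (u : (weakDeriv d T k).domain) :
    IsWeakDeriv k (u : L2 d T) (weakDeriv d T k u) :=
  Classical.choose_spec u.2

/-- The Sobolev space `H⁴([0,T], ℝᵈ)`: the functions in `L²` whose weak derivatives up to order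
four exist in `L²`. -/
def sobolevH4 (d : ℕ) (T : ℝ) : Submodule ℝ (L2 d T) :=
  (weakDeriv d T 1).domain ⊓ (weakDeriv d T 2).domain ⊓
    (weakDeriv d T 3).domain ⊓ (weakDeriv d T 4).domain

/-- The boundary value `u(t) = a` for `u ∈ L²`: it is the value at `t` of the representative of
`u` that is continuous on `[0,T]`. -/
def HasTrace {d : ℕ} {T : ℝ} (u : L2 d T) (t : ℝ) (a : E d) : Prop :=
  ∃ c : ℝ → E d, ContinuousOn c (Icc 0 T) ∧ u =ᵐ[volume.restrict (Icc (0 : ℝ) T)] c ∧ c t = a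

lemma hasTrace_zero {d : ℕ} {T : ℝ} (t : ℝ) : HasTrace (0 : L2 d T) t 0 :=
  ⟨0, continuousOn_const, Lp.coeFn_zero _ _ _, rfl⟩

lemma HasTrace.add {d : ℕ} {T t : ℝ} {u u' : L2 d T} {a a' : E d}
    (h : HasTrace u t a) (h' : HasTrace u' t a') : HasTrace (u + u') t (a + a') := by
  obtain ⟨c, h1, h2, h3⟩ := h
  obtain ⟨c', h1', h2', h3'⟩ := h'
  exact ⟨c + c', h1.add h1', (Lp.coeFn_add u u').trans (h2.add h2'), by simp [h3, h3']⟩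

lemma HasTrace.smul {d : ℕ} {T t : ℝ} {u : L2 d T} {a : E d} (r : ℝ)
    (h : HasTrace u t a) : HasTrace (r • u) t (r • a) := by
  obtain ⟨c, h1, h2, h3⟩ := h
  exact ⟨r • c, h1.const_smul r, (Lp.coeFn_smul r u).trans (h2.const_smul r), by simp [h3]⟩

/-- The relation `m ∂ₜ²u(t) = σ ∂ₜu(t)` between boundary values of weak derivatives of `u`. -/
def HasRobinRelation {d : ℕ} {T : ℝ} (m σ t : ℝ) (u : L2 d T) : Prop :=
  ∃ (u₁ u₂ : L2 d T) (a b : E d), IsWeakDeriv 1 u u₁ ∧ IsWeakDeriv 2 u u₂ ∧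
    HasTrace u₁ t a ∧ HasTrace u₂ t b ∧ m • b = σ • a

/-- The domain of the operator: all `u ∈ H⁴` with `u(0) = u(T) = 0`, `m ∂ₜ²u(0) = ∂ₜu(0)` and
`m ∂ₜ²u(T) = -∂ₜu(T)`. -/
def operatorDomain (d : ℕ) (m T : ℝ) : Submodule ℝ (L2 d T) where
  carrier := {u | u ∈ sobolevH4 d T ∧ HasTrace u 0 0 ∧ HasTrace u T 0 ∧
    HasRobinRelation m 1 0 u ∧ HasRobinRelation m (-1) T u}
  zero_mem' := by
    have h : ∀ σ t : ℝ, HasRobinRelation m σ t (0 : L2 d T) := fun σ t =>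
      ⟨0, 0, 0, 0, isWeakDeriv_zero 1, isWeakDeriv_zero 2, hasTrace_zero t, hasTrace_zero t,
        by simp⟩
    exact ⟨zero_mem _, hasTrace_zero _, hasTrace_zero _, h _ _, h _ _⟩
  add_mem' := by
    have h : ∀ (σ t : ℝ) (u u' : L2 d T), HasRobinRelation m σ t u →
        HasRobinRelation m σ t u' → HasRobinRelation m σ t (u + u') := by
      rintro σ t u u' ⟨u₁, u₂, a, b, h1, h2, h3, h4, h5⟩ ⟨u₁', u₂', a', b', h1', h2', h3', h4', h5'⟩
      exact ⟨_, _, _, _, h1.add h1', h2.add h2', h3.add h3', h4.add h4', by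
        rw [smul_add, smul_add, h5, h5']⟩
    rintro u u' ⟨h1, h2, h3, h4, h5⟩ ⟨h1', h2', h3', h4', h5'⟩
    exact ⟨add_mem h1 h1', by simpa using h2.add h2', by simpa using h3.add h3',
      h _ _ _ _ h4 h4', h _ _ _ _ h5 h5'⟩
  smul_mem' := by
    have h : ∀ (r σ t : ℝ) (u : L2 d T), HasRobinRelation m σ t u →
        HasRobinRelation m σ t (r • u) := by
      rintro r σ t u ⟨u₁, u₂, a, b, h1, h2, h3, h4, h5⟩
      exact ⟨_, _, _, _, h1.smul r, h2.smul r, h3.smul r, h4.smul r, by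
        rw [smul_comm m r, h5, smul_comm]⟩
    rintro r u ⟨h1, h2, h3, h4, h5⟩
    exact ⟨Submodule.smul_mem _ r h1, by simpa using h2.smul r, by simpa using h3.smul r,
      h _ _ _ _ h4, h _ _ _ _ h5⟩

/-- The operator `𝓛 = -m² ∂ₜ⁴ + ∂ₜ²` on `L²([0,T], ℝᵈ)` with domain `operatorDomain`. -/
def operatorL (d : ℕ) (m T : ℝ) : L2 d T →ₗ.[ℝ] L2 d T :=
  ((-(m ^ 2)) • weakDeriv d T 4 + weakDeriv d T 2).domRestrict (operatorDomain d m T)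

/-- `C` is the everywhere defined bounded inverse of the unbounded operator `A`. -/
structure IsBoundedInverse {H : Type*} [NormedAddCommGroup H] [NormedSpace ℝ H]
    (A : H →ₗ.[ℝ] H) (C : H →L[ℝ] H) : Prop where
  right_inv : ∀ g : H, ∃ hg : C g ∈ A.domain, A ⟨C g, hg⟩ = g
  left_inv : ∀ u : A.domain, C (A u) = u

/-- `y` is a classical solution on `[0,T]` of `-m² y'''' + y'' = 0` with
`y(0) = xminus`, `y(T) = xplus`, `m y''(0) = y'(0)`, `m y''(T) = -y'(T)`. -/
structure IsMeanPath {d : ℕ} (m T : ℝ) (xminus xplus : E d) (y : ℝ → E d) : Prop where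
  contDiffOn : ContDiffOn ℝ 4 y (Icc 0 T)
  equation : ∀ t ∈ Icc (0 : ℝ) T,
    (-(m ^ 2)) • iteratedDerivWithin 4 y (Icc 0 T) t + iteratedDerivWithin 2 y (Icc 0 T) t = 0
  left_value : y 0 = xminus
  right_value : y T = xplus
  left_deriv : m • iteratedDerivWithin 2 y (Icc 0 T) 0 = derivWithin y (Icc 0 T) 0
  right_deriv : m • iteratedDerivWithin 2 y (Icc 0 T) T = -derivWithin y (Icc 0 T) T

/-- `G` is the (scalar) Green's function of `-L = m² ∂ₜ⁴ - ∂ₜ²` on `[0,T]` with the boundary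
conditions `u(0) = u(T) = 0`, `m u''(0) = u'(0)`, `m u''(T) = -u'(T)`: it is continuous, and for
each `s` the function `G(s, ·)` is `C²` up to the boundary, satisfies the boundary conditions, and
solves `m² ∂ₜ⁴ G(s, ·) - ∂ₜ² G(s, ·) = δ_s` in the sense of distributions on `(0,T)`. -/
structure IsGreenFunction (m T : ℝ) (G : ℝ → ℝ → ℝ) : Prop where
  continuousOn : ContinuousOn (Function.uncurry G) (Icc 0 T ×ˢ Icc 0 T)
  contDiffOn : ∀ s ∈ Icc (0 : ℝ) T, ContDiffOn ℝ 2 (G s) (Icc 0 T)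
  equation : ∀ s ∈ Icc (0 : ℝ) T, ∀ φ : ℝ → ℝ, IsTestFunction T φ →
    ∫ t in Icc (0 : ℝ) T, G s t * (m ^ 2 * iteratedDeriv 4 φ t - iteratedDeriv 2 φ t) = φ s
  left_value : ∀ s ∈ Icc (0 : ℝ) T, G s 0 = 0
  right_value : ∀ s ∈ Icc (0 : ℝ) T, G s T = 0
  left_deriv : ∀ s ∈ Icc (0 : ℝ) T,
    m * iteratedDerivWithin 2 (G s) (Icc 0 T) 0 = derivWithin (G s) (Icc 0 T) 0
  right_deriv : ∀ s ∈ Icc (0 : ℝ) T,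
    m * iteratedDerivWithin 2 (G s) (Icc 0 T) T = -derivWithin (G s) (Icc 0 T) T

end LangevinBridge

/-!
Integrating the velocity equation writes `x(t)` as a linear functional of `v₀` and `w`, so that the
components of `x` are independent Gaussian processes with the explicit covariance `freeCov`.
Regressing `x(t)` on the endpoint `x(T)` leaves a residual of covariance `bridgeCov`, which is
independent of `x(T)`. Hence adding the regression line `bridgeMean`, evaluated at the prescribed
endpoint, to the law of the residual gives the conditioned law, and this depends continuously on
the endpoint; as the law of `x(T)` charges every open set, a continuous version is unique.

On either side of the diagonal `bridgeCov` is a combination of `1, t, e^{t/m}, e^{-t/m}`, the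
solutions of `m² y'''' = y''`; only its third derivative jumps, by the amount that produces the
Dirac mass. So `bridgeCov` is the Green's function, and its integral operator inverts `-𝓛`.
Negativity of `𝓛` and uniqueness of the mean path come from the energy identity
`-⟨𝓛u, u⟩ = m²‖u''‖² + ‖u'‖² + m|u'(0)|² + m|u'(T)|²`.
-/

noncomputable section

namespace LangevinBridge

/-! ### The equation `m² y'''' = y''` -/

section HomogeneousEquation

variable {V : Type*} [NormedAddCommGroup V] [NormedSpace ℝ V]

/-- The solution of `m² y'''' = y''` with coefficients `c` in the fundamental system
`1, t, e^{t/m}, e^{-t/m}`. -/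
def homogSol (m : ℝ) (c : Fin 4 → V) (t : ℝ) : V :=
  c 0 + t • c 1 + Real.exp (t / m) • c 2 + Real.exp (-t / m) • c 3

/-- Differentiation in terms of the coefficients in the fundamental system
`1, t, e^{t/m}, e^{-t/m}`. -/
def derivCoeff (m : ℝ) (c : Fin 4 → V) : Fin 4 → V :=
  ![c 1, 0, m⁻¹ • c 2, -(m⁻¹ • c 3)]

lemma continuous_derivCoeff (m : ℝ) : Continuous (derivCoeff m : (Fin 4 → V) → Fin 4 → V) := by
  refine continuous_pi fun i => ?_
  fin_cases i <;> simp only [derivCoeff] <;> dsimp <;> fun_prop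

lemma continuous_homogSol {X : Type*} [TopologicalSpace X] (m : ℝ) {c : X → Fin 4 → V}
    {t : X → ℝ} (hc : Continuous c) (ht : Continuous t) :
    Continuous fun p => homogSol m (c p) (t p) := by
  have hc' (i) : Continuous fun p => c p i := (continuous_apply i).comp hc
  exact (((hc' 0).add (ht.smul (hc' 1))).add ((by fun_prop : Continuous _).smul (hc' 2))).add
    ((by fun_prop : Continuous _).smul (hc' 3))

lemma hasDerivAt_homogSol (m : ℝ) (c : Fin 4 → V) (t : ℝ) :
    HasDerivAt (homogSol m c) (homogSol m (derivCoeff m c) t) t := by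
  have h := ((((hasDerivAt_id t).smul_const (c 1)).const_add (c 0)).add
    (((hasDerivAt_id t).div_const m).exp.smul_const (c 2))).add
    (((hasDerivAt_id t).neg.div_const m).exp.smul_const (c 3))
  refine h.congr_deriv ?_
  simp only [homogSol, derivCoeff, Matrix.cons_val, id, Pi.neg_apply]
  module

lemma hasDerivAt_homogSol_iterate (m : ℝ) (c : Fin 4 → V) (j : ℕ) (t : ℝ) :
    HasDerivAt (homogSol m ((derivCoeff m)^[j] c))
      (homogSol m ((derivCoeff m)^[j + 1] c) t) t := by
  rw [Function.iterate_succ_apply']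
  exact hasDerivAt_homogSol m _ t

lemma homogSol_equation {m : ℝ} (hm : m ≠ 0) (c : Fin 4 → V) (t : ℝ) :
    m ^ 2 • homogSol m ((derivCoeff m)^[4] c) t = homogSol m ((derivCoeff m)^[2] c) t := by
  simp only [homogSol, derivCoeff, Function.iterate_succ, Function.iterate_zero,
    Function.comp_apply, id, Matrix.cons_val]
  match_scalars <;> field_simp

lemma homogSol_robin_left {m : ℝ} (hm : m ≠ 0) {c : Fin 4 → V} (hc : m • c 1 = (2 : ℝ) • c 3) :
    m • homogSol m ((derivCoeff m)^[2] c) 0 = homogSol m (derivCoeff m c) 0 := by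
  have hc' : c 1 = (2 * m⁻¹) • c 3 := by
    rw [mul_comm, mul_smul, ← hc, inv_smul_smul₀ hm]
  simp only [homogSol, derivCoeff, Function.iterate_succ, Function.iterate_zero,
    Function.comp_apply, id, Matrix.cons_val, neg_zero, zero_div, Real.exp_zero, hc']
  match_scalars <;> field_simp
  norm_num

lemma homogSol_robin_right {m T : ℝ} (hm : m ≠ 0) {c : Fin 4 → V}
    (hc : (2 * Real.exp (T / m)) • c 2 = -(m • c 1)) :
    m • homogSol m ((derivCoeff m)^[2] c) T = -homogSol m (derivCoeff m c) T := by
  have hc' : c 1 = -((2 * m⁻¹ * Real.exp (T / m)) • c 2) := by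
    rw [mul_right_comm, mul_comm, mul_smul, hc, smul_neg, neg_neg, inv_smul_smul₀ hm]
  simp only [homogSol, derivCoeff, Function.iterate_succ, Function.iterate_zero,
    Function.comp_apply, id, Matrix.cons_val, hc']
  match_scalars <;> field_simp
  ring

end HomogeneousEquation

/-! ### Covariances of the free path and of the bridge -/

/-- The coefficients of `t ↦ freeCov m s t` in the fundamental system for `t ≤ s`. -/
def lowerCoeff (m s : ℝ) : Fin 4 → ℝ :=
  ![-(m / 2 * (1 - Real.exp (-s / m))), 1, -(m / 2 * Real.exp (-s / m)), m / 2]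

/-- The coefficients of `t ↦ freeCov m s t` in the fundamental system for `s ≤ t`. -/
def upperCoeff (m s : ℝ) : Fin 4 → ℝ :=
  ![s - m / 2 * (1 - Real.exp (-s / m)), 0, 0, m / 2 * (1 - Real.exp (s / m))]

/-- The covariance of each component of the free Langevin path between the times `s` and `t`. -/
def freeCov (m s t : ℝ) : ℝ :=
  min s t - m / 2 * (1 - Real.exp (-s / m) - Real.exp (-t / m) + Real.exp (-|s - t| / m))

/-- The covariance `freeCov m t T` between the path at time `t ≤ T` and its endpoint, continued
smoothly to all `t`. -/
def endpointCov (m T t : ℝ) : ℝ :=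
  homogSol m (lowerCoeff m T) t

/-- The covariance of each component of the bridge, that is, of the residual of the free path
after linear regression on its endpoint. -/
def bridgeCov (m T s t : ℝ) : ℝ :=
  freeCov m s t - endpointCov m T s / endpointCov m T T * endpointCov m T t

lemma freeCov_comm (m s t : ℝ) : freeCov m s t = freeCov m t s := by
  simp only [freeCov, min_comm s, abs_sub_comm s]
  ring

lemma bridgeCov_comm (m T s t : ℝ) : bridgeCov m T s t = bridgeCov m T t s := by
  simp only [bridgeCov, freeCov_comm m s]
  ring

lemma freeCov_of_ge {m s t : ℝ} (h : t ≤ s) : freeCov m s t = homogSol m (lowerCoeff m s) t := by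
  have hexp : Real.exp (-(s - t) / m) = Real.exp (-s / m) * Real.exp (t / m) := by
    rw [← Real.exp_add]; ring_nf
  simp only [freeCov, min_eq_right h, abs_of_nonneg (sub_nonneg.2 h), hexp, homogSol, lowerCoeff,
    Matrix.cons_val, smul_eq_mul]
  ring

lemma freeCov_of_le {m s t : ℝ} (h : s ≤ t) : freeCov m s t = homogSol m (upperCoeff m s) t := by
  have hexp : Real.exp (-(t - s) / m) = Real.exp (s / m) * Real.exp (-t / m) := by
    rw [← Real.exp_add]; ring_nf
  simp only [freeCov, min_eq_left h, abs_sub_comm s, abs_of_nonneg (sub_nonneg.2 h), hexp,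
    homogSol, upperCoeff, Matrix.cons_val, smul_eq_mul]
  ring

lemma freeCov_endpoint {m T t : ℝ} (h : t ≤ T) : freeCov m t T = endpointCov m T t := by
  rw [freeCov_comm, freeCov_of_ge h, endpointCov]

lemma continuous_freeCov (m : ℝ) : Continuous fun p : ℝ × ℝ => freeCov m p.1 p.2 := by
  unfold freeCov
  fun_prop

lemma continuous_endpointCov (m T : ℝ) : Continuous (endpointCov m T) :=
  continuous_homogSol m continuous_const continuous_id

lemma endpointCov_zero (m T : ℝ) : endpointCov m T 0 = 0 := by
  simp only [endpointCov, homogSol, lowerCoeff, Matrix.cons_val, smul_eq_mul, zero_div, neg_zero,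
    Real.exp_zero]
  ring

lemma endpointCov_self {m : ℝ} (T : ℝ) :
    endpointCov m T T = T - m * (1 - Real.exp (-T / m)) := by
  rw [← freeCov_endpoint le_rfl, freeCov, sub_self, abs_zero, neg_zero, zero_div, Real.exp_zero,
    min_self]
  ring

lemma endpointCov_self_pos {m T : ℝ} (hm : 0 < m) (hT : 0 < T) : 0 < endpointCov m T T := by
  have h : -T / m + 1 < Real.exp (-T / m) :=
    Real.add_one_lt_exp (div_ne_zero (neg_ne_zero.2 hT.ne') hm.ne')
  have h' := mul_lt_mul_of_pos_left h hm
  have hcancel : m * (-T / m) = -T := mul_div_cancel₀ _ hm.ne'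
  rw [endpointCov_self]
  linarith

lemma continuous_bridgeCov (m T : ℝ) : Continuous fun p : ℝ × ℝ => bridgeCov m T p.1 p.2 := by
  have h₁ := continuous_freeCov m
  have h₂ := continuous_endpointCov m T
  unfold bridgeCov
  fun_prop

lemma bridgeCov_zero_right (m T : ℝ) {s : ℝ} (hs : 0 ≤ s) : bridgeCov m T s 0 = 0 := by
  have h : freeCov m s 0 = 0 := by
    rw [freeCov, min_eq_right hs, sub_zero, abs_of_nonneg hs, neg_zero, zero_div, Real.exp_zero]
    ring
  rw [bridgeCov, h, endpointCov_zero, mul_zero, sub_zero]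

lemma bridgeCov_endpoint {m T s : ℝ} (hm : 0 < m) (hT : 0 < T) (hs : s ≤ T) :
    bridgeCov m T s T = 0 := by
  rw [bridgeCov, freeCov_endpoint hs, div_mul_cancel₀ _ (endpointCov_self_pos hm hT).ne', sub_self]

/-! ### Derivatives of the bridge covariance -/

/-- The coefficients of `t ↦ bridgeCov m T s t` in the fundamental system for `t ≤ s`. -/
def bridgeLowerCoeff (m T s : ℝ) : Fin 4 → ℝ :=
  lowerCoeff m s - (endpointCov m T s / endpointCov m T T) • lowerCoeff m T

/-- The coefficients of `t ↦ bridgeCov m T s t` in the fundamental system for `s ≤ t`. -/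
def bridgeUpperCoeff (m T s : ℝ) : Fin 4 → ℝ :=
  upperCoeff m s - (endpointCov m T s / endpointCov m T T) • lowerCoeff m T

/-- The derivative of order `j` of `t ↦ bridgeCov m T s t`.  At `t = s`, where the derivatives of
order at least three jump, it is the derivative from the left. -/
def bridgeCovDeriv (m T : ℝ) (j : ℕ) (t s : ℝ) : ℝ :=
  if t ≤ s then homogSol m ((derivCoeff m)^[j] (bridgeLowerCoeff m T s)) t
  else homogSol m ((derivCoeff m)^[j] (bridgeUpperCoeff m T s)) t

lemma homogSol_sub_smul {V : Type*} [NormedAddCommGroup V] [NormedSpace ℝ V]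
    (m r : ℝ) (c c' : Fin 4 → V) (t : ℝ) :
    homogSol m (c - r • c') t = homogSol m c t - r • homogSol m c' t := by
  simp only [homogSol, Pi.sub_apply, Pi.smul_apply]
  module

lemma bridgeCovDeriv_zero (m T t s : ℝ) : bridgeCovDeriv m T 0 t s = bridgeCov m T s t := by
  simp only [bridgeCovDeriv, Function.iterate_zero, id, bridgeLowerCoeff, bridgeUpperCoeff,
    homogSol_sub_smul]
  split_ifs with h
  · rw [bridgeCov, freeCov_of_ge h, smul_eq_mul, ← endpointCov.eq_1 m T t]
  · rw [bridgeCov, freeCov_of_le (not_le.1 h).le, smul_eq_mul, endpointCov.eq_1 m T t]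

lemma bridgeCovDeriv_four {m : ℝ} (hm : m ≠ 0) (T t s : ℝ) :
    m ^ 2 * bridgeCovDeriv m T 4 t s = bridgeCovDeriv m T 2 t s := by
  unfold bridgeCovDeriv
  split_ifs <;> exact homogSol_equation hm _ t

/-- The jump of the third derivative is what produces the Dirac mass. -/
lemma bridgeCov_jump {m : ℝ} (hm : m ≠ 0) (T s : ℝ) {j : ℕ} (hj : j ≤ 3) :
    homogSol m ((derivCoeff m)^[j] (bridgeLowerCoeff m T s)) s -
      homogSol m ((derivCoeff m)^[j] (bridgeUpperCoeff m T s)) s =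
      if j = 3 then -(m ^ 2)⁻¹ else 0 := by
  have h : Real.exp (-(s / m)) * Real.exp (s / m) = 1 := by
    rw [← Real.exp_add, neg_add_cancel, Real.exp_zero]
  interval_cases j <;>
    simp only [homogSol, derivCoeff, bridgeLowerCoeff, bridgeUpperCoeff, lowerCoeff, upperCoeff,
      Function.iterate_succ, Function.iterate_zero, Function.comp_apply, id, Matrix.cons_val,
      Pi.sub_apply, Pi.smul_apply, smul_eq_mul, OfNat.zero_ne_ofNat, OfNat.one_ne_ofNat,
      Nat.reduceEqDiff, if_true, if_false]
  · ring
  · field_simp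
    linear_combination -2 * m * h
  · field_simp
    ring
  · field_simp
    linear_combination -2 * m * h

lemma continuous_bridgeCoeffs (m T : ℝ) (j : ℕ) :
    (Continuous fun p : ℝ × ℝ => homogSol m ((derivCoeff m)^[j] (bridgeLowerCoeff m T p.2)) p.1) ∧
      Continuous fun p : ℝ × ℝ =>
        homogSol m ((derivCoeff m)^[j] (bridgeUpperCoeff m T p.2)) p.1 := by
  have hend := continuous_endpointCov m T
  have hlower : Continuous (lowerCoeff m) := by
    refine continuous_pi fun i => ?_
    fin_cases i <;> simp only [lowerCoeff] <;> dsimp <;> fun_prop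
  have hupper : Continuous (upperCoeff m) := by
    refine continuous_pi fun i => ?_
    fin_cases i <;> simp only [upperCoeff] <;> dsimp <;> fun_prop
  have hD := (continuous_derivCoeff (V := ℝ) m).iterate j
  unfold bridgeLowerCoeff bridgeUpperCoeff
  exact ⟨continuous_homogSol m (hD.comp (by fun_prop)) continuous_fst,
    continuous_homogSol m (hD.comp (by fun_prop)) continuous_fst⟩

lemma measurable_bridgeCovDeriv (m T : ℝ) (j : ℕ) :
    Measurable (Function.uncurry (bridgeCovDeriv m T j)) :=
  Measurable.ite (measurableSet_le measurable_fst measurable_snd)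
    (continuous_bridgeCoeffs m T j).1.measurable (continuous_bridgeCoeffs m T j).2.measurable

lemma continuous_bridgeCovDeriv {m : ℝ} (hm : m ≠ 0) (T : ℝ) {j : ℕ} (hj : j ≤ 2) :
    Continuous (Function.uncurry (bridgeCovDeriv m T j)) := by
  refine Continuous.if_le (continuous_bridgeCoeffs m T j).1 (continuous_bridgeCoeffs m T j).2
    continuous_fst continuous_snd fun p hp => ?_
  have h := bridgeCov_jump hm T p.2 (j := j) (by lia)
  rw [if_neg (by lia), sub_eq_zero] at h
  rw [hp, h]

lemma hasDerivAt_ite_le {V : Type*} [NormedAddCommGroup V] [NormedSpace ℝ V] {s : ℝ}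
    {f f' g g' : ℝ → V} (hf : ∀ t, HasDerivAt f (f' t) t) (hg : ∀ t, HasDerivAt g (g' t) t)
    (h : f s = g s) (h' : f' s = g' s) (t : ℝ) :
    HasDerivAt (fun t => if t ≤ s then f t else g t) (if t ≤ s then f' t else g' t) t := by
  rcases lt_trichotomy t s with hts | rfl | hts
  · rw [if_pos hts.le]
    refine (hf t).congr_of_eventuallyEq ?_
    filter_upwards [Iio_mem_nhds hts] with r hr using if_pos hr.le
  · rw [if_pos le_rfl, ← hasDerivWithinAt_univ, ← Iic_union_Ici (a := t)]
    refine HasDerivWithinAt.union ?_ ?_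
    · exact (hf t).hasDerivWithinAt.congr (fun r hr => if_pos hr) (if_pos le_rfl)
    · rw [h']
      refine (hg t).hasDerivWithinAt.congr (fun r hr => ?_) ((if_pos le_rfl).trans h)
      rcases eq_or_lt_of_le (mem_Ici.1 hr) with rfl | hr
      · exact (if_pos le_rfl).trans h
      · exact if_neg hr.not_ge
  · rw [if_neg hts.not_ge]
    refine (hg t).congr_of_eventuallyEq ?_
    filter_upwards [Ioi_mem_nhds hts] with r hr using if_neg hr.not_ge

lemma hasDerivAt_bridgeCovDeriv {m : ℝ} (hm : m ≠ 0) (T : ℝ) {j : ℕ} (hj : j ≤ 1) (s t : ℝ) :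
    HasDerivAt (fun t => bridgeCovDeriv m T j t s) (bridgeCovDeriv m T (j + 1) t s) t := by
  have hjump (k : ℕ) (hk : k ≤ 2) := bridgeCov_jump hm T s (j := k) (by lia)
  refine hasDerivAt_ite_le (hasDerivAt_homogSol_iterate m _ j) (hasDerivAt_homogSol_iterate m _ j)
    (sub_eq_zero.1 ((hjump j (by lia)).trans (if_neg (by lia))))
    (sub_eq_zero.1 ((hjump (j + 1) (by lia)).trans (if_neg (by lia)))) t

lemma bridgeCovDeriv_robin_left {m : ℝ} (hm : m ≠ 0) (T : ℝ) {s : ℝ} (hs : 0 ≤ s) :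
    m * bridgeCovDeriv m T 2 0 s = bridgeCovDeriv m T 1 0 s := by
  rw [bridgeCovDeriv, bridgeCovDeriv, if_pos hs, if_pos hs]
  refine homogSol_robin_left hm ?_
  simp only [bridgeLowerCoeff, lowerCoeff, Pi.sub_apply, Pi.smul_apply, Matrix.cons_val,
    smul_eq_mul]
  ring

lemma lowerCoeff_robin_right (m T : ℝ) :
    2 * Real.exp (T / m) * lowerCoeff m T 2 = -(m * lowerCoeff m T 1) := by
  have h : Real.exp (T / m) * Real.exp (-T / m) = 1 := by
    rw [← Real.exp_add, neg_div, add_neg_cancel, Real.exp_zero]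
  simp only [lowerCoeff, Matrix.cons_val]
  linear_combination (-m) * h

lemma bridgeCovDeriv_robin_right {m T s : ℝ} (hm : m ≠ 0) (hs : s ≤ T) :
    m * bridgeCovDeriv m T 2 T s = -bridgeCovDeriv m T 1 T s := by
  have hupper {j : ℕ} (hj : j ≤ 2) : bridgeCovDeriv m T j T s =
      homogSol m ((derivCoeff m)^[j] (bridgeUpperCoeff m T s)) T := by
    rcases hs.eq_or_lt with rfl | hlt
    · rw [bridgeCovDeriv, if_pos le_rfl]
      exact sub_eq_zero.1 ((bridgeCov_jump hm s s (by lia)).trans (if_neg (by lia)))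
    · rw [bridgeCovDeriv, if_neg hlt.not_ge]
  rw [hupper le_rfl, hupper one_le_two]
  refine homogSol_robin_right hm ?_
  have h := lowerCoeff_robin_right m T
  simp only [bridgeUpperCoeff, upperCoeff, Pi.sub_apply, Pi.smul_apply, Matrix.cons_val,
    smul_eq_mul]
  linear_combination (-(endpointCov m T s / endpointCov m T T)) * h

/-! ### Test functions -/

lemma IsTestFunction.deriv {T : ℝ} {φ : ℝ → ℝ} (h : IsTestFunction T φ) :
    IsTestFunction T (deriv φ) where
  smooth := (contDiff_infty_iff_deriv.1 h.smooth).2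
  compact := h.compact.deriv
  support := (closure_minimal support_deriv_subset (isClosed_tsupport φ)).trans h.support

lemma IsTestFunction.eq_zero {T : ℝ} {φ : ℝ → ℝ} (h : IsTestFunction T φ) {t : ℝ}
    (ht : t ∉ Ioo 0 T) : φ t = 0 :=
  image_eq_zero_of_notMem_tsupport fun hh => ht (h.support hh)

lemma IsTestFunction.hasDerivAt {T : ℝ} {φ : ℝ → ℝ} (h : IsTestFunction T φ) (t : ℝ) :
    HasDerivAt φ (_root_.deriv φ t) t :=
  (h.smooth.differentiable (by simp) t).hasDerivAt

lemma integral_Icc_ite_le {V : Type*} [NormedAddCommGroup V] [NormedSpace ℝ V] {a b s : ℝ}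
    (hs : s ∈ Icc a b) {f g : ℝ → V} (hf : Continuous f) (hg : Continuous g) :
    ∫ t in Icc a b, (if t ≤ s then f t else g t) = (∫ t in a..s, f t) + ∫ t in s..b, g t := by
  have hleft : EqOn f (fun t => if t ≤ s then f t else g t) (Ioc a s) :=
    fun t ht => (if_pos ht.2).symm
  have hright : EqOn g (fun t => if t ≤ s then f t else g t) (Ioc s b) :=
    fun t ht => (if_neg ht.1.not_ge).symm
  have hfi : IntegrableOn f (Ioc a s) := hf.integrableOn_Icc.mono_set Ioc_subset_Icc_self
  have hgi : IntegrableOn g (Ioc s b) := hg.integrableOn_Icc.mono_set Ioc_subset_Icc_self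
  rw [integral_Icc_eq_integral_Ioc, ← Ioc_union_Ioc_eq_Ioc hs.1 hs.2,
    setIntegral_union (Ioc_disjoint_Ioc_of_le le_rfl) measurableSet_Ioc
      (hfi.congr_fun hleft measurableSet_Ioc) (hgi.congr_fun hright measurableSet_Ioc),
    intervalIntegral.integral_of_le hs.1, intervalIntegral.integral_of_le hs.2,
    setIntegral_congr_fun measurableSet_Ioc hleft, setIntegral_congr_fun measurableSet_Ioc hright]

lemma IsTestFunction.integral_deriv_mul_ite {T s : ℝ} (hs : s ∈ Icc 0 T) {φ : ℝ → ℝ}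
    (hφ : IsTestFunction T φ) {f f' g g' : ℝ → ℝ}
    (hf : ∀ t, HasDerivAt f (f' t) t) (hf' : Continuous f')
    (hg : ∀ t, HasDerivAt g (g' t) t) (hg' : Continuous g') :
    ∫ t in Icc 0 T, _root_.deriv φ t * (if t ≤ s then f t else g t) =
      φ s * (f s - g s) - ∫ t in Icc 0 T, φ t * (if t ≤ s then f' t else g' t) := by
  have hcont {h h' : ℝ → ℝ} (hh : ∀ t, HasDerivAt h (h' t) t) : Continuous h :=
    continuous_iff_continuousAt.2 fun t => (hh t).continuousAt
  have hcφ := hφ.smooth.continuous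
  have hcφ' := hφ.deriv.smooth.continuous
  have parts {h h' : ℝ → ℝ} (hh : ∀ t, HasDerivAt h (h' t) t) (hh' : Continuous h') (a b : ℝ) :
      ∫ t in a..b, _root_.deriv φ t * h t =
        φ b * h b - φ a * h a - ∫ t in a..b, φ t * h' t := by
    rw [intervalIntegral.integral_mul_deriv_eq_deriv_mul (u := φ) (v := h)
      (fun t _ => hφ.hasDerivAt t) (fun t _ => hh t) (hcφ'.intervalIntegrable _ _)
      (hh'.intervalIntegrable _ _)]
    ring
  have split {ψ h k : ℝ → ℝ} (hψ : Continuous ψ) (hh : Continuous h) (hk : Continuous k) :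
      ∫ t in Icc 0 T, ψ t * (if t ≤ s then h t else k t) =
        (∫ t in (0 : ℝ)..s, ψ t * h t) + ∫ t in s..T, ψ t * k t := by
    simp only [mul_ite]
    exact integral_Icc_ite_le hs (hψ.mul hh) (hψ.mul hk)
  rw [split hcφ' (hcont hf) (hcont hg), split hcφ hf' hg', parts hf hf', parts hg hg',
    hφ.eq_zero (t := 0) (by simp), hφ.eq_zero (t := T) (by simp)]
  ring

lemma IsTestFunction.integral_deriv_mul_bridgeCovDeriv {m T s : ℝ} (hm : m ≠ 0)
    (hs : s ∈ Icc 0 T) {φ : ℝ → ℝ} (hφ : IsTestFunction T φ) {j : ℕ} (hj : j ≤ 3) :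
    ∫ t in Icc 0 T, _root_.deriv φ t * bridgeCovDeriv m T j t s =
      φ s * (if j = 3 then -(m ^ 2)⁻¹ else 0) -
        ∫ t in Icc 0 T, φ t * bridgeCovDeriv m T (j + 1) t s := by
  have hcont (c : Fin 4 → ℝ) : Continuous (homogSol m c) :=
    continuous_homogSol m continuous_const continuous_id
  simp only [← bridgeCov_jump hm T s hj, bridgeCovDeriv]
  exact hφ.integral_deriv_mul_ite hs (hasDerivAt_homogSol_iterate m _ j) (hcont _)
    (hasDerivAt_homogSol_iterate m _ j) (hcont _)

lemma IsTestFunction.integral_iteratedDeriv_mul_bridgeCov {m T s : ℝ} (hm : m ≠ 0)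
    (hs : s ∈ Icc 0 T) {φ : ℝ → ℝ} (hφ : IsTestFunction T φ) {k : ℕ} (hk : k ≤ 3) :
    ∫ t in Icc 0 T, iteratedDeriv k φ t * bridgeCov m T s t =
      (-1) ^ k * ∫ t in Icc 0 T, φ t * bridgeCovDeriv m T k t s := by
  induction k generalizing φ with
  | zero => simp only [iteratedDeriv_zero, bridgeCovDeriv_zero, pow_zero, one_mul]
  | succ k ih =>
    rw [iteratedDeriv_succ', ih hφ.deriv (by lia),
      hφ.integral_deriv_mul_bridgeCovDeriv hm hs (by lia), if_neg (by lia)]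
    ring

lemma IsTestFunction.integral_iteratedDeriv_four_mul_bridgeCov {m T s : ℝ} (hm : m ≠ 0)
    (hs : s ∈ Icc 0 T) {φ : ℝ → ℝ} (hφ : IsTestFunction T φ) :
    ∫ t in Icc 0 T, iteratedDeriv 4 φ t * bridgeCov m T s t =
      (∫ t in Icc 0 T, φ t * bridgeCovDeriv m T 4 t s) + φ s / m ^ 2 := by
  rw [iteratedDeriv_succ', hφ.deriv.integral_iteratedDeriv_mul_bridgeCov hm hs le_rfl,
    hφ.integral_deriv_mul_bridgeCovDeriv hm hs le_rfl, if_pos rfl]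
  ring

/-! ### The Green's function and the mean path -/

section DerivativeChain

variable {V : Type*} [NormedAddCommGroup V] [NormedSpace ℝ V] {n : ℕ} {F : ℕ → ℝ → V}

lemma contDiff_of_hasDerivAt_chain (hF : ∀ j < n, ∀ t, HasDerivAt (F j) (F (j + 1) t) t)
    (hc : Continuous (F n)) : ContDiff ℝ n (F 0) := by
  induction n generalizing F with
  | zero => exact contDiff_zero.2 hc
  | succ n ih =>
    rw [Nat.cast_succ, contDiff_succ_iff_deriv]
    refine ⟨fun t => (hF 0 (by lia) t).differentiableAt, by simp, ?_⟩
    rw [funext fun t => (hF 0 (by lia) t).deriv]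
    exact ih (F := fun j => F (j + 1)) (fun j hj => hF (j + 1) (by lia)) hc

lemma iteratedDeriv_of_hasDerivAt_chain (hF : ∀ j < n, ∀ t, HasDerivAt (F j) (F (j + 1) t) t)
    {j : ℕ} (hj : j ≤ n) : iteratedDeriv j (F 0) = F j := by
  induction j with
  | zero => exact iteratedDeriv_zero
  | succ j ih =>
    rw [iteratedDeriv_succ, ih (by lia)]
    exact funext fun t => (hF j (by lia) t).deriv

lemma iteratedDerivWithin_Icc_of_hasDerivAt_chain
    (hF : ∀ j < n, ∀ t, HasDerivAt (F j) (F (j + 1) t) t) (hc : Continuous (F n)) {j : ℕ}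
    (hj : j ≤ n) {a b t : ℝ} (hab : a < b) (ht : t ∈ Icc a b) :
    iteratedDerivWithin j (F 0) (Icc a b) t = F j t := by
  rw [iteratedDerivWithin_eq_iteratedDeriv (uniqueDiffOn_Icc hab)
    ((contDiff_of_hasDerivAt_chain hF hc).of_le (by exact_mod_cast hj)).contDiffAt ht,
    iteratedDeriv_of_hasDerivAt_chain hF hj]

end DerivativeChain

lemma integral_bridgeCov_mul_adjoint {m T s : ℝ} (hm : m ≠ 0) (hs : s ∈ Icc 0 T) {φ : ℝ → ℝ}
    (hφ : IsTestFunction T φ) :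
    ∫ t in Icc 0 T, bridgeCov m T s t * (m ^ 2 * iteratedDeriv 4 φ t - iteratedDeriv 2 φ t) =
      φ s := by
  have hcont : Continuous (bridgeCov m T s) :=
    (continuous_bridgeCov m T).comp (continuous_const.prodMk continuous_id)
  have hint (k) : IntegrableOn (fun t => iteratedDeriv k φ t * bridgeCov m T s t) (Icc 0 T) :=
    ((hφ.continuous_iteratedDeriv k).mul hcont).integrableOn_Icc
  have hfour : ∫ t in Icc 0 T, φ t * bridgeCovDeriv m T 2 t s =
      m ^ 2 * ∫ t in Icc 0 T, φ t * bridgeCovDeriv m T 4 t s := by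
    rw [← integral_const_mul]
    simp only [← bridgeCovDeriv_four hm, mul_left_comm]
  calc ∫ t in Icc 0 T, bridgeCov m T s t * (m ^ 2 * iteratedDeriv 4 φ t - iteratedDeriv 2 φ t)
      = m ^ 2 * (∫ t in Icc 0 T, iteratedDeriv 4 φ t * bridgeCov m T s t) -
          ∫ t in Icc 0 T, iteratedDeriv 2 φ t * bridgeCov m T s t := by
        rw [← integral_const_mul, ← integral_sub ((hint 4).const_mul _) (hint 2)]
        congr with t
        ring
    _ = φ s := by
        rw [hφ.integral_iteratedDeriv_four_mul_bridgeCov hm hs,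
          hφ.integral_iteratedDeriv_mul_bridgeCov hm hs (by norm_num), hfour]
        field_simp
        ring

lemma isGreenFunction_bridgeCov {m T : ℝ} (hm : 0 < m) (hT : 0 < T) :
    IsGreenFunction m T (bridgeCov m T) := by
  have hzero (s) : (fun t => bridgeCovDeriv m T 0 t s) = bridgeCov m T s :=
    funext fun t => bridgeCovDeriv_zero m T t s
  have hchain (s : ℝ) (j : ℕ) (hj : j < 2) := hasDerivAt_bridgeCovDeriv hm.ne' T (j := j) (by lia) s
  have hcont (s : ℝ) : Continuous fun t => bridgeCovDeriv m T 2 t s :=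
    (continuous_bridgeCovDeriv hm.ne' T le_rfl).comp (continuous_id.prodMk continuous_const)
  have hderiv (s : ℝ) {j : ℕ} (hj : j ≤ 2) {t : ℝ} (ht : t ∈ Icc 0 T) :
      iteratedDerivWithin j (bridgeCov m T s) (Icc 0 T) t = bridgeCovDeriv m T j t s := by
    rw [← hzero]
    exact iteratedDerivWithin_Icc_of_hasDerivAt_chain (F := fun j t => bridgeCovDeriv m T j t s)
      (hchain s) (hcont s) hj hT ht
  have h0 : (0 : ℝ) ∈ Icc 0 T := left_mem_Icc.2 hT.le
  have h1 : T ∈ Icc 0 T := right_mem_Icc.2 hT.le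
  refine ⟨(continuous_bridgeCov m T).continuousOn, fun s _ => ?_,
    fun s hs φ hφ => integral_bridgeCov_mul_adjoint hm.ne' hs hφ,
    fun s hs => bridgeCov_zero_right m T hs.1, fun s hs => bridgeCov_endpoint hm hT hs.2,
    fun s hs => ?_, fun s hs => ?_⟩
  · rw [← hzero]
    exact (contDiff_of_hasDerivAt_chain (F := fun j t => bridgeCovDeriv m T j t s)
      (hchain s) (hcont s)).contDiffOn
  · rw [← iteratedDerivWithin_one, hderiv s le_rfl h0, hderiv s one_le_two h0,
      bridgeCovDeriv_robin_left hm.ne' T hs.1]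
  · rw [← iteratedDerivWithin_one, hderiv s le_rfl h1, hderiv s one_le_two h1,
      bridgeCovDeriv_robin_right hm.ne' hs.2]

lemma isMeanPath_homogSol {d : ℕ} {m T : ℝ} (hm : m ≠ 0) (hT : 0 < T) {c : Fin 4 → E d}
    (hleft : m • c 1 = (2 : ℝ) • c 3) (hright : (2 * Real.exp (T / m)) • c 2 = -(m • c 1)) :
    IsMeanPath m T (homogSol m c 0) (homogSol m c T) (homogSol m c) := by
  have hchain : ∀ j < 4, ∀ t, HasDerivAt (homogSol m ((derivCoeff m)^[j] c))
      (homogSol m ((derivCoeff m)^[j + 1] c) t) t :=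
    fun j _ => hasDerivAt_homogSol_iterate m c j
  have hcont : Continuous (homogSol m ((derivCoeff m)^[4] c)) :=
    continuous_homogSol m continuous_const continuous_id
  have hderiv {j : ℕ} (hj : j ≤ 4) {t : ℝ} (ht : t ∈ Icc 0 T) :
      iteratedDerivWithin j (homogSol m c) (Icc 0 T) t = homogSol m ((derivCoeff m)^[j] c) t :=
    iteratedDerivWithin_Icc_of_hasDerivAt_chain (F := fun j => homogSol m ((derivCoeff m)^[j] c))
      hchain hcont hj hT ht
  have h0 : (0 : ℝ) ∈ Icc 0 T := left_mem_Icc.2 hT.le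
  have h1 : T ∈ Icc 0 T := right_mem_Icc.2 hT.le
  refine ⟨(contDiff_of_hasDerivAt_chain (F := fun j => homogSol m ((derivCoeff m)^[j] c))
    hchain hcont).contDiffOn, fun t ht => ?_, rfl, rfl, ?_, ?_⟩
  · rw [hderiv le_rfl ht, hderiv (by norm_num) ht, neg_smul, homogSol_equation hm, neg_add_cancel]
  · rw [← iteratedDerivWithin_one, hderiv (by norm_num) h0, hderiv (by norm_num) h0]
    exact homogSol_robin_left hm hleft
  · rw [← iteratedDerivWithin_one, hderiv (by norm_num) h1, hderiv (by norm_num) h1]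
    exact homogSol_robin_right hm hright

/-- The mean of the bridge from `xminus` to `xplus`: the linear regression of the free path on its
endpoint. -/
def bridgeMean {d : ℕ} (m T : ℝ) (xminus xplus : E d) (t : ℝ) : E d :=
  xminus + (endpointCov m T t / endpointCov m T T) • (xplus - xminus)

lemma continuous_bridgeMean {d : ℕ} (m T : ℝ) (xminus xplus : E d) :
    Continuous (bridgeMean m T xminus xplus) := by
  have := continuous_endpointCov m T
  unfold bridgeMean
  fun_prop

lemma isMeanPath_bridgeMean {d : ℕ} {m T : ℝ} (hm : 0 < m) (hT : 0 < T) (xminus xplus : E d) :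
    IsMeanPath m T xminus xplus (bridgeMean m T xminus xplus) := by
  set c : Fin 4 → E d := fun i =>
    (Pi.single 0 xminus : Fin 4 → E d) i +
      (lowerCoeff m T i / endpointCov m T T) • (xplus - xminus)
  have hsol : homogSol m c = bridgeMean m T xminus xplus := by
    funext t
    simp only [c, bridgeMean, endpointCov, homogSol, Pi.single_eq_same, smul_eq_mul,
      Pi.single_eq_of_ne, ne_eq, Fin.reduceEq, one_ne_zero, not_false_eq_true, zero_add]
    module
  have hleft : bridgeMean m T xminus xplus 0 = xminus := by
    rw [bridgeMean, endpointCov_zero, zero_div, zero_smul, add_zero]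
  have hright : bridgeMean m T xminus xplus T = xplus := by
    rw [bridgeMean, div_self (endpointCov_self_pos hm hT).ne', one_smul, add_sub_cancel]
  have hc (i : Fin 4) (hi : i ≠ 0) :
      c i = (lowerCoeff m T i / endpointCov m T T) • (xplus - xminus) := by
    simp only [c, Pi.single_eq_of_ne hi, zero_add]
  have h := isMeanPath_homogSol (c := c) hm.ne' hT ?_ ?_
  · rwa [hsol, hleft, hright] at h
  · rw [hc 1 (by decide), hc 3 (by decide), smul_smul, smul_smul]
    simp only [lowerCoeff, Matrix.cons_val]
    congr 1
    ring
  · rw [hc 1 (by decide), hc 2 (by decide), smul_smul, smul_smul, ← neg_smul]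
    congr 1
    linear_combination (endpointCov m T T)⁻¹ * lowerCoeff_robin_right m T

/-! ### Integral operators with bounded kernels -/

section FiniteMeasure

variable {α F : Type*} [MeasurableSpace α] {μ : Measure α} [IsFiniteMeasure μ]
  [NormedAddCommGroup F]

lemma integrable_lp_two (g : Lp F 2 μ) : Integrable g μ :=
  (Lp.memLp g).integrable (by norm_num)

lemma integral_norm_lp_two_le (g : Lp F 2 μ) :
    ∫ t, ‖g t‖ ∂μ ≤ (μ univ ^ (1 / 2 : ℝ)).toReal * ‖g‖ := by
  have hμ : μ univ ^ (1 / 2 : ℝ) ≠ ⊤ := ENNReal.rpow_ne_top_of_nonneg (by norm_num) (by simp)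
  have hexp : 1 / (1 : ENNReal).toReal - 1 / (2 : ENNReal).toReal = 1 / 2 := by norm_num
  rw [integral_norm_eq_lintegral_enorm (Lp.aestronglyMeasurable g),
    ← eLpNorm_one_eq_lintegral_enorm, Lp.norm_def, ← ENNReal.toReal_mul, mul_comm, ← hexp]
  exact ENNReal.toReal_mono (ENNReal.mul_ne_top (Lp.eLpNorm_ne_top g) (by rwa [hexp]))
    (eLpNorm_le_eLpNorm_mul_rpow_measure_univ (by norm_num) (Lp.aestronglyMeasurable g))

end FiniteMeasure

section Kernel

variable {α F : Type*} [MeasurableSpace α] {μ : Measure α} [NormedAddCommGroup F] [NormedSpace ℝ F]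
  {H : α → α → ℝ}

/-- The integral `s ↦ ∫ H(s,t) g(t) dμ(t)` of a function against a scalar kernel. -/
def kernelIntegral (μ : Measure α) (H : α → α → ℝ) (g : α → F) (s : α) : F :=
  ∫ t, H s t • g t ∂μ

lemma kernelIntegral_congr_ae {g h : α → F} (hgh : g =ᵐ[μ] h) :
    kernelIntegral μ H g = kernelIntegral μ H h :=
  funext fun _ => integral_congr_ae (hgh.mono fun t ht => by simp only [ht])

lemma kernelIntegral_const_smul (H : α → α → ℝ) (c : ℝ) (g : α → F) :
    kernelIntegral μ H (c • g) = c • kernelIntegral μ H g :=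
  funext fun s => by simp only [kernelIntegral, Pi.smul_apply, smul_comm _ c, integral_smul]

/-- A scalar kernel that is measurable and essentially bounded; on a finite measure space it
defines a bounded integral operator on `L²`. -/
structure IsBoundedKernel (μ : Measure α) (H : α → α → ℝ) : Prop where
  measurable : Measurable (Function.uncurry H)
  bounded : ∃ M, ∀ᵐ p ∂μ.prod μ, |H p.1 p.2| ≤ M

namespace IsBoundedKernel

lemma integrable_prod [SFinite μ] (hH : IsBoundedKernel μ H) {ψ : α → ℝ} (hψ : Integrable ψ μ)
    {g : α → F} (hg : Integrable g μ) :
    Integrable (fun p : α × α => H p.1 p.2 • ψ p.1 • g p.2) (μ.prod μ) := by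
  obtain ⟨M, hM⟩ := hH.bounded
  exact (hψ.smul_prod hg).bdd_smul M hH.measurable.aestronglyMeasurable hM

lemma ae_integrable [IsFiniteMeasure μ] (hH : IsBoundedKernel μ H) {g : α → F}
    (hg : Integrable g μ) : ∀ᵐ s ∂μ, Integrable (fun t => H s t • g t) μ := by
  simpa only [one_smul] using (hH.integrable_prod (integrable_const 1) hg).prod_right_ae

lemma integral_smul_kernelIntegral [SFinite μ] [CompleteSpace F] (hH : IsBoundedKernel μ H)
    {ψ : α → ℝ} (hψ : Integrable ψ μ) {g : α → F} (hg : Integrable g μ) :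
    ∫ s, ψ s • kernelIntegral μ H g s ∂μ = ∫ t, (∫ s, ψ s * H s t ∂μ) • g t ∂μ := by
  simp_rw [kernelIntegral, ← integral_smul, smul_comm (ψ _) (H _ _)]
  rw [integral_integral_swap (hH.integrable_prod hψ hg)]
  simp only [smul_smul, integral_smul_const, mul_comm]

lemma kernelIntegral_add [IsFiniteMeasure μ] (hH : IsBoundedKernel μ H) {g h : α → F}
    (hg : Integrable g μ) (hh : Integrable h μ) :
    kernelIntegral μ H (g + h) =ᵐ[μ] kernelIntegral μ H g + kernelIntegral μ H h := by
  filter_upwards [hH.ae_integrable hg, hH.ae_integrable hh] with s hgs hhs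
  simp only [kernelIntegral, Pi.add_apply, smul_add, integral_add hgs hhs]

lemma aestronglyMeasurable_kernelIntegral [IsFiniteMeasure μ] (hH : IsBoundedKernel μ H)
    {g : α → F} (hg : Integrable g μ) : AEStronglyMeasurable (kernelIntegral μ H g) μ := by
  have h := (hH.integrable_prod (integrable_const 1) hg).aestronglyMeasurable
  simp only [one_smul] at h
  exact h.integral_prod_right'

lemma exists_norm_kernelIntegral_le [SFinite μ] (hH : IsBoundedKernel μ H) :
    ∃ M, 0 ≤ M ∧ ∀ g : α → F, Integrable g μ →
      ∀ᵐ s ∂μ, ‖kernelIntegral μ H g s‖ ≤ M * ∫ t, ‖g t‖ ∂μ := by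
  obtain ⟨M, hM⟩ := hH.bounded
  refine ⟨|M|, abs_nonneg M, fun g hg => ?_⟩
  filter_upwards [Measure.ae_ae_of_ae_prod hM] with s hs
  rw [← integral_const_mul]
  refine norm_integral_le_of_norm_le (hg.norm.const_mul _) (hs.mono fun t ht => ?_)
  rw [norm_smul]
  exact mul_le_mul_of_nonneg_right (ht.trans (le_abs_self M)) (norm_nonneg _)

variable [IsFiniteMeasure μ]

lemma exists_norm_kernelIntegral_lp_le (hH : IsBoundedKernel μ H) :
    ∃ M, 0 ≤ M ∧ ∀ g : Lp F 2 μ, ∀ᵐ s ∂μ, ‖kernelIntegral μ H g s‖ ≤ M * ‖g‖ := by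
  obtain ⟨M, hM0, hM⟩ := hH.exists_norm_kernelIntegral_le (F := F)
  refine ⟨M * (μ univ ^ (1 / 2 : ℝ)).toReal, by positivity, fun g => ?_⟩
  filter_upwards [hM g (integrable_lp_two g)] with s hs
  rw [mul_assoc]
  exact hs.trans (mul_le_mul_of_nonneg_left (integral_norm_lp_two_le g) hM0)

lemma memLp_kernelIntegral (hH : IsBoundedKernel μ H) (g : Lp F 2 μ) :
    MemLp (kernelIntegral μ H g) 2 μ :=
  let ⟨M, _, hM⟩ := hH.exists_norm_kernelIntegral_lp_le (F := F)
  .of_bound (hH.aestronglyMeasurable_kernelIntegral (integrable_lp_two g)) (M * ‖g‖) (hM g)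

variable (F) in
/-- The integral operator on `L²` with a bounded kernel. -/
def toCLM (hH : IsBoundedKernel μ H) : Lp F 2 μ →L[ℝ] Lp F 2 μ :=
  LinearMap.mkContinuousOfExistsBound
    { toFun := fun g => (hH.memLp_kernelIntegral g).toLp
      map_add' := fun g h => by
        rw [← MemLp.toLp_add]
        refine MemLp.toLp_congr _ _ ?_
        rw [kernelIntegral_congr_ae (Lp.coeFn_add g h)]
        exact hH.kernelIntegral_add (integrable_lp_two g) (integrable_lp_two h)
      map_smul' := fun c g => by
        rw [RingHom.id_apply, ← MemLp.toLp_const_smul]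
        refine MemLp.toLp_congr _ _ (.of_eq ?_)
        rw [kernelIntegral_congr_ae (Lp.coeFn_smul c g), kernelIntegral_const_smul] }
    (by
      obtain ⟨M, hM0, hM⟩ := hH.exists_norm_kernelIntegral_lp_le (F := F)
      refine ⟨measureUnivNNReal μ ^ (2 : ENNReal).toReal⁻¹ * M, fun g => ?_⟩
      rw [mul_assoc]
      refine Lp.norm_le_of_ae_bound (by positivity) ?_
      filter_upwards [(hH.memLp_kernelIntegral g).coeFn_toLp, hM g] with s hs hM
      exact (congrArg norm hs).trans_le hM)

lemma coeFn_toCLM (hH : IsBoundedKernel μ H) (g : Lp F 2 μ) :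
    hH.toCLM F g =ᵐ[μ] kernelIntegral μ H g :=
  (hH.memLp_kernelIntegral g).coeFn_toLp

end IsBoundedKernel

section Inner

variable {F : Type*} [NormedAddCommGroup F] [InnerProductSpace ℝ F]

lemma IsBoundedKernel.integrable_mul_inner [SFinite μ] (hH : IsBoundedKernel μ H) {g h : α → F}
    (hg : Integrable g μ) (hh : Integrable h μ) :
    Integrable (fun p : α × α => H p.1 p.2 * ⟪g p.2, h p.1⟫) (μ.prod μ) := by
  obtain ⟨M, hM⟩ := hH.bounded
  have hgh : Integrable (fun p : α × α => ⟪g p.2, h p.1⟫) (μ.prod μ) := by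
    simp_rw [real_inner_comm (h _)]
    exact Integrable.op_fst_snd (op := fun x y : F => ⟪x, y⟫) continuous_inner
      ⟨1, fun x y => by simpa using norm_inner_le_norm (𝕜 := ℝ) x y⟩ hh hg
  exact hgh.bdd_mul hH.measurable.aestronglyMeasurable hM

variable [IsFiniteMeasure μ]

lemma IsBoundedKernel.inner_toCLM [CompleteSpace F] (hH : IsBoundedKernel μ H)
    (g h : Lp F 2 μ) : ⟪hH.toCLM F g, h⟫ = ∫ p, H p.1 p.2 * ⟪g p.2, h p.1⟫ ∂μ.prod μ := by
  rw [integral_prod _ (hH.integrable_mul_inner (integrable_lp_two g) (integrable_lp_two h)),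
    L2.inner_def]
  refine integral_congr_ae ?_
  filter_upwards [hH.coeFn_toCLM g, hH.ae_integrable (integrable_lp_two g)] with s hs hint
  rw [hs, kernelIntegral, real_inner_comm, ← integral_inner hint]
  simp only [inner_smul_right, real_inner_comm]

lemma IsBoundedKernel.inner_toCLM_comm [CompleteSpace F] (hH : IsBoundedKernel μ H)
    (hsymm : ∀ s t, H s t = H t s) (g h : Lp F 2 μ) :
    ⟪hH.toCLM F g, h⟫ = ⟪g, hH.toCLM F h⟫ := by
  rw [real_inner_comm (hH.toCLM F h), hH.inner_toCLM, hH.inner_toCLM, ← integral_prod_swap]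
  simp only [Prod.fst_swap, Prod.snd_swap, real_inner_comm, hsymm]

end Inner

end Kernel

section KernelOnInterval

variable {T : ℝ} {H : ℝ → ℝ → ℝ}

lemma IsBoundedKernel.of_bound (hH : Measurable (Function.uncurry H)) {M : ℝ}
    (hM : ∀ s ∈ Icc 0 T, ∀ t ∈ Icc 0 T, |H s t| ≤ M) :
    IsBoundedKernel (volume.restrict (Icc 0 T)) H := by
  refine ⟨hH, M, ?_⟩
  rw [Measure.prod_restrict]
  filter_upwards [ae_restrict_mem (measurableSet_Icc.prod measurableSet_Icc)] with p hp
  exact hM _ hp.1 _ hp.2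

lemma exists_bound_of_continuous_uncurry (T : ℝ) (hH : Continuous (Function.uncurry H)) :
    ∃ M, ∀ s ∈ Icc 0 T, ∀ t ∈ Icc 0 T, |H s t| ≤ M := by
  obtain ⟨M, hM⟩ := (isCompact_Icc (a := (0 : ℝ)) (b := T)).prod
    (isCompact_Icc (a := (0 : ℝ)) (b := T)) |>.exists_bound_of_continuousOn hH.continuousOn
  exact ⟨M, fun s hs t ht => hM (s, t) ⟨hs, ht⟩⟩

lemma IsBoundedKernel.of_continuous (T : ℝ) (hH : Continuous (Function.uncurry H)) :
    IsBoundedKernel (volume.restrict (Icc 0 T)) H :=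
  let ⟨_, hM⟩ := exists_bound_of_continuous_uncurry T hH
  .of_bound hH.measurable hM

lemma continuousOn_kernelIntegral {F : Type*} [NormedAddCommGroup F] [NormedSpace ℝ F]
    (hH : Continuous (Function.uncurry H)) {g : ℝ → F} (hg : IntegrableOn g (Icc 0 T)) :
    ContinuousOn (kernelIntegral (volume.restrict (Icc 0 T)) H g) (Icc 0 T) := by
  obtain ⟨M, hM⟩ := exists_bound_of_continuous_uncurry T hH
  have hcont (s : ℝ) : Continuous (H s) := hH.comp (continuous_const.prodMk continuous_id)
  refine continuousOn_of_dominated (bound := fun t => M * ‖g t‖)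
    (fun s _ => (hcont s).aestronglyMeasurable.smul hg.aestronglyMeasurable) (fun s hs => ?_)
    (hg.norm.const_mul M) (.of_forall fun t => ?_)
  · filter_upwards [ae_restrict_mem measurableSet_Icc] with t ht
    rw [norm_smul]
    exact mul_le_mul_of_nonneg_right (hM s hs t ht) (norm_nonneg _)
  · exact ((hH.comp (continuous_id.prodMk continuous_const)).smul
      continuous_const).continuousOn

/-- Weak differentiation of an integral operator under the integral sign; a jump of the kernel on
the diagonal contributes the multiple `c` of the density. -/
lemma IsBoundedKernel.isWeakDeriv {d k : ℕ} {H' : ℝ → ℝ → ℝ}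
    (hH : IsBoundedKernel (volume.restrict (Icc 0 T)) H)
    (hH' : IsBoundedKernel (volume.restrict (Icc 0 T)) H') (c : ℝ) (g : L2 d T)
    (h : ∀ s ∈ Icc 0 T, ∀ φ : ℝ → ℝ, IsTestFunction T φ →
      ∫ t in Icc 0 T, iteratedDeriv k φ t * H t s =
        (-1) ^ k * ((∫ t in Icc 0 T, φ t * H' t s) + c * φ s)) :
    IsWeakDeriv k (hH.toCLM (E d) g) (hH'.toCLM (E d) g + c • g) := by
  intro φ hφ
  have hgi := integrable_lp_two g
  have hφi : IntegrableOn φ (Icc 0 T) := hφ.smooth.continuous.integrableOn_Icc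
  have hrhs : (fun t => φ t • (hH'.toCLM (E d) g + c • g : L2 d T) t) =ᵐ[volume.restrict (Icc 0 T)]
      fun t => φ t • hH'.toCLM (E d) g t + (c * φ t) • g t := by
    filter_upwards [Lp.coeFn_add (hH'.toCLM (E d) g) (c • g), Lp.coeFn_smul c g] with t h1 h2
    rw [h1, Pi.add_apply, h2, Pi.smul_apply, smul_add, smul_smul, mul_comm c]
  have hcoe {K : ℝ → ℝ → ℝ} (hK : IsBoundedKernel (volume.restrict (Icc 0 T)) K) {ψ : ℝ → ℝ}
      (hψ : Continuous ψ) : ∫ t in Icc 0 T, ψ t • hK.toCLM (E d) g t =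
        ∫ s in Icc 0 T, (∫ t in Icc 0 T, ψ t * K t s) • g s := by
    rw [← hK.integral_smul_kernelIntegral hψ.integrableOn_Icc hgi]
    exact integral_congr_ae ((hK.coeFn_toCLM g).mono fun t ht => by simp only [ht])
  have hint : IntegrableOn (fun s => (∫ t in Icc 0 T, φ t * H' t s) • g s) (Icc 0 T) := by
    have := (hH'.integrable_prod hφi hgi).integral_prod_right
    simpa only [IntegrableOn, smul_smul, integral_smul_const, mul_comm (H' _ _)] using this
  have hcφ : Continuous fun t => c * φ t := continuous_const.mul hφ.smooth.continuous
  rw [integral_congr_ae hrhs, integral_add (integrable_smul_L2 hφ.smooth.continuous _)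
    (integrable_smul_L2 hcφ g), hcoe hH (hφ.continuous_iteratedDeriv k),
    hcoe hH' hφ.smooth.continuous, ← integral_add hint (integrable_smul_L2 hcφ g),
    ← integral_smul]
  refine setIntegral_congr_fun measurableSet_Icc fun s hs => ?_
  simp only [h s hs φ hφ, ← add_smul, smul_smul]

end KernelOnInterval

/-! ### Weak derivatives and primitives -/

section Primitive

variable {F₁ F₂ F₃ : Type*} [NormedAddCommGroup F₁] [NormedSpace ℝ F₁]
  [NormedAddCommGroup F₂] [NormedSpace ℝ F₂] [NormedAddCommGroup F₃] [NormedSpace ℝ F₃]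
  {T : ℝ} {U V : ℝ → F₁} {A B : ℝ → F₂}

lemma setIntegral_Iic_restrict_Icc {t : ℝ} (ht : t ∈ Icc 0 T) (V : ℝ → F₁) :
    ∫ s in Iic t, V s ∂volume.restrict (Icc 0 T) = ∫ s in (0 : ℝ)..t, V s := by
  have hset : Iic t ∩ Icc 0 T = Icc 0 t := by
    ext s
    exact ⟨fun h => ⟨h.2.1, h.1⟩, fun h => ⟨h.2, h.1, h.2.trans ht.2⟩⟩
  rw [Measure.restrict_restrict measurableSet_Iic, hset, integral_Icc_eq_integral_Ioc,
    intervalIntegral.integral_of_le ht.1]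

lemma setIntegral_Icc_eq_intervalIntegral (hT : 0 ≤ T) (V : ℝ → F₁) :
    ∫ s in Icc 0 T, V s = ∫ s in (0 : ℝ)..T, V s := by
  rw [integral_Icc_eq_integral_Ioc, intervalIntegral.integral_of_le hT]

/-- Fubini's theorem on the two triangles into which the diagonal cuts the square. -/
lemma integral_bilin_primitive_add [CompleteSpace F₁] [CompleteSpace F₂] [CompleteSpace F₃]
    (L : F₁ →L[ℝ] F₂ →L[ℝ] F₃) (hV : IntegrableOn V (Icc 0 T)) (hB : IntegrableOn B (Icc 0 T)) :
    (∫ t in Icc 0 T, L (V t) (∫ s in (0 : ℝ)..t, B s)) +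
      ∫ t in Icc 0 T, L (∫ s in (0 : ℝ)..t, V s) (B t) =
        L (∫ t in Icc 0 T, V t) (∫ t in Icc 0 T, B t) := by
  set ν := volume.restrict (Icc 0 T)
  have hint : Integrable (fun p : ℝ × ℝ => L (V p.1) (B p.2)) (ν.prod ν) :=
    Integrable.op_fst_snd (op := fun x y => L x y) L.continuous₂ ⟨‖L‖, L.le_opNorm₂⟩ hV hB
  have hS : MeasurableSet {p : ℝ × ℝ | p.2 ≤ p.1} :=
    measurableSet_le measurable_snd measurable_fst
  have hlower : ∫ p in {p : ℝ × ℝ | p.2 ≤ p.1}, L (V p.1) (B p.2) ∂ν.prod ν =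
      ∫ t, L (V t) (∫ s in (0 : ℝ)..t, B s) ∂ν := by
    rw [← integral_indicator hS, integral_prod _ (hint.indicator hS)]
    refine setIntegral_congr_fun measurableSet_Icc fun t ht => ?_
    rw [← setIntegral_Iic_restrict_Icc ht, ← (L (V t)).integral_comp_comm (Integrable.restrict hB),
      ← integral_indicator measurableSet_Iic]
    rfl
  have hupper : ∫ p in {p : ℝ × ℝ | p.2 ≤ p.1}ᶜ, L (V p.1) (B p.2) ∂ν.prod ν =
      ∫ t, L (∫ s in (0 : ℝ)..t, V s) (B t) ∂ν := by
    rw [← integral_indicator hS.compl, integral_prod_symm _ (hint.indicator hS.compl)]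
    refine setIntegral_congr_fun measurableSet_Icc fun t ht => ?_
    rw [← setIntegral_Iic_restrict_Icc ht, ← setIntegral_congr_set (Iio_ae_eq_Iic (μ := ν)),
      ← L.flip_apply, ← (L.flip (B t)).integral_comp_comm (Integrable.restrict hV),
      ← integral_indicator measurableSet_Iio]
    simp only [indicator, mem_compl_iff, mem_ofPred_eq, not_le, mem_Iio, L.flip_apply]
    rfl
  rw [← hlower, ← hupper, integral_add_compl hS hint, integral_prod _ hint,
    ← L.flip_apply, ← (L.flip _).integral_comp_comm hV]
  exact integral_congr_ae (.of_forall fun t => (L (V t)).integral_comp_comm hB)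

lemma integrableOn_bilin_continuousOn (L : F₁ →L[ℝ] F₂ →L[ℝ] F₃) (hV : IntegrableOn V (Icc 0 T))
    (hA : ContinuousOn A (Icc 0 T)) : IntegrableOn (fun t => L (V t) (A t)) (Icc 0 T) := by
  obtain ⟨M, hM⟩ := isCompact_Icc.exists_bound_of_continuousOn hA
  refine (hV.norm.const_mul (‖L‖ * M)).mono' (L.aestronglyMeasurable_comp₂
    hV.aestronglyMeasurable (hA.aestronglyMeasurable measurableSet_Icc)) ?_
  filter_upwards [ae_restrict_mem measurableSet_Icc] with t ht
  calc ‖L (V t) (A t)‖ ≤ ‖L‖ * ‖V t‖ * ‖A t‖ := L.le_opNorm₂ _ _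
    _ ≤ ‖L‖ * ‖V t‖ * M := by gcongr; exact hM t ht
    _ = ‖L‖ * M * ‖V t‖ := by ring

/-- `U` is a primitive on `[0,T]` of the integrable function `V`. -/
structure IsPrimitiveOn (T : ℝ) (U V : ℝ → F₁) : Prop where
  integrableOn : IntegrableOn V (Icc 0 T)
  eq_add_integral : ∀ t ∈ Icc 0 T, U t = U 0 + ∫ s in (0 : ℝ)..t, V s

namespace IsPrimitiveOn

lemma of_hasDerivAt [CompleteSpace F₁] (hUV : ∀ t, HasDerivAt U (V t) t) (hV : Continuous V) :
    IsPrimitiveOn T U V where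
  integrableOn := hV.integrableOn_Icc
  eq_add_integral := fun t _ => by
    rw [intervalIntegral.integral_eq_sub_of_hasDerivAt (fun s _ => hUV s)
      (hV.intervalIntegrable 0 t)]
    abel

lemma congr_ae {V' : ℝ → F₁} (hUV : IsPrimitiveOn T U V)
    (hVV' : V =ᵐ[volume.restrict (Icc 0 T)] V') : IsPrimitiveOn T U V' where
  integrableOn := hUV.integrableOn.congr hVV'
  eq_add_integral := fun t ht => by
    rw [hUV.eq_add_integral t ht, intervalIntegral.integral_of_le ht.1,
      intervalIntegral.integral_of_le ht.1]
    congr 1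
    exact integral_congr_ae
      (ae_restrict_of_ae_restrict_of_subset (Ioc_subset_Icc_self.trans (Icc_subset_Icc_right ht.2))
        hVV')

lemma continuousOn (hUV : IsPrimitiveOn T U V) : ContinuousOn U (Icc 0 T) :=
  (continuousOn_const.add (intervalIntegral.continuousOn_primitive hUV.integrableOn)).congr
    fun t ht => by rw [hUV.eq_add_integral t ht, intervalIntegral.integral_of_le ht.1]; rfl

lemma integral_bilin_eq_add [CompleteSpace F₁] [CompleteSpace F₃] (hAB : IsPrimitiveOn T A B)
    (L : F₁ →L[ℝ] F₂ →L[ℝ] F₃) (hV : IntegrableOn V (Icc 0 T)) :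
    ∫ t in Icc 0 T, L (V t) (A t) =
      L (∫ t in Icc 0 T, V t) (A 0) + ∫ t in Icc 0 T, L (V t) (∫ s in (0 : ℝ)..t, B s) := by
  have hconst : IntegrableOn (fun t => L (V t) (A 0)) (Icc 0 T) :=
    (L.flip (A 0)).integrable_comp hV
  have hprim : IntegrableOn (fun t => L (V t) (∫ s in (0 : ℝ)..t, B s)) (Icc 0 T) := by
    refine ((integrableOn_bilin_continuousOn L hV hAB.continuousOn).sub hconst).congr ?_
    filter_upwards [ae_restrict_mem measurableSet_Icc] with t ht
    rw [Pi.sub_apply, hAB.eq_add_integral t ht, map_add, add_sub_cancel_left]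
  rw [← L.flip_apply, ← (L.flip (A 0)).integral_comp_comm hV]
  refine Eq.trans (setIntegral_congr_fun measurableSet_Icc fun t ht => ?_)
    (integral_add hconst hprim)
  simp only [hAB.eq_add_integral t ht, map_add, L.flip_apply]

lemma integral_bilin [CompleteSpace F₁] [CompleteSpace F₂] [CompleteSpace F₃] (hT : 0 ≤ T)
    (hUV : IsPrimitiveOn T U V) (hAB : IsPrimitiveOn T A B) (L : F₁ →L[ℝ] F₂ →L[ℝ] F₃) :
    (∫ t in Icc 0 T, L (V t) (A t)) + ∫ t in Icc 0 T, L (U t) (B t) =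
      L (U T) (A T) - L (U 0) (A 0) := by
  have hFubini := integral_bilin_primitive_add L hUV.integrableOn hAB.integrableOn
  have hright := hUV.integral_bilin_eq_add L.flip hAB.integrableOn
  simp only [L.flip_apply] at hright
  rw [hAB.integral_bilin_eq_add L hUV.integrableOn, hright, hUV.eq_add_integral T ⟨hT, le_rfl⟩,
    hAB.eq_add_integral T ⟨hT, le_rfl⟩, ← setIntegral_Icc_eq_intervalIntegral hT,
    ← setIntegral_Icc_eq_intervalIntegral hT]
  simp only [map_add, add_apply, ← hFubini]
  abel

end IsPrimitiveOn

end Primitive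

section DuBoisReymond

variable {d : ℕ} {T : ℝ}

lemma IsTestFunction.isPrimitiveOn {φ : ℝ → ℝ} (hφ : IsTestFunction T φ) :
    IsPrimitiveOn T φ (_root_.deriv φ) :=
  .of_hasDerivAt hφ.hasDerivAt hφ.deriv.smooth.continuous

lemma IsPrimitiveOn.isWeakDeriv (hT : 0 ≤ T) {U V : ℝ → E d} (hUV : IsPrimitiveOn T U V)
    {u v : L2 d T} (hu : u =ᵐ[volume.restrict (Icc 0 T)] U)
    (hv : v =ᵐ[volume.restrict (Icc 0 T)] V) : IsWeakDeriv 1 u v := by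
  intro φ hφ
  have h := hφ.isPrimitiveOn.integral_bilin hT hUV (ContinuousLinearMap.lsmul ℝ ℝ)
  simp only [ContinuousLinearMap.lsmul_apply, hφ.eq_zero (t := 0) (by simp),
    hφ.eq_zero (t := T) (by simp), zero_smul, sub_zero] at h
  rw [pow_one, neg_one_smul, iteratedDeriv_one,
    integral_congr_ae (hu.mono fun t ht => congrArg (_root_.deriv φ t • ·) ht),
    integral_congr_ae (hv.mono fun t ht => congrArg (φ t • ·) ht)]
  exact eq_neg_of_add_eq_zero_left h

lemma IsWeakDeriv.succ {k : ℕ} {u a b : L2 d T} (ha : IsWeakDeriv k u a)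
    (hb : IsWeakDeriv (k + 1) u b) : IsWeakDeriv 1 a b := by
  intro φ hφ
  have h := hb φ hφ
  rw [iteratedDeriv_succ', ha _ hφ.deriv, pow_succ, mul_smul] at h
  rw [iteratedDeriv_one, pow_one]
  exact smul_right_injective (E d) (pow_ne_zero k (by norm_num : (-1 : ℝ) ≠ 0)) h

lemma exists_isTestFunction_integral_eq_one (hT : 0 < T) :
    ∃ φ, IsTestFunction T φ ∧ ∫ t in Icc 0 T, φ t = 1 := by
  let b : ContDiffBump (T / 2 : ℝ) := ⟨T / 8, T / 4, by linarith, by linarith⟩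
  have hsub : tsupport (b.normed volume) ⊆ Ioo 0 T := by
    rw [b.tsupport_normed_eq, Real.closedBall_eq_Icc]
    exact Icc_subset_Ioo (by simp only [b]; linarith) (by simp only [b]; linarith)
  have htest : IsTestFunction T (b.normed volume) :=
    ⟨b.contDiff_normed, b.hasCompactSupport_normed, hsub⟩
  refine ⟨b.normed volume, htest, ?_⟩
  rw [setIntegral_eq_integral_of_forall_compl_eq_zero, b.integral_normed]
  exact fun t ht => htest.eq_zero fun h => ht (Ioo_subset_Icc_self h)

lemma IsTestFunction.exists_tsupport_subset_Icc (hT : 0 < T) {χ : ℝ → ℝ}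
    (hχ : IsTestFunction T χ) : ∃ a b, tsupport χ ⊆ Icc a b ∧ Icc a b ⊆ Ioo 0 T := by
  rcases (tsupport χ).eq_empty_or_nonempty with hempty | hne
  · refine ⟨T / 2, T / 2, by simp [hempty], ?_⟩
    exact Icc_subset_Ioo (by linarith) (by linarith)
  · have hcompact : IsCompact (tsupport χ) := hχ.compact
    exact ⟨sInf (tsupport χ), sSup (tsupport χ), hcompact.isBounded.subset_Icc_sInf_sSup,
      Icc_subset_Ioo (hχ.support (hcompact.sInf_mem hne)).1
        (hχ.support (hcompact.sSup_mem hne)).2⟩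

lemma IsTestFunction.exists_deriv_eq {χ : ℝ → ℝ} (hT : 0 < T) (hχ : IsTestFunction T χ)
    (hmean : ∫ t in Icc 0 T, χ t = 0) : ∃ φ, IsTestFunction T φ ∧ _root_.deriv φ = χ := by
  have hcont := hχ.smooth.continuous
  have hderiv (t : ℝ) : HasDerivAt (fun t => ∫ s in (0 : ℝ)..t, χ s) (χ t) t :=
    intervalIntegral.integral_hasDerivAt_right (hcont.intervalIntegrable _ _)
      (hcont.stronglyMeasurableAtFilter _ _) hcont.continuousAt
  have hderiv_eq : _root_.deriv (fun t => ∫ s in (0 : ℝ)..t, χ s) = χ :=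
    funext fun t => (hderiv t).deriv
  obtain ⟨a, b, hsub, hab⟩ := hχ.exists_tsupport_subset_Icc hT
  have hzero {s : ℝ} (hs : s ∉ Icc a b) : χ s = 0 :=
    image_eq_zero_of_notMem_tsupport fun h => hs (hsub h)
  have hprim (t : ℝ) (ht : t ∉ Icc a b) : ∫ s in (0 : ℝ)..t, χ s = 0 := by
    rcases lt_or_ge t a with hta | hat
    · refine intervalIntegral.integral_zero_ae (.of_forall fun s hs => hzero fun hsab => ?_)
      exact (max_lt (hab hsab).1 (hta.trans_le hsab.1)).not_ge hs.2
    · have hbt : b < t := not_le.1 fun h => ht ⟨hat, h⟩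
      rw [← intervalIntegral.integral_add_adjacent_intervals (hcont.intervalIntegrable 0 T)
        (hcont.intervalIntegrable T t), ← setIntegral_Icc_eq_intervalIntegral hT.le, hmean,
        zero_add]
      refine intervalIntegral.integral_zero_ae (.of_forall fun s hs => hzero fun hsab => ?_)
      exact (lt_min (hab hsab).2 (hsab.2.trans_lt hbt)).not_gt hs.1
  have hsupp : tsupport (fun t => ∫ s in (0 : ℝ)..t, χ s) ⊆ Icc a b :=
    closure_minimal (fun t ht => by_contra fun h => ht (hprim t h)) isClosed_Icc
  refine ⟨_, ⟨?_, isCompact_Icc.of_isClosed_subset (isClosed_tsupport _) hsupp,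
    hsupp.trans hab⟩, hderiv_eq⟩
  rw [contDiff_infty_iff_deriv, hderiv_eq]
  exact ⟨fun t => (hderiv t).differentiableAt, hχ.smooth⟩

lemma IsTestFunction.sub_mul {φ ψ : ℝ → ℝ} (hφ : IsTestFunction T φ) (hψ : IsTestFunction T ψ)
    (c : ℝ) : IsTestFunction T (fun t => φ t - c * ψ t) where
  smooth := hφ.smooth.sub (contDiff_const.mul hψ.smooth)
  compact := hφ.compact.sub (hψ.compact.mul_left (f := fun _ => c))
  support := (tsupport_sub φ (fun t => c * ψ t)).trans (union_subset hφ.support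
    ((closure_mono (Function.support_mul_subset_right _ _)).trans hψ.support))

/-- The lemma of du Bois-Reymond: after subtracting a multiple of a fixed bump function of integral
one, every test function is the derivative of a test function. -/
lemma IsWeakDeriv.ae_eq_const {u : L2 d T} (hT : 0 < T) (h : IsWeakDeriv 1 u 0) :
    ∃ c : E d, u =ᵐ[volume.restrict (Icc 0 T)] fun _ => c := by
  obtain ⟨ψ, hψ, hψ_one⟩ := exists_isTestFunction_integral_eq_one hT
  set c := ∫ t in Icc 0 T, ψ t • u t with hc
  have hmem : MemLp (fun _ : ℝ => c) 2 (volume.restrict (Icc 0 T)) := memLp_const c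
  suffices hconst : IsWeakDeriv 0 u hmem.toLp from
    ⟨c, (IsWeakDeriv.unique (k := 0) (fun φ _ => by simp) hconst : u = _) ▸ hmem.coeFn_toLp⟩
  intro φ hφ
  have hφi : IntegrableOn φ (Icc 0 T) := hφ.smooth.continuous.integrableOn_Icc
  have hψi : IntegrableOn ψ (Icc 0 T) := hψ.smooth.continuous.integrableOn_Icc
  obtain ⟨θ, hθ, hθ_deriv⟩ := (hφ.sub_mul hψ (∫ t in Icc 0 T, φ t)).exists_deriv_eq hT (by
    rw [integral_sub hφi (hψi.const_mul _), integral_const_mul, hψ_one, mul_one, sub_self])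
  have hzero : ∫ t in Icc 0 T, (φ t - (∫ t in Icc 0 T, φ t) * ψ t) • u t = 0 := by
    have hu := h θ hθ
    rw [iteratedDeriv_one, hθ_deriv, integral_congr_ae ((Lp.coeFn_zero (E d) 2 _).mono
      fun t ht => congrArg (θ t • ·) ht)] at hu
    simpa only [Pi.zero_apply, smul_zero, integral_zero] using hu
  have hui : IntegrableOn (fun t => (∫ t in Icc 0 T, φ t) • ψ t • u t) (Icc 0 T) :=
    (integrable_smul_L2 hψ.smooth.continuous u).smul (∫ t in Icc 0 T, φ t)
  simp only [sub_smul, mul_smul] at hzero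
  rw [integral_sub (integrable_smul_L2 hφ.smooth.continuous u) hui, integral_smul, ← hc,
    sub_eq_zero] at hzero
  rw [iteratedDeriv_zero, hzero, pow_zero, one_smul, ← integral_smul_const]
  exact integral_congr_ae (hmem.coeFn_toLp.mono fun t ht => by simp only [ht])

lemma isPrimitiveOn_const_add_integral (c : E d) (v : L2 d T) :
    IsPrimitiveOn T (fun t => c + ∫ s in (0 : ℝ)..t, v s) v where
  integrableOn := integrable_lp_two v
  eq_add_integral := fun t _ => by simp

lemma memLp_Icc_of_continuousOn {U : ℝ → E d} (hU : ContinuousOn U (Icc 0 T)) (p : ENNReal) :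
    MemLp U p (volume.restrict (Icc 0 T)) := by
  obtain ⟨M, hM⟩ := isCompact_Icc.exists_bound_of_continuousOn hU
  exact .of_bound (hU.aestronglyMeasurable measurableSet_Icc) M
    ((ae_restrict_mem measurableSet_Icc).mono hM)

lemma IsWeakDeriv.exists_isPrimitiveOn {u v : L2 d T} (hT : 0 < T) (h : IsWeakDeriv 1 u v) :
    ∃ U, IsPrimitiveOn T U v ∧ u =ᵐ[volume.restrict (Icc 0 T)] U := by
  have hprim := isPrimitiveOn_const_add_integral 0 v
  have hmem := memLp_Icc_of_continuousOn hprim.continuousOn 2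
  have hdiff := h.add ((hprim.isWeakDeriv hT.le hmem.coeFn_toLp (ae_eq_refl v)).smul (-1))
  rw [neg_one_smul, neg_one_smul, add_neg_cancel, ← sub_eq_add_neg] at hdiff
  obtain ⟨c, hc⟩ := hdiff.ae_eq_const hT
  refine ⟨_, isPrimitiveOn_const_add_integral c v, ?_⟩
  filter_upwards [hc, Lp.coeFn_sub u hmem.toLp, hmem.coeFn_toLp] with t hct hsub hV
  rw [hsub, Pi.sub_apply, hV, zero_add, sub_eq_iff_eq_add] at hct
  exact hct

end DuBoisReymond

/-! ### The energy identity -/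

section Energy

variable {F : Type*} [NormedAddCommGroup F] [InnerProductSpace ℝ F] [CompleteSpace F]
  {m T : ℝ} {U : ℕ → ℝ → F}

lemma IsPrimitiveOn.integral_inner {U V A B : ℝ → F} (hT : 0 ≤ T) (hUV : IsPrimitiveOn T U V)
    (hAB : IsPrimitiveOn T A B) :
    (∫ t in Icc 0 T, ⟪V t, A t⟫) + ∫ t in Icc 0 T, ⟪U t, B t⟫ = ⟪U T, A T⟫ - ⟪U 0, A 0⟫ :=
  hUV.integral_bilin hT hAB (innerSL ℝ)

/-- The functions `U 0, …, U 4` are successive derivatives on `[0,T]`, the last one in the sense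
of `IsPrimitiveOn`, and `U 0` satisfies the boundary conditions of `operatorDomain`. -/
structure IsRobinChain (m T : ℝ) (U : ℕ → ℝ → F) : Prop where
  isPrimitiveOn : ∀ j < 4, IsPrimitiveOn T (U j) (U (j + 1))
  left_value : U 0 0 = 0
  right_value : U 0 T = 0
  left_deriv : m • U 2 0 = U 1 0
  right_deriv : m • U 2 T = -U 1 T

namespace IsRobinChain

lemma integral_inner_two (hT : 0 ≤ T) (hU : IsRobinChain m T U) :
    ∫ t in Icc 0 T, ⟪U 2 t, U 0 t⟫ = -∫ t in Icc 0 T, ‖U 1 t‖ ^ 2 := by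
  have h := (hU.isPrimitiveOn 1 (by lia)).integral_inner hT (hU.isPrimitiveOn 0 (by lia))
  simp only [hU.left_value, hU.right_value, inner_zero_right, sub_zero, zero_add,
    real_inner_self_eq_norm_sq] at h
  exact eq_neg_of_add_eq_zero_left h

lemma integral_inner_four (hT : 0 ≤ T) (hU : IsRobinChain m T U) :
    ∫ t in Icc 0 T, ⟪U 4 t, U 0 t⟫ =
      (∫ t in Icc 0 T, ‖U 2 t‖ ^ 2) + m * (‖U 2 0‖ ^ 2 + ‖U 2 T‖ ^ 2) := by
  have houter := (hU.isPrimitiveOn 3 (by lia)).integral_inner hT (hU.isPrimitiveOn 0 (by lia))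
  have hinner := (hU.isPrimitiveOn 2 (by lia)).integral_inner hT (hU.isPrimitiveOn 1 (by lia))
  simp only [hU.left_value, hU.right_value, inner_zero_right, sub_zero, zero_add,
    Nat.reduceAdd] at houter
  rw [← hU.left_deriv, ← neg_eq_iff_eq_neg.2 hU.right_deriv] at hinner
  simp only [inner_neg_right, inner_smul_right, real_inner_self_eq_norm_sq, Nat.reduceAdd] at hinner
  linarith

lemma integral_inner_operator (hT : 0 ≤ T) (hU : IsRobinChain m T U) :
    ∫ t in Icc 0 T, ⟪-(m ^ 2) • U 4 t + U 2 t, U 0 t⟫ =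
      -(m ^ 2 * (∫ t in Icc 0 T, ‖U 2 t‖ ^ 2) + m ^ 3 * (‖U 2 0‖ ^ 2 + ‖U 2 T‖ ^ 2) +
        ∫ t in Icc 0 T, ‖U 1 t‖ ^ 2) := by
  have hprim := hU.isPrimitiveOn
  have hint (j : ℕ) (hj : j < 4) : IntegrableOn (fun t => ⟪U (j + 1) t, U 0 t⟫) (Icc 0 T) :=
    integrableOn_bilin_continuousOn (innerSL ℝ) (hprim j hj).integrableOn
      (hprim 0 (by lia)).continuousOn
  simp only [inner_add_left, real_inner_smul_left]
  rw [integral_add ((hint 3 (by lia)).const_mul _) (hint 1 (by lia)), integral_const_mul,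
    hU.integral_inner_two hT, hU.integral_inner_four hT]
  ring

/-- The energy of `U` controls `‖U 1‖²`, and `U 0` vanishes at `0`. -/
lemma eqOn_zero (hm : 0 ≤ m) (hT : 0 ≤ T) (hU : IsRobinChain m T U)
    (h : 0 ≤ ∫ t in Icc 0 T, ⟪-(m ^ 2) • U 4 t + U 2 t, U 0 t⟫) : EqOn (U 0) 0 (Icc 0 T) := by
  have hprim := hU.isPrimitiveOn
  have hzero : ∫ t in Icc 0 T, ‖U 1 t‖ ^ 2 = 0 := by
    have hone : 0 ≤ ∫ t in Icc 0 T, ‖U 1 t‖ ^ 2 := integral_nonneg fun t => by positivity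
    have htwo : 0 ≤ ∫ t in Icc 0 T, ‖U 2 t‖ ^ 2 := integral_nonneg fun t => by positivity
    rw [hU.integral_inner_operator hT] at h
    have : 0 ≤ m ^ 2 * (∫ t in Icc 0 T, ‖U 2 t‖ ^ 2) + m ^ 3 * (‖U 2 0‖ ^ 2 + ‖U 2 T‖ ^ 2) := by
      positivity
    linarith
  have hint : IntegrableOn (fun t => ‖U 1 t‖ ^ 2) (Icc 0 T) :=
    ((hprim 1 (by lia)).continuousOn.norm.pow 2).integrableOn_Icc
  have hderiv : U 1 =ᵐ[volume.restrict (Icc 0 T)] fun _ => 0 := by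
    filter_upwards [(integral_eq_zero_iff_of_nonneg (fun t => by positivity) hint).1 hzero]
      with t ht
    simpa using ht
  intro t ht
  rw [((hprim 0 (by lia)).congr_ae hderiv).eq_add_integral t ht, hU.left_value,
    intervalIntegral.integral_zero, add_zero, Pi.zero_apply]

end IsRobinChain

end Energy

section Uniqueness

variable {F : Type*} [NormedAddCommGroup F] [NormedSpace ℝ F] {T : ℝ}

lemma IsPrimitiveOn.sub {U V A B : ℝ → F} (hUV : IsPrimitiveOn T U V)
    (hAB : IsPrimitiveOn T A B) :
    IsPrimitiveOn T (fun t => U t - A t) (fun t => V t - B t) where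
  integrableOn := hUV.integrableOn.sub hAB.integrableOn
  eq_add_integral := fun t ht => by
    have hint {W : ℝ → F} (hW : IntegrableOn W (Icc 0 T)) : IntervalIntegrable W volume 0 t :=
      
      (intervalIntegrable_iff_integrableOn_Icc_of_le ht.1).2
        (hW.mono_set (Icc_subset_Icc_right ht.2))
    rw [intervalIntegral.integral_sub (hint hUV.integrableOn) (hint hAB.integrableOn),
      hUV.eq_add_integral t ht, hAB.eq_add_integral t ht]
    abel

lemma isPrimitiveOn_iteratedDerivWithin [CompleteSpace F] {n j : ℕ} {y : ℝ → F} (hT : 0 < T)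
    (hy : ContDiffOn ℝ n y (Icc 0 T)) (hj : j < n) :
    IsPrimitiveOn T (iteratedDerivWithin j y (Icc 0 T))
      (iteratedDerivWithin (j + 1) y (Icc 0 T)) := by
  have huniq := uniqueDiffOn_Icc hT
  have hcont {k : ℕ} (hk : k ≤ n) : ContinuousOn (iteratedDerivWithin k y (Icc 0 T)) (Icc 0 T) :=
    hy.continuousOn_iteratedDerivWithin (by exact_mod_cast hk) huniq
  refine ⟨(hcont hj).integrableOn_Icc, fun t ht => ?_⟩
  have hsub : Icc 0 t ⊆ Icc 0 T := Icc_subset_Icc_right ht.2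
  rw [intervalIntegral.integral_eq_sub_of_hasDerivAt_of_le ht.1 ((hcont hj.le).mono hsub)
    (fun s hs => ?_)
      (((hcont hj).mono hsub).intervalIntegrable_of_Icc ht.1)]
  · abel
  · have hs' : s ∈ Icc 0 T := hsub (Ioo_subset_Icc_self hs)
    rw [iteratedDerivWithin_succ]
    exact (hy.differentiableOn_iteratedDerivWithin (by exact_mod_cast hj) huniq s hs')
      |>.hasDerivWithinAt.hasDerivAt (Icc_mem_nhds hs.1 (hs.2.trans_le ht.2))

end Uniqueness

section MeanPath

variable {d : ℕ} {m T : ℝ} {xminus xplus : E d} {y z : ℝ → E d}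

lemma IsMeanPath.isRobinChain_sub (hT : 0 < T) (hy : IsMeanPath m T xminus xplus y)
    (hz : IsMeanPath m T xminus xplus z) :
    IsRobinChain m T fun j t =>
      iteratedDerivWithin j y (Icc 0 T) t - iteratedDerivWithin j z (Icc 0 T) t where
  isPrimitiveOn := fun _ hj =>
    (isPrimitiveOn_iteratedDerivWithin hT hy.contDiffOn hj).sub
      (isPrimitiveOn_iteratedDerivWithin hT hz.contDiffOn hj)
  left_value := by simp [hy.left_value, hz.left_value]
  right_value := by simp [hy.right_value, hz.right_value]
  left_deriv := by
    rw [smul_sub, hy.left_deriv, hz.left_deriv, iteratedDerivWithin_one, iteratedDerivWithin_one]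
  right_deriv := by
    rw [smul_sub, hy.right_deriv, hz.right_deriv, iteratedDerivWithin_one,
      iteratedDerivWithin_one, neg_sub_neg, neg_sub]

lemma IsMeanPath.eqOn (hm : 0 ≤ m) (hT : 0 < T) (hy : IsMeanPath m T xminus xplus y)
    (hz : IsMeanPath m T xminus xplus z) : EqOn y z (Icc 0 T) := by
  have henergy : 0 = ∫ t in Icc 0 T, ⟪-(m ^ 2) • (iteratedDerivWithin 4 y (Icc 0 T) t -
      iteratedDerivWithin 4 z (Icc 0 T) t) + (iteratedDerivWithin 2 y (Icc 0 T) t -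
      iteratedDerivWithin 2 z (Icc 0 T) t), y t - z t⟫ := by
    refine (setIntegral_eq_zero_of_forall_eq_zero fun t ht => ?_).symm
    rw [smul_sub, sub_add_sub_comm, hy.equation t ht, hz.equation t ht, sub_zero, inner_zero_left]
  intro t ht
  have h := (hy.isRobinChain_sub hT hz).eqOn_zero hm hT.le (by simpa using henergy.le) ht
  simpa [sub_eq_zero] using h

end MeanPath

section Operator

variable {d : ℕ} {m T : ℝ}

lemma HasTrace.unique {u : L2 d T} (hT : 0 < T) {t : ℝ} (ht : t ∈ Icc 0 T) {a : E d}
    (h : HasTrace u t a) {c : ℝ → E d} (hc : ContinuousOn c (Icc 0 T))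
    (huc : u =ᵐ[volume.restrict (Icc 0 T)] c) : c t = a := by
  obtain ⟨c', hc', huc', rfl⟩ := h
  exact Measure.eqOn_Icc_of_ae_eq volume hT.ne (huc.symm.trans huc') hc hc' ht

lemma HasRobinRelation.eq {σ t : ℝ} {u u₁ u₂ : L2 d T} (hT : 0 < T) (ht : t ∈ Icc 0 T)
    (h : HasRobinRelation m σ t u) (h₁ : IsWeakDeriv 1 u u₁) (h₂ : IsWeakDeriv 2 u u₂)
    {c₁ c₂ : ℝ → E d} (hc₁ : ContinuousOn c₁ (Icc 0 T)) (hc₂ : ContinuousOn c₂ (Icc 0 T))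
    (hu₁ : u₁ =ᵐ[volume.restrict (Icc 0 T)] c₁) (hu₂ : u₂ =ᵐ[volume.restrict (Icc 0 T)] c₂) :
    m • c₂ t = σ • c₁ t := by
  obtain ⟨v₁, v₂, a, b, hv₁, hv₂, ha, hb, hab⟩ := h
  rw [hv₁.unique h₁] at ha
  rw [hv₂.unique h₂] at hb
  rw [ha.unique hT ht hc₁ hu₁, hb.unique hT ht hc₂ hu₂, hab]

lemma mem_domain_operatorL {u : L2 d T} :
    u ∈ (operatorL d m T).domain ↔ u ∈ operatorDomain d m T :=
  ⟨fun h => h.1, fun h => ⟨h, h.1.2, h.1.1.1.2⟩⟩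

lemma operatorL_apply (u : (operatorL d m T).domain) {a b : L2 d T}
    (ha : IsWeakDeriv 4 (u : L2 d T) a) (hb : IsWeakDeriv 2 (u : L2 d T) b) :
    operatorL d m T u = -(m ^ 2) • a + b := by
  rw [← (weakDeriv_spec ⟨u, a, ha⟩).unique ha, ← (weakDeriv_spec ⟨u, b, hb⟩).unique hb]
  rfl

lemma exists_isRobinChain_ae_eq (hT : 0 < T) (u : (operatorL d m T).domain) :
    ∃ U : ℕ → ℝ → E d, IsRobinChain m T U ∧ u =ᵐ[volume.restrict (Icc 0 T)] U 0 ∧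
      operatorL d m T u =ᵐ[volume.restrict (Icc 0 T)] fun t => -(m ^ 2) • U 4 t + U 2 t := by
  obtain ⟨⟨⟨⟨⟨u₁, h₁⟩, ⟨u₂, h₂⟩⟩, ⟨u₃, h₃⟩⟩, ⟨u₄, h₄⟩⟩, hleft, hright, hleft', hright'⟩ :=
    mem_domain_operatorL.1 u.2
  obtain ⟨U₀, hU₀, hu₀⟩ := h₁.exists_isPrimitiveOn hT
  obtain ⟨U₁, hU₁, hu₁⟩ := (h₁.succ h₂).exists_isPrimitiveOn hT
  obtain ⟨U₂, hU₂, hu₂⟩ := (h₂.succ h₃).exists_isPrimitiveOn hT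
  obtain ⟨U₃, hU₃, hu₃⟩ := (h₃.succ h₄).exists_isPrimitiveOn hT
  have hzero : (0 : ℝ) ∈ Icc 0 T := ⟨le_rfl, hT.le⟩
  have hend : T ∈ Icc 0 T := ⟨hT.le, le_rfl⟩
  let U : ℕ → ℝ → E d
    | 0 => U₀
    | 1 => U₁
    | 2 => U₂
    | 3 => U₃
    | _ => u₄
  refine ⟨U, ⟨fun j hj => ?_, hleft.unique hT hzero hU₀.continuousOn hu₀,
    hright.unique hT hend hU₀.continuousOn hu₀, ?_, ?_⟩, hu₀, ?_⟩
  · interval_cases j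
    exacts [hU₀.congr_ae hu₁, hU₁.congr_ae hu₂, hU₂.congr_ae hu₃, hU₃]
  · exact (hleft'.eq hT hzero h₁ h₂ hU₁.continuousOn hU₂.continuousOn hu₁ hu₂).trans (one_smul ℝ _)
  · exact (hright'.eq hT hend h₁ h₂ hU₁.continuousOn hU₂.continuousOn hu₁ hu₂).trans
      (neg_one_smul ℝ _)
  · rw [operatorL_apply u h₄ h₂]
    filter_upwards [Lp.coeFn_add (-(m ^ 2) • u₄) u₂, Lp.coeFn_smul (-(m ^ 2)) u₄, hu₂]
      with t hadd hsmul ht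
    rw [hadd, Pi.add_apply, hsmul, Pi.smul_apply, ht]
    rfl

theorem operatorL_inner_neg (hm : 0 ≤ m) (hT : 0 < T) {u : (operatorL d m T).domain} (hu : u ≠ 0) :
    ⟪operatorL d m T u, (u : L2 d T)⟫ < 0 := by
  contrapose! hu
  obtain ⟨U, hU, hu₀, hLu⟩ := exists_isRobinChain_ae_eq hT u
  have hinner : ⟪operatorL d m T u, (u : L2 d T)⟫ =
      ∫ t in Icc 0 T, ⟪-(m ^ 2) • U 4 t + U 2 t, U 0 t⟫ := by
    rw [L2.inner_def]
    refine integral_congr_ae ?_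
    filter_upwards [hu₀, hLu] with t h h'
    rw [h, h']
  rw [hinner] at hu
  refine Subtype.ext (Lp.ext ?_)
  filter_upwards [hu₀, ae_restrict_mem measurableSet_Icc,
    Lp.coeFn_zero (E d) 2 (volume.restrict (Icc 0 T))] with t h ht h0
  rw [h, hU.eqOn_zero hm hT.le hu ht, ZeroMemClass.coe_zero, h0]

lemma operatorL_injective (hm : 0 ≤ m) (hT : 0 < T) {u : (operatorL d m T).domain}
    (hu : operatorL d m T u = 0) : u = 0 := by
  by_contra hne
  simpa [hu] using operatorL_inner_neg hm hT hne

end Operator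

/-! ### The inverse of the operator -/

section GreenOperator

variable {d : ℕ} {m T : ℝ}

lemma isBoundedKernel_bridgeCov (m T : ℝ) :
    IsBoundedKernel (volume.restrict (Icc 0 T)) (bridgeCov m T) :=
  .of_continuous T (continuous_bridgeCov m T)

lemma isBoundedKernel_bridgeCovDeriv (m T : ℝ) (j : ℕ) :
    IsBoundedKernel (volume.restrict (Icc 0 T)) (bridgeCovDeriv m T j) := by
  have hcont := continuous_bridgeCoeffs m T j
  obtain ⟨M, hM⟩ := (isCompact_Icc.prod isCompact_Icc).exists_bound_of_continuousOn
    (s := Icc 0 T ×ˢ Icc 0 T) hcont.1.continuousOn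
  obtain ⟨N, hN⟩ := (isCompact_Icc.prod isCompact_Icc).exists_bound_of_continuousOn
    (s := Icc 0 T ×ˢ Icc 0 T) hcont.2.continuousOn
  refine .of_bound (measurable_bridgeCovDeriv m T j) (M := max M N) fun t ht s hs => ?_
  unfold bridgeCovDeriv
  split_ifs
  · exact (hM (t, s) ⟨ht, hs⟩).trans (le_max_left _ _)
  · exact (hN (t, s) ⟨ht, hs⟩).trans (le_max_right _ _)

/-- The integral operator of the Green's function `bridgeCov`, which inverts `-𝓛`. -/
def greenOperator (d : ℕ) (m T : ℝ) : L2 d T →L[ℝ] L2 d T :=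
  (isBoundedKernel_bridgeCov m T).toCLM (E d)

lemma inner_greenOperator_comm (g h : L2 d T) :
    ⟪greenOperator d m T g, h⟫ = ⟪g, greenOperator d m T h⟫ :=
  (isBoundedKernel_bridgeCov m T).inner_toCLM_comm (bridgeCov_comm m T) g h

lemma isWeakDeriv_greenOperator (hm : m ≠ 0) {k : ℕ} (hk : k ≤ 3) (g : L2 d T) :
    IsWeakDeriv k (greenOperator d m T g)
      ((isBoundedKernel_bridgeCovDeriv m T k).toCLM (E d) g) := by
  have h := (isBoundedKernel_bridgeCov m T).isWeakDeriv (k := k)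
    (isBoundedKernel_bridgeCovDeriv m T k) 0 g
    fun s hs φ hφ => by
      simp only [bridgeCov_comm m T _ s, hφ.integral_iteratedDeriv_mul_bridgeCov hm hs hk,
        zero_mul, add_zero]
  rwa [zero_smul, add_zero] at h

lemma isWeakDeriv_four_greenOperator (hm : m ≠ 0) (g : L2 d T) :
    IsWeakDeriv 4 (greenOperator d m T g)
      ((isBoundedKernel_bridgeCovDeriv m T 4).toCLM (E d) g + (m ^ 2)⁻¹ • g) :=
  (isBoundedKernel_bridgeCov m T).isWeakDeriv (isBoundedKernel_bridgeCovDeriv m T 4) _ g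
    fun s hs φ hφ => by
      simp only [bridgeCov_comm m T _ s, hφ.integral_iteratedDeriv_four_mul_bridgeCov hm hs]
      ring

lemma hasTrace_greenOperator_of_eq_zero {t : ℝ} (ht : ∀ s ∈ Icc 0 T, bridgeCov m T t s = 0)
    (g : L2 d T) : HasTrace (greenOperator d m T g) t 0 := by
  have hcont : Continuous (Function.uncurry (bridgeCov m T)) := continuous_bridgeCov m T
  refine ⟨_, continuousOn_kernelIntegral hcont (integrable_lp_two g),
    (isBoundedKernel_bridgeCov m T).coeFn_toCLM g, setIntegral_eq_zero_of_forall_eq_zero ?_⟩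
  intro s hs
  rw [ht s hs, zero_smul]

lemma hasRobinRelation_greenOperator (hm : m ≠ 0) {σ t : ℝ}
    (h : ∀ s ∈ Icc 0 T, m * bridgeCovDeriv m T 2 t s = σ * bridgeCovDeriv m T 1 t s)
    (g : L2 d T) : HasRobinRelation m σ t (greenOperator d m T g) := by
  have htrace {j : ℕ} (hj : j ≤ 2) := continuousOn_kernelIntegral
    (continuous_bridgeCovDeriv hm T hj) (integrable_lp_two g)
  refine ⟨_, _, _, _, isWeakDeriv_greenOperator hm (by norm_num) g,
    isWeakDeriv_greenOperator hm (by norm_num) g,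
    ⟨_, htrace one_le_two, (isBoundedKernel_bridgeCovDeriv m T 1).coeFn_toCLM g, rfl⟩,
    ⟨_, htrace le_rfl, (isBoundedKernel_bridgeCovDeriv m T 2).coeFn_toCLM g, rfl⟩, ?_⟩
  rw [kernelIntegral, kernelIntegral, ← integral_smul, ← integral_smul]
  refine setIntegral_congr_fun measurableSet_Icc fun s hs => ?_
  simp only [smul_smul, h s hs]

lemma greenOperator_mem_operatorDomain (hm : 0 < m) (hT : 0 < T) (g : L2 d T) :
    greenOperator d m T g ∈ operatorDomain d m T := by
  have hderiv {k : ℕ} (hk : k ≤ 3) := isWeakDeriv_greenOperator (d := d) (T := T) hm.ne' hk g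
  refine ⟨⟨⟨⟨⟨_, hderiv (by norm_num)⟩, ⟨_, hderiv (by norm_num)⟩⟩, ⟨_, hderiv le_rfl⟩⟩,
    ⟨_, isWeakDeriv_four_greenOperator hm.ne' g⟩⟩, ?_, ?_, ?_, ?_⟩
  · refine hasTrace_greenOperator_of_eq_zero (fun s hs => ?_) g
    rw [bridgeCov_comm, bridgeCov_zero_right m T hs.1]
  · refine hasTrace_greenOperator_of_eq_zero (fun s hs => ?_) g
    rw [bridgeCov_comm, bridgeCov_endpoint hm hT hs.2]
  · refine hasRobinRelation_greenOperator hm.ne' (fun s hs => ?_) g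
    rw [bridgeCovDeriv_robin_left hm.ne' T hs.1, one_mul]
  · refine hasRobinRelation_greenOperator hm.ne' (fun s hs => ?_) g
    rw [bridgeCovDeriv_robin_right hm.ne' hs.2, neg_one_mul]

lemma toCLM_bridgeCovDeriv_two (hm : m ≠ 0) (g : L2 d T) :
    (isBoundedKernel_bridgeCovDeriv m T 2).toCLM (E d) g =
      m ^ 2 • (isBoundedKernel_bridgeCovDeriv m T 4).toCLM (E d) g := by
  refine Lp.ext ?_
  filter_upwards [(isBoundedKernel_bridgeCovDeriv m T 2).coeFn_toCLM g,
    (isBoundedKernel_bridgeCovDeriv m T 4).coeFn_toCLM g,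
    Lp.coeFn_smul (m ^ 2) ((isBoundedKernel_bridgeCovDeriv m T 4).toCLM (E d) g)] with s h₂ h₄ hs
  rw [h₂, hs, Pi.smul_apply, h₄, kernelIntegral, kernelIntegral, ← integral_smul]
  simp only [smul_smul, bridgeCovDeriv_four hm]

lemma operatorL_greenOperator (hm : m ≠ 0) (g : L2 d T)
    (hg : greenOperator d m T g ∈ (operatorL d m T).domain) :
    operatorL d m T ⟨greenOperator d m T g, hg⟩ = -g := by
  rw [operatorL_apply ⟨_, hg⟩ (isWeakDeriv_four_greenOperator hm g)
    (isWeakDeriv_greenOperator hm (by norm_num) g), toCLM_bridgeCovDeriv_two hm, neg_smul, smul_add,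
    smul_inv_smul₀ (pow_ne_zero 2 hm)]
  abel

lemma isBoundedInverse_greenOperator (hm : 0 < m) (hT : 0 < T) :
    IsBoundedInverse (-operatorL d m T) (greenOperator d m T) := by
  have hmem (g : L2 d T) : greenOperator d m T g ∈ (operatorL d m T).domain :=
    mem_domain_operatorL.2 (greenOperator_mem_operatorDomain hm hT g)
  have hright (g : L2 d T) := operatorL_greenOperator hm.ne' g (hmem g)
  refine ⟨fun g => ⟨hmem g, neg_eq_iff_eq_neg.2 (hright g)⟩, fun u => ?_⟩
  have hzero : operatorL d m T (⟨_, hmem ((-operatorL d m T) u)⟩ - u) = 0 := by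
    rw [LinearPMap.map_sub, hright, LinearPMap.neg_apply, neg_neg, sub_self]
  exact congrArg Subtype.val (sub_eq_zero.1 (operatorL_injective hm.le hT hzero))

end GreenOperator

section BoundedInverse

variable {H : Type*} [NormedAddCommGroup H] [InnerProductSpace ℝ H]
  {A : H →ₗ.[ℝ] H} {C : H →L[ℝ] H}

namespace IsBoundedInverse

lemma of_neg (h : IsBoundedInverse (-A) C) : IsBoundedInverse A (-C) where
  right_inv := fun g => by
    obtain ⟨hg, hAg⟩ := h.right_inv g
    exact ⟨A.domain.neg_mem hg, (A.map_neg ⟨C g, hg⟩).trans hAg⟩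
  left_inv := fun u => by
    have h := h.left_inv u
    rwa [LinearPMap.neg_apply, map_neg] at h

lemma dense_domain [CompleteSpace H] (h : IsBoundedInverse A C)
    (hC : ∀ f g : H, ⟪C f, g⟫ = ⟪f, C g⟫) : Dense (A.domain : Set H) := by
  rw [Submodule.dense_iff_topologicalClosure_eq_top, Submodule.topologicalClosure_eq_top_iff,
    Submodule.eq_bot_iff]
  intro g hg
  have hCg : C g = 0 := by
    rw [← inner_self_eq_zero (𝕜 := ℝ), hC]
    exact (Submodule.mem_orthogonal' _ _).1 hg _ (h.right_inv (C g)).1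
  obtain ⟨hmem, hACg⟩ := h.right_inv g
  rw [← hACg, show (⟨C g, hmem⟩ : A.domain) = 0 from Subtype.ext hCg, LinearPMap.map_zero]

lemma isFormalAdjoint (h : IsBoundedInverse A C) (hC : ∀ f g : H, ⟪C f, g⟫ = ⟪f, C g⟫) :
    A.IsFormalAdjoint A := fun x y => by
  rw [← h.left_inv y, ← hC, h.left_inv]

theorem isSelfAdjoint [CompleteSpace H] (h : IsBoundedInverse A C)
    (hC : ∀ f g : H, ⟪C f, g⟫ = ⟪f, C g⟫) : IsSelfAdjoint A := by
  have hdense := h.dense_domain hC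
  have hadjoint (y : A.adjoint.domain) : (y : H) = C (A.adjoint y) := by
    refine ext_inner_right ℝ fun g => ?_
    obtain ⟨hg, hACg⟩ := h.right_inv g
    have hinner := LinearPMap.adjoint_isFormalAdjoint hdense y ⟨C g, hg⟩
    rw [hACg] at hinner
    rw [hC, hinner]
  rw [LinearPMap.isSelfAdjoint_def]
  refine le_antisymm ?_ ((h.isFormalAdjoint hC).le_adjoint hdense)
  refine ⟨fun y hy => ?_, fun y z hyz => ?_⟩
  · exact (congrArg (· ∈ A.domain) (hadjoint ⟨y, hy⟩)).mpr (h.right_inv _).1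
  · obtain ⟨hg, hAg⟩ := h.right_inv (A.adjoint y)
    rw [← hAg, show z = ⟨_, hg⟩ from Subtype.ext (hyz.symm.trans (hadjoint y))]

end IsBoundedInverse

end BoundedInverse

lemma isSelfAdjoint_operatorL {d : ℕ} {m T : ℝ} (hm : 0 < m) (hT : 0 < T) :
    IsSelfAdjoint (operatorL d m T) :=
  (isBoundedInverse_greenOperator hm hT).of_neg.isSelfAdjoint fun f g => by
    rw [neg_apply, neg_apply, inner_neg_left, inner_neg_right, inner_greenOperator_comm]

/-! ### Gaussian transforms -/

section GaussianTransform

variable {Ω : Type*} [MeasurableSpace Ω] {P : Measure Ω} {X Y : Ω → ℝ} {q r : ℝ}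

/-- `E e^{iX} = e^{-q/2}`, as for a centred Gaussian variable `X` of variance `q`. Required of all
linear combinations of the members of a family, with a quadratic form in place of `q`, this
expresses that the family is centred and jointly Gaussian. -/
structure HasGaussianTransform (P : Measure Ω) (X : Ω → ℝ) (q : ℝ) : Prop where
  aemeasurable : AEMeasurable X P
  charFun_one : charFun (P.map X) 1 = Complex.exp (-(q / 2 : ℝ))

lemma charFun_map_one (hX : AEMeasurable X P) :
    charFun (P.map X) 1 = ∫ ω, Complex.exp (X ω * Complex.I) ∂P := by
  rw [charFun_apply_real, integral_map hX (by fun_prop)]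
  simp only [Complex.ofReal_one, one_mul]

lemma HasGaussianTransform.congr_ae (hX : HasGaussianTransform P X q) (hXY : X =ᵐ[P] Y) :
    HasGaussianTransform P Y q :=
  ⟨hX.aemeasurable.congr hXY, by rw [← Measure.map_congr hXY, hX.charFun_one]⟩

lemma HasGaussianTransform.add_of_indepFun [IsProbabilityMeasure P]
    (hX : HasGaussianTransform P X q) (hY : HasGaussianTransform P Y r) (hXY : IndepFun X Y P) :
    HasGaussianTransform P (fun ω => X ω + Y ω) (q + r) where
  aemeasurable := hX.aemeasurable.add hY.aemeasurable
  charFun_one := by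
    rw [hXY.charFun_map_fun_add_eq_mul hX.aemeasurable hY.aemeasurable, Pi.mul_apply,
      hX.charFun_one, hY.charFun_one, ← Complex.exp_add]
    congr 1
    push_cast
    ring

lemma HasGaussianTransform.sum_of_iIndepFun [IsProbabilityMeasure P] {ι : Type*} [Fintype ι]
    {X : ι → Ω → ℝ} {q : ι → ℝ} (hX : ∀ i, HasGaussianTransform P (X i) (q i))
    (hind : iIndepFun X P) :
    HasGaussianTransform P (fun ω => ∑ i, X i ω) (∑ i, q i) where
  aemeasurable := Finset.aemeasurable_fun_sum _ fun i _ => (hX i).aemeasurable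
  charFun_one := by
    simp only [hind.charFun_map_fun_sum_eq_prod fun i => (hX i).aemeasurable, Finset.prod_apply,
      (hX _).charFun_one, ← Complex.exp_sum, Finset.sum_div, Complex.ofReal_sum,
      Finset.sum_neg_distrib]

lemma HasGaussianTransform.of_tendsto_ae [IsFiniteMeasure P] {Xn : ℕ → Ω → ℝ} {qn : ℕ → ℝ}
    (hXn : ∀ n, HasGaussianTransform P (Xn n) (qn n))
    (hX : ∀ᵐ ω ∂P, Tendsto (fun n => Xn n ω) atTop (nhds (X ω)))
    (hq : Tendsto qn atTop (nhds q)) : HasGaussianTransform P X q := by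
  have hXm : AEMeasurable X P :=
    aemeasurable_of_tendsto_metrizable_ae atTop (fun n => (hXn n).aemeasurable) hX
  have hlim : Tendsto (fun n => ∫ ω, Complex.exp (Xn n ω * Complex.I) ∂P) atTop
      (nhds (∫ ω, Complex.exp (X ω * Complex.I) ∂P)) := by
    refine tendsto_integral_of_dominated_convergence (fun _ => 1) (fun n => ?_)
      (integrable_const _) (fun n => Eventually.of_forall fun ω => ?_) ?_
    · have := (hXn n).aemeasurable
      fun_prop
    · rw [Complex.norm_exp_ofReal_mul_I]
    · filter_upwards [hX] with ω hω
      exact (by fun_prop : Continuous fun a : ℝ => Complex.exp (a * Complex.I)).continuousAt.tendsto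
        |>.comp hω
  refine ⟨hXm, ?_⟩
  rw [charFun_map_one hXm]
  refine tendsto_nhds_unique hlim ?_
  simp only [← charFun_map_one (hXn _).aemeasurable, (hXn _).charFun_one]
  exact (by fun_prop : Continuous fun q : ℝ => Complex.exp (-(q / 2 : ℝ))).continuousAt.tendsto
    |>.comp hq

lemma hasGaussianTransform_of_hasGaussianLaw (hX : HasGaussianLaw X P) (hmean : P[X] = 0) :
    HasGaussianTransform P X Var[X; P] where
  aemeasurable := hX.aemeasurable
  charFun_one := by
    rw [hX.map_eq_gaussianReal, charFun_gaussianReal, hmean,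
      Real.coe_toNNReal _ (variance_nonneg _ _)]
    congr 1
    push_cast
    ring

variable {H : Type*} [NormedAddCommGroup H] [InnerProductSpace ℝ H] [MeasurableSpace H]
  [BorelSpace H] [SecondCountableTopology H]

lemma charFun_map_eq_charFun_map_inner {X : Ω → H} (hX : AEMeasurable X P) (c : H) :
    charFun (P.map X) c = charFun (P.map fun ω => ⟪X ω, c⟫) 1 := by
  rw [charFun_map_one (hX.inner aemeasurable_const), charFun_apply, integral_map hX (by fun_prop)]

lemma hasGaussianTransform_inner_iff {X : Ω → H} (hX : AEMeasurable X P) {c : H} :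
    HasGaussianTransform P (fun ω => ⟪X ω, c⟫) q ↔
      charFun (P.map X) c = Complex.exp (-(q / 2 : ℝ)) := by
  rw [charFun_map_eq_charFun_map_inner hX]
  exact ⟨fun h => h.charFun_one, fun h => ⟨hX.inner aemeasurable_const, h⟩⟩

end GaussianTransform

section WeakMeasurability

variable {H : Type*} [NormedAddCommGroup H] [InnerProductSpace ℝ H]
  [SecondCountableTopology H]

lemma countable_of_orthonormal {ι : Type*} {b : ι → H} (hb : Orthonormal ℝ b) : Countable ι := by
  have hdist : Pairwise fun i j => 1 ≤ dist (b i) (b j) := by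
    intro i j hij
    have hsq : dist (b i) (b j) ^ 2 = 2 := by
      rw [dist_eq_norm, norm_sub_sq_real, hb.1 i, hb.1 j, hb.2 hij]
      norm_num
    nlinarith [dist_nonneg (x := b i) (y := b j)]
  refine Pairwise.countable_of_isOpen_disjoint (s := fun i => Metric.ball (b i) (1 / 2))
    (fun i j hij => Metric.ball_disjoint_ball (by linarith [hdist hij]))
    (fun i => Metric.isOpen_ball) fun i => ⟨b i, Metric.mem_ball_self (by norm_num)⟩

lemma aemeasurable_of_inner [CompleteSpace H] [MeasurableSpace H] [BorelSpace H] {Ω : Type*}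
    [MeasurableSpace Ω] {P : Measure Ω} {X : Ω → H}
    (hX : ∀ c, AEMeasurable (fun ω => ⟪X ω, c⟫) P) : AEMeasurable X P := by
  obtain ⟨w, b, -⟩ := exists_hilbertBasis ℝ H
  have := countable_of_orthonormal b.orthonormal
  refine aemeasurable_of_tendsto_metrizable_ae (atTop : Filter (Finset w))
    (f := fun s ω => ∑ i ∈ s, b.repr (X ω) i • b i) (fun s => ?_)
    (Eventually.of_forall fun ω => b.hasSum_repr (X ω))
  simp only [b.repr_apply_apply, real_inner_comm]
  have := hX
  fun_prop

end WeakMeasurability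

/-! ### Gaussian measures given by their characteristic function -/

section GaussianMeasure

variable {H : Type*} [NormedAddCommGroup H] [InnerProductSpace ℝ H] [MeasurableSpace H]
  {μ : Measure H} [IsProbabilityMeasure μ] {C : H →L[ℝ] H}

lemma inner_nonneg_of_charFun (h : ∀ g, charFun μ g = Complex.exp (-(⟪C g, g⟫ / 2 : ℝ))) (g : H) :
    0 ≤ ⟪C g, g⟫ := by
  have hnorm := norm_charFun_le_one (μ := μ) g
  rw [h, Complex.norm_exp, Real.exp_le_one_iff, Complex.neg_re, Complex.ofReal_re] at hnorm
  linarith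

lemma isGaussianWith_map_add [BorelSpace H] [SecondCountableTopology H] [CompleteSpace H]
    (h : ∀ g, charFun μ g = Complex.exp (-(⟪C g, g⟫ / 2 : ℝ)))
    (hC : ∀ f g, ⟪C f, g⟫ = ⟪f, C g⟫) (a : H) :
    IsGaussianWith (μ.map fun u => u + a) a C := by
  have : IsProbabilityMeasure (μ.map fun u => u + a) :=
    Measure.isProbabilityMeasure_map (by fun_prop)
  set f : H →L[ℝ] H →L[ℝ] ℝ := (innerSL ℝ).comp C
  have hf : f.toBilinForm.IsPosSemidef :=
    { eq := fun g k => (hC g k).trans (real_inner_comm _ _)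
      nonneg := inner_nonneg_of_charFun h }
  have hchar : ∀ t, charFun (μ.map fun u => u + a) t =
      Complex.exp ((⟪t, a⟫ : ℝ) * Complex.I - (f t t : ℝ) / 2) := by
    intro t
    rw [charFun_map_add_const, h, ← Complex.exp_add, real_inner_comm t a,
      show f t t = ⟪C t, t⟫ from rfl]
    congr 1
    push_cast
    ring
  obtain ⟨hmean, hcov⟩ := gaussian_charFun_congr a f hf hchar
  exact ⟨isGaussian_iff_gaussian_charFun.2 ⟨a, f, hf, hchar⟩, hmean.symm,
    fun g k => (congrArg (fun b => b g k) hcov).symm⟩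

end GaussianMeasure

lemma isOpenPosMeasure_stdGaussian (d : ℕ) : (stdGaussian (E d)).IsOpenPosMeasure := by
  have : (gaussianReal 0 1).IsOpenPosMeasure :=
    (gaussianReal_absolutelyContinuous' 0 one_ne_zero).isOpenPosMeasure
  rw [← map_pi_eq_stdGaussian]
  exact (PiLp.continuous_toLp 2 _).isOpenPosMeasure_map (WithLp.toLp_surjective 2)

lemma charFun_stdGaussian_map_smul {d : ℕ} (a : ℝ) (c : E d) :
    charFun ((stdGaussian (E d)).map (a • ·)) c = Complex.exp (-(a ^ 2 * ‖c‖ ^ 2 / 2 : ℝ)) := by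
  rw [charFun_map_smul, charFun_stdGaussian, ← Complex.ofReal_pow, norm_smul, mul_pow,
    Real.norm_eq_abs, sq_abs]
  congr 1
  push_cast
  ring

lemma isOpenPosMeasure_of_charFun {d : ℕ} {μ : Measure (E d)} [IsFiniteMeasure μ] {r : ℝ}
    (hr : 0 < r) (h : ∀ c, charFun μ c = Complex.exp (-(r * ‖c‖ ^ 2 / 2 : ℝ))) :
    μ.IsOpenPosMeasure := by
  have hμ : μ = (stdGaussian (E d)).map (Real.sqrt r • ·) :=
    Measure.ext_of_charFun <| funext fun c => by
      rw [h, charFun_stdGaussian_map_smul, Real.sq_sqrt hr.le]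
  have := isOpenPosMeasure_stdGaussian d
  rw [hμ]
  exact (continuous_const_smul _).isOpenPosMeasure_map
    (MulAction.surjective₀ (Real.sqrt_pos.2 hr).ne')

/-! ### Conditioned laws -/

section Conditioning

variable {Ω 𝓧 𝓨 : Type*} [MeasurableSpace Ω] {P : Measure Ω} [IsProbabilityMeasure P]
  [MeasurableSpace 𝓧] [MeasurableSpace 𝓨] {X Z : Ω → 𝓧} {Y : Ω → 𝓨}

lemma IsConditionedLaw.unique [TopologicalSpace 𝓨] [PseudoMetricSpace 𝓧] [BorelSpace 𝓧]
    [SecondCountableTopology 𝓧] (hY : (P.map Y).IsOpenPosMeasure) {y : 𝓨} {Q Q' : Measure 𝓧}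
    (h : IsConditionedLaw P X Y y Q) (h' : IsConditionedLaw P X Y y Q') : Q = Q' := by
  obtain ⟨κ, hκ, hcont, hdist, rfl⟩ := h
  obtain ⟨κ', hκ', hcont', hdist', rfl⟩ := h'
  have : IsProbabilityMeasure (P.map Y) := Measure.isProbabilityMeasure_map hdist.aemeasurable_fst
  have hae : ∀ᵐ z ∂P.map Y, κ z = κ' z :=
    Kernel.ae_eq_of_compProd_eq (hdist.map_eq.symm.trans hdist'.map_eq)
  refine ext_of_forall_integral_eq_of_IsFiniteMeasure fun F => ?_
  refine congrFun ((Continuous.ae_eq_iff_eq (P.map Y) (hcont F) (hcont' F)).1 ?_) y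
  filter_upwards [hae] with z hz
  rw [hz]

lemma hasCondDistrib_prodMk_of_indepFun (hY : AEMeasurable Y P) (hZ : AEMeasurable Z P)
    (hYZ : IndepFun Y Z P) :
    HasCondDistrib (fun ω => (Y ω, Z ω)) Y (Kernel.id ×ₖ Kernel.const 𝓨 (P.map Z)) P := by
  have : IsProbabilityMeasure (P.map Z) := Measure.isProbabilityMeasure_map hZ
  have : IsProbabilityMeasure (P.map Y) := Measure.isProbabilityMeasure_map hY
  refine ⟨hY.prodMk (hY.prodMk hZ), ?_⟩
  have hdiag : Measurable fun p : 𝓨 × 𝓧 => (p.1, p) := measurable_fst.prodMk measurable_id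
  have hmap : P.map (fun ω => (Y ω, (Y ω, Z ω))) =
      ((P.map Y).prod (P.map Z)).map fun p => (p.1, p) := by
    rw [← hYZ.map_prod_eq_prod_map_map hY hZ,
      AEMeasurable.map_map_of_aemeasurable hdiag.aemeasurable (hY.prodMk hZ)]
    rfl
  rw [hmap]
  refine Measure.ext_of_lintegral _ fun F hF => ?_
  have hFdiag : Measurable fun p : 𝓨 × 𝓧 => F (p.1, p) := hF.comp hdiag
  rw [lintegral_map hF hdiag, lintegral_prod _ hFdiag.aemeasurable,
    Measure.lintegral_compProd hF]
  refine lintegral_congr fun z => ?_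
  have hFz : Measurable fun p : 𝓨 × 𝓧 => F (z, p) := hF.comp measurable_prodMk_left
  rw [Kernel.lintegral_id_prod hFz, Kernel.const_apply]

lemma isConditionedLaw_of_indepFun [TopologicalSpace 𝓨] [BorelSpace 𝓨]
    [SecondCountableTopology 𝓨] [NormedAddCommGroup 𝓧] [BorelSpace 𝓧]
    [SecondCountableTopology 𝓧] (hZ : AEMeasurable Z P) (hY : AEMeasurable Y P)
    (hYZ : IndepFun Y Z P) {A : 𝓨 → 𝓧} (hA : Continuous A)
    (hX : ∀ᵐ ω ∂P, X ω = Z ω + A (Y ω)) (y : 𝓨) :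
    IsConditionedLaw P X Y y ((P.map Z).map fun u => u + A y) := by
  have : IsProbabilityMeasure (P.map Z) := Measure.isProbabilityMeasure_map hZ
  have hg : Measurable fun p : 𝓨 × 𝓧 => p.2 + A p.1 := by fun_prop
  set κ : Kernel 𝓨 𝓧 := (Kernel.id ×ₖ Kernel.const 𝓨 (P.map Z)).map fun p => p.2 + A p.1 with hκ
  have hκ_apply : ∀ z, κ z = (P.map Z).map fun u => u + A z := fun z => by
    rw [hκ, Kernel.map_apply _ hg, Kernel.prod_apply, Kernel.id_apply, Kernel.const_apply,
      Measure.dirac_prod, Measure.map_map hg measurable_prodMk_left]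
    rfl
  refine ⟨κ, Kernel.IsMarkovKernel.map _ hg, fun F => ?_, ?_, hκ_apply y⟩
  · have hint : ∀ z, ∫ u, F u ∂κ z = ∫ u, F (u + A z) ∂P.map Z := fun z => by
      rw [hκ_apply, integral_map (by fun_prop) (by fun_prop)]
    simp only [hint]
    exact continuous_of_dominated (bound := fun _ => ‖F‖)
      (fun z => (by fun_prop : Continuous fun u => F (u + A z)).aestronglyMeasurable)
      (fun z => Eventually.of_forall fun u => F.norm_coe_le_norm _) (integrable_const _)
      (Eventually.of_forall fun u => by fun_prop)
  · have hsum := (hasCondDistrib_prodMk_of_indepFun hY hZ hYZ).comp_left hg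
    have hae : (fun ω => (Y ω, Z ω + A (Y ω))) =ᵐ[P] fun ω => (Y ω, X ω) := by
      filter_upwards [hX] with ω hω
      rw [hω]
    exact ⟨hsum.aemeasurable.congr hae, (Measure.map_congr hae).symm.trans hsum.map_eq⟩

end Conditioning

instance instSecondCountableTopologyL2 (d : ℕ) (T : ℝ) : SecondCountableTopology (L2 d T) :=
  haveI : Fact ((2 : ENNReal) ≠ ⊤) := ⟨ENNReal.ofNat_ne_top⟩
  inferInstance

/-! ### Gaussian fields with values in `L²` -/

section ToL2

variable {d : ℕ} {T : ℝ} {F F' : ℝ → E d}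

lemma toL2_eq_toLp (hF : MemLp F 2 (volume.restrict (Icc 0 T))) : toL2 T F = hF.toLp F :=
  dif_pos hF

lemma coeFn_toL2 (hF : MemLp F 2 (volume.restrict (Icc 0 T))) :
    toL2 T F =ᵐ[volume.restrict (Icc 0 T)] F := by
  rw [toL2_eq_toLp hF]
  exact hF.coeFn_toLp

lemma inner_toL2 (hF : MemLp F 2 (volume.restrict (Icc 0 T))) (g : L2 d T) :
    ⟪toL2 T F, g⟫ = ∫ t in Icc 0 T, ⟪F t, g t⟫ := by
  rw [L2.inner_def]
  refine integral_congr_ae ?_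
  filter_upwards [coeFn_toL2 hF] with t ht
  rw [ht]

lemma toL2_add (hF : MemLp F 2 (volume.restrict (Icc 0 T)))
    (hF' : MemLp F' 2 (volume.restrict (Icc 0 T))) :
    toL2 T (fun t => F t + F' t) = toL2 T F + toL2 T F' := by
  rw [toL2_eq_toLp hF, toL2_eq_toLp hF', ← MemLp.toLp_add hF hF', ← toL2_eq_toLp (hF.add hF')]
  rfl

end ToL2

section SimpleFunc

variable {α β F G : Type*} [MeasurableSpace α] {μ : Measure α} [NormedAddCommGroup F]
  [NormedSpace ℝ F] [NormedAddCommGroup G] [NormedSpace ℝ G] [CompleteSpace F] [CompleteSpace G]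

lemma integral_simpleFunc_apply (τ : SimpleFunc α β) (L : β → F →L[ℝ] G) {g : α → F}
    (hg : Integrable g μ) :
    ∫ x, L (τ x) (g x) ∂μ = ∑ y ∈ τ.range, L y (∫ x in τ ⁻¹' {y}, g x ∂μ) := by
  have hsum : ∀ x, L (τ x) (g x) = ∑ y ∈ τ.range, (τ ⁻¹' {y}).indicator (fun x => L y (g x)) x := by
    intro x
    rw [Finset.sum_eq_single_of_mem (τ x) (τ.mem_range_self x)]
    · have hx : x ∈ τ ⁻¹' {τ x} := mem_singleton _
      rw [indicator_of_mem hx]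
    · exact fun y _ hy =>
        indicator_of_notMem (fun hx : x ∈ τ ⁻¹' {y} => hy (mem_singleton_iff.1 hx).symm) _
  simp_rw [hsum]
  rw [integral_finsetSum _ fun y _ =>
    ((L y).integrable_comp hg).indicator (τ.measurableSet_fiber y)]
  refine Finset.sum_congr rfl fun y _ => ?_
  rw [integral_indicator (τ.measurableSet_fiber y), (L y).integral_comp_comm hg.integrableOn]

end SimpleFunc

section KernelConvergence

variable {α F : Type*} [MeasurableSpace α] {μ : Measure α} [IsFiniteMeasure μ]
  [NormedAddCommGroup F] [InnerProductSpace ℝ F] [CompleteSpace F]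

lemma IsBoundedKernel.tendsto_inner_toCLM {H : α → α → ℝ} {Hn : ℕ → α → α → ℝ}
    (hHn : ∀ n, IsBoundedKernel μ (Hn n)) (hH : IsBoundedKernel μ H) {M : ℝ}
    (hM : ∀ n s t, |Hn n s t| ≤ M)
    (hlim : ∀ᵐ p ∂μ.prod μ, Tendsto (fun n => Hn n p.1 p.2) atTop (nhds (H p.1 p.2)))
    (g h : Lp F 2 μ) :
    Tendsto (fun n => ⟪(hHn n).toCLM F g, h⟫) atTop (nhds ⟪hH.toCLM F g, h⟫) := by
  have hgh : Integrable (fun p : α × α => ‖g p.2‖ * ‖h p.1‖) (μ.prod μ) := by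
    simp_rw [mul_comm ‖g _‖]
    exact (integrable_lp_two h).norm.mul_prod (integrable_lp_two g).norm
  simp only [IsBoundedKernel.inner_toCLM]
  refine tendsto_integral_of_dominated_convergence (fun p => M * (‖g p.2‖ * ‖h p.1‖))
    (fun n => ((hHn n).integrable_mul_inner (integrable_lp_two g)
      (integrable_lp_two h)).aestronglyMeasurable) (hgh.const_mul M)
    (fun n => Eventually.of_forall fun p => ?_) (hlim.mono fun p hp => hp.mul_const _)
  rw [norm_mul]
  exact mul_le_mul (hM n _ _) (norm_inner_le_norm _ _) (norm_nonneg _)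
    ((abs_nonneg _).trans (hM n p.1 p.2))

end KernelConvergence

section TimeGrid

variable {d : ℕ} {T : ℝ}

/-- Simple functions with values in `[0,T]` that converge to the identity on `[0,T]`: they sample
a path at finitely many times. -/
def timeGrid (hT : 0 ≤ T) (n : ℕ) : SimpleFunc ℝ ℝ :=
  SimpleFunc.approxOn id measurable_id (Icc 0 T) 0 ⟨le_rfl, hT⟩ n

lemma timeGrid_mem (hT : 0 ≤ T) (n : ℕ) (t : ℝ) : timeGrid hT n t ∈ Icc 0 T :=
  SimpleFunc.approxOn_mem _ _ _ _

lemma tendsto_timeGrid (hT : 0 ≤ T) {t : ℝ} (ht : t ∈ Icc 0 T) :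
    Tendsto (fun n => timeGrid hT n t) atTop (nhds t) :=
  SimpleFunc.tendsto_approxOn measurable_id _ (subset_closure ht)

lemma range_timeGrid_subset (hT : 0 ≤ T) (n : ℕ) :
    (↑(timeGrid hT n).range : Set ℝ) ⊆ Icc 0 T := by
  rw [SimpleFunc.coe_range]
  exact range_subset_iff.2 (timeGrid_mem hT n)

lemma tendsto_integral_inner_timeGrid (hT : 0 ≤ T) {F : ℝ → E d} (hF : ContinuousOn F (Icc 0 T))
    (g : L2 d T) :
    Tendsto (fun n => ∫ t in Icc 0 T, ⟪F (timeGrid hT n t), g t⟫) atTop (nhds ⟪toL2 T F, g⟫) := by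
  obtain ⟨M, hM⟩ := isCompact_Icc.exists_bound_of_continuousOn hF
  rw [inner_toL2 (memLp_Icc_of_continuousOn hF 2)]
  refine tendsto_integral_of_dominated_convergence (fun t => M * ‖g t‖) (fun n => ?_)
    ((integrable_lp_two g).norm.const_mul M) (fun n => Eventually.of_forall fun t => ?_) ?_
  · exact ((timeGrid hT n).map F).aestronglyMeasurable.inner (Lp.aestronglyMeasurable g)
  · exact (norm_inner_le_norm _ _).trans
      (mul_le_mul_of_nonneg_right (hM _ (timeGrid_mem hT n t)) (norm_nonneg _))
  · filter_upwards [ae_restrict_mem measurableSet_Icc] with t ht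
    exact ((hF t ht).tendsto.comp (tendsto_nhdsWithin_iff.2 ⟨tendsto_timeGrid hT ht,
      Eventually.of_forall fun n => timeGrid_mem hT n t⟩)).inner tendsto_const_nhds

/-- The integrals of `g` over the level sets of a time grid: the weights with which a path sampled
on the grid is paired with `g`. -/
def gridWeight (hT : 0 ≤ T) (n : ℕ) (g : L2 d T) (s : ℝ) : E d :=
  ∫ t in timeGrid hT n ⁻¹' {s}, g t ∂volume.restrict (Icc 0 T)

lemma integral_inner_timeGrid (hT : 0 ≤ T) (n : ℕ) (F : ℝ → E d) (g : L2 d T) :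
    ∫ t in Icc 0 T, ⟪F (timeGrid hT n t), g t⟫ =
      ∑ t ∈ (timeGrid hT n).range, ⟪F t, gridWeight hT n g t⟫ :=
  integral_simpleFunc_apply (timeGrid hT n) (fun t => innerSL ℝ (F t)) (integrable_lp_two g)

lemma tendsto_sum_gridWeight (hT : 0 ≤ T) {R : ℝ → ℝ → ℝ} (hR : Continuous (Function.uncurry R))
    (g : L2 d T) :
    Tendsto (fun n => ∑ s ∈ (timeGrid hT n).range, ∑ t ∈ (timeGrid hT n).range,
      R s t * ⟪gridWeight hT n g t, gridWeight hT n g s⟫) atTop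
      (nhds ⟪(IsBoundedKernel.of_continuous T hR).toCLM (E d) g, g⟫) := by
  obtain ⟨M, hM⟩ := exists_bound_of_continuous_uncurry T hR
  have hbound : ∀ n s t, |R (timeGrid hT n s) (timeGrid hT n t)| ≤ M := fun n s t =>
    hM _ (timeGrid_mem hT n s) _ (timeGrid_mem hT n t)
  have hker : ∀ n, IsBoundedKernel (volume.restrict (Icc 0 T)) fun s t =>
      R (timeGrid hT n s) (timeGrid hT n t) := fun n =>
    .of_bound (hR.measurable.comp (((timeGrid hT n).measurable.comp measurable_fst).prodMk
      ((timeGrid hT n).measurable.comp measurable_snd))) fun s _ t _ => hbound n s t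
  have hlim := IsBoundedKernel.tendsto_inner_toCLM hker (IsBoundedKernel.of_continuous T hR) hbound
    (by
      rw [Measure.prod_restrict]
      filter_upwards [ae_restrict_mem (measurableSet_Icc.prod measurableSet_Icc)] with p hp
      exact (hR.tendsto p).comp
        ((tendsto_timeGrid hT hp.1).prodMk_nhds (tendsto_timeGrid hT hp.2))) g g
  refine hlim.congr fun n => ?_
  have hcoe : (hker n).toCLM (E d) g =ᵐ[volume.restrict (Icc 0 T)] fun s =>
      ∑ t ∈ (timeGrid hT n).range, R (timeGrid hT n s) t • gridWeight hT n g t :=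
    ((hker n).coeFn_toCLM g).trans (Eventually.of_forall fun s =>
      integral_simpleFunc_apply (timeGrid hT n)
        (fun t => R (timeGrid hT n s) t • ContinuousLinearMap.id ℝ (E d)) (integrable_lp_two g))
  rw [L2.inner_def, integral_congr_ae (hcoe.mono fun s hs => congrArg (⟪·, g s⟫) hs),
    integral_inner_timeGrid hT n
      (fun s => ∑ t ∈ (timeGrid hT n).range, R s t • gridWeight hT n g t)]
  simp only [sum_inner, real_inner_smul_left]

end TimeGrid

section GaussianField

variable {Ω : Type*} [MeasurableSpace Ω] {d : ℕ} {T : ℝ} {P : Measure Ω}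

/-- The `ℝᵈ`-valued process `Y` with continuous paths on `[0,T]` is centred and Gaussian with
covariance `R(s,t) I` and is independent of the centred Gaussian vector `ξ` with covariance `r I`;
the Gaussian property is stated for the linear functionals of finitely many values of `Y` and of
`ξ`. -/
structure IsGaussianField (P : Measure Ω) (T : ℝ) (Y : ℝ → Ω → E d) (ξ : Ω → E d)
    (R : ℝ → ℝ → ℝ) (r : ℝ) : Prop where
  continuousOn : ∀ᵐ ω ∂P, ContinuousOn (fun t => Y t ω) (Icc 0 T)
  transform : ∀ s : Finset ℝ, (↑s : Set ℝ) ⊆ Icc 0 T → ∀ (a : ℝ → E d) (c : E d),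
    HasGaussianTransform P (fun ω => ∑ t ∈ s, ⟪Y t ω, a t⟫ + ⟪ξ ω, c⟫)
      (∑ t ∈ s, ∑ t' ∈ s, R t t' * ⟪a t', a t⟫ + r * ‖c‖ ^ 2)

namespace IsGaussianField

variable {Y : ℝ → Ω → E d} {ξ : Ω → E d} {R : ℝ → ℝ → ℝ} {r : ℝ}

lemma transform_vector (h : IsGaussianField P T Y ξ R r) (c : E d) :
    HasGaussianTransform P (fun ω => ⟪ξ ω, c⟫) (r * ‖c‖ ^ 2) := by
  simpa using h.transform ∅ (by simp) 0 c

lemma aemeasurable_vector (h : IsGaussianField P T Y ξ R r) : AEMeasurable ξ P :=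
  aemeasurable_of_inner fun c => (h.transform_vector c).aemeasurable

lemma charFun_vector (h : IsGaussianField P T Y ξ R r) (c : E d) :
    charFun (P.map ξ) c = Complex.exp (-(r * ‖c‖ ^ 2 / 2 : ℝ)) :=
  (hasGaussianTransform_inner_iff h.aemeasurable_vector).1 (h.transform_vector c)

variable [IsProbabilityMeasure P]

lemma transform_toL2 (h : IsGaussianField P T Y ξ R r) (hT : 0 ≤ T)
    (hR : Continuous (Function.uncurry R)) (g : L2 d T) (c : E d) :
    HasGaussianTransform P (fun ω => ⟪toL2 T (fun t => Y t ω), g⟫ + ⟪ξ ω, c⟫)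
      (⟪(IsBoundedKernel.of_continuous T hR).toCLM (E d) g, g⟫ + r * ‖c‖ ^ 2) := by
  refine .of_tendsto_ae
    (fun n => h.transform _ (range_timeGrid_subset hT n) (gridWeight hT n g) c) ?_
    ((tendsto_sum_gridWeight hT hR g).add_const _)
  filter_upwards [h.continuousOn] with ω hω
  simp only [← integral_inner_timeGrid hT _ fun t => Y t ω]
  exact (tendsto_integral_inner_timeGrid hT hω g).add_const _

lemma transform_toL2_left (h : IsGaussianField P T Y ξ R r) (hT : 0 ≤ T)
    (hR : Continuous (Function.uncurry R)) (g : L2 d T) :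
    HasGaussianTransform P (fun ω => ⟪toL2 T (fun t => Y t ω), g⟫)
      ⟪(IsBoundedKernel.of_continuous T hR).toCLM (E d) g, g⟫ := by
  simpa using h.transform_toL2 hT hR g 0

lemma aemeasurable_toL2 (h : IsGaussianField P T Y ξ R r) (hT : 0 ≤ T)
    (hR : Continuous (Function.uncurry R)) :
    AEMeasurable (fun ω => toL2 T fun t => Y t ω) P :=
  aemeasurable_of_inner fun g => (h.transform_toL2_left hT hR g).aemeasurable

lemma charFun_toL2 (h : IsGaussianField P T Y ξ R r) (hT : 0 ≤ T)
    (hR : Continuous (Function.uncurry R)) (g : L2 d T) :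
    charFun (P.map fun ω => toL2 T fun t => Y t ω) g =
      Complex.exp (-(⟪(IsBoundedKernel.of_continuous T hR).toCLM (E d) g, g⟫ / 2 : ℝ)) :=
  (hasGaussianTransform_inner_iff (h.aemeasurable_toL2 hT hR)).1 (h.transform_toL2_left hT hR g)

lemma indepFun (h : IsGaussianField P T Y ξ R r) (hT : 0 ≤ T)
    (hR : Continuous (Function.uncurry R)) :
    IndepFun (fun ω => toL2 T fun t => Y t ω) ξ P := by
  have hX := h.aemeasurable_toL2 hT hR
  have hξ := h.aemeasurable_vector
  refine (indepFun_iff_charFun_prod hX hξ).2 fun p => ?_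
  rw [h.charFun_toL2 hT hR, h.charFun_vector, ← Complex.exp_add,
    ← neg_add, ← Complex.ofReal_add, ← add_div]
  refine (hasGaussianTransform_inner_iff
    ((WithLp.measurable_toLp 2 _).comp_aemeasurable (hX.prodMk hξ))).1 ?_
  simp only [WithLp.prod_inner_apply]
  exact h.transform_toL2 hT hR p.fst p.snd

end IsGaussianField

end GaussianField

/-! ### The driving noise -/

section Noise

variable {Ω ι : Type*} [MeasurableSpace Ω] {d : ℕ} {P : Measure Ω} {W : ℝ≥0 → Ω → E d}

lemma hasGaussianTransform_sum_brownianReal {B : ℝ≥0 → Ω → ℝ} (hB : IsBrownianReal B P)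
    (s : Finset ι) (τ : ι → ℝ≥0) (a : ι → ℝ) :
    HasGaussianTransform P (fun ω => ∑ i ∈ s, a i * B (τ i) ω)
      (∑ i ∈ s, ∑ j ∈ s, min (τ i : ℝ) (τ j) * (a j * a i)) := by
  have := hB.isGaussianProcess.isProbabilityMeasure
  have hgauss : HasGaussianLaw (fun ω => ∑ i ∈ s, a i * B (τ i) ω) P := by
    simpa only [Function.comp_apply, smul_eq_mul] using
      ((hB.isGaussianProcess.comp_right τ).smul a).hasGaussianLaw_fun_sum (I := s)
  have hmean : ∫ ω, ∑ i ∈ s, a i * B (τ i) ω ∂P = 0 := by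
    rw [integral_finsetSum _ fun i _ => (hB.integrable_eval _).const_mul _]
    simp only [integral_const_mul, hB.integral_eval, mul_zero, Finset.sum_const_zero]
  have hvar : Var[fun ω => ∑ i ∈ s, a i * B (τ i) ω; P] =
      ∑ i ∈ s, ∑ j ∈ s, min (τ i : ℝ) (τ j) * (a j * a i) := by
    rw [variance_fun_sum' fun i _ =>
      (hB.isGaussianProcess.hasGaussianLaw_eval (τ i)).memLp_two.const_mul (a i)]
    simp only [covariance_const_mul_left, covariance_const_mul_right, hB.covariance_fun_eval,
      NNReal.coe_min]
    exact Finset.sum_congr rfl fun i _ => Finset.sum_congr rfl fun j _ => by ring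
  exact hvar ▸ hasGaussianTransform_of_hasGaussianLaw hgauss hmean

lemma IsBrownianVector.hasGaussianTransform_sum [IsProbabilityMeasure P]
    (hW : IsBrownianVector W P) (s : Finset ι) (τ : ι → ℝ≥0) (a : ι → E d) :
    HasGaussianTransform P (fun ω => ∑ i ∈ s, ⟪W (τ i) ω, a i⟫)
      (∑ i ∈ s, ∑ j ∈ s, min (τ i : ℝ) (τ j) * ⟪a j, a i⟫) := by
  have hind : iIndepFun (fun (k : Fin d) ω => ∑ i ∈ s, a i k * W (τ i) ω k) P :=
    hW.indep.comp (fun k w => ∑ i ∈ s, a i k * w (τ i)) fun k => by fun_prop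
  have hsum : HasGaussianTransform P (fun ω => ∑ k, ∑ i ∈ s, a i k * W (τ i) ω k)
      (∑ k, ∑ i ∈ s, ∑ j ∈ s, min (τ i : ℝ) (τ j) * (a j k * a i k)) :=
    .sum_of_iIndepFun (fun k => hasGaussianTransform_sum_brownianReal (hW.component k) s τ _) hind
  convert hsum using 1
  · funext ω
    rw [Finset.sum_comm]
    simp only [PiLp.inner_apply, RCLike.inner_apply, conj_trivial]
  · rw [Finset.sum_comm (s := Finset.univ)]
    refine Finset.sum_congr rfl fun i _ => ?_
    rw [Finset.sum_comm (s := Finset.univ)]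
    simp only [PiLp.inner_apply, RCLike.inner_apply, conj_trivial, Finset.mul_sum,
      mul_comm (a i _)]

lemma IsBrownianVector.continuous (hW : IsBrownianVector W P) :
    ∀ᵐ ω ∂P, Continuous fun t => W t ω := by
  filter_upwards [ae_all_iff.2 fun i => (hW.component i).cont] with ω hω
  exact (PiLp.continuous_toLp 2 _).comp (continuous_pi hω)

lemma charFun_velocityLaw {m : ℝ} (hm : 0 ≤ m) (c : E d) :
    charFun (velocityLaw d m) c = Complex.exp (-(1 / (2 * m) * ‖c‖ ^ 2 / 2 : ℝ)) := by
  rw [velocityLaw, charFun_stdGaussian_map_smul, inv_pow, Real.sq_sqrt (by positivity), one_div]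

lemma IsLangevinSolution.isGaussianField_noise [IsProbabilityMeasure P] {m T : ℝ} (hm : 0 ≤ m)
    {f : E d → E d} {x₀ : E d} {x v : ℝ → Ω → E d} (hsol : IsLangevinSolution m T f x₀ P W x v) :
    IsGaussianField P T (fun t ω => W t.toNNReal ω) (v 0) (fun s t => min s t) (1 / (2 * m)) where
  continuousOn := by
    filter_upwards [hsol.brownian.continuous] with ω hω
    exact (hω.comp continuous_real_toNNReal).continuousOn
  transform s hs a c := by
    have hnoise : HasGaussianTransform P (fun ω => ∑ t ∈ s, ⟪W t.toNNReal ω, a t⟫)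
        (∑ t ∈ s, ∑ t' ∈ s, min t t' * ⟪a t', a t⟫) := by
      convert hsol.brownian.hasGaussianTransform_sum s Real.toNNReal a using 1
      exact Finset.sum_congr rfl fun t ht => Finset.sum_congr rfl fun t' ht' => by
        rw [Real.coe_toNNReal _ (hs ht).1, Real.coe_toNNReal _ (hs ht').1]
    have hvelocity : HasGaussianTransform P (fun ω => ⟪v 0 ω, c⟫) (1 / (2 * m) * ‖c‖ ^ 2) :=
      (hasGaussianTransform_inner_iff hsol.velocity_law.aemeasurable).2 <| by
        rw [hsol.velocity_law.map_eq, charFun_velocityLaw hm]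
    exact hnoise.add_of_indepFun hvelocity <|
      hsol.velocity_indep.symm.comp (φ := fun w : ℝ≥0 → E d => ∑ t ∈ s, ⟪w t.toNNReal, a t⟫)
        (ψ := fun y => ⟪y, c⟫) (by fun_prop) (by fun_prop)

end Noise

/-! ### The free path as a linear functional of the noise -/

section Path

variable {F : Type*} [NormedAddCommGroup F] [NormedSpace ℝ F] {d : ℕ} {m T t : ℝ}

/-- The response of the position at time `t` to the initial velocity. -/
def velocityCoeff (m t : ℝ) : ℝ := m * (1 - Real.exp (-t / m))

/-- The response of the position at time `t` to the Brownian motion at time `u`; there is none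
for `u > t`. -/
def noiseKernel (m t : ℝ) : ℝ → ℝ := (Iic t).indicator fun u => m⁻¹ * Real.exp ((u - t) / m)

lemma integral_noiseKernel_smul (ht : t ∈ Icc 0 T) (w : ℝ → F) :
    ∫ u in Icc 0 T, noiseKernel m t u • w u =
      ∫ u in (0 : ℝ)..t, (m⁻¹ * Real.exp ((u - t) / m)) • w u := by
  simp only [noiseKernel, ← indicator_smul_apply_left]
  rw [integral_indicator measurableSet_Iic, setIntegral_Iic_restrict_Icc ht]

lemma hasDerivAt_exp_sub_div (m t u : ℝ) :
    HasDerivAt (fun u => Real.exp ((u - t) / m)) (m⁻¹ * Real.exp ((u - t) / m)) u := by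
  simpa [mul_comm] using (((hasDerivAt_id u).sub_const t).div_const m).exp

lemma integral_exp_sub_div (hm : m ≠ 0) (t : ℝ) :
    ∫ u in (0 : ℝ)..t, Real.exp ((u - t) / m) = velocityCoeff m t := by
  rw [intervalIntegral.integral_eq_sub_of_hasDerivAt
    (f := fun u => m * Real.exp ((u - t) / m))
    (fun u _ => by simpa [hm] using (hasDerivAt_exp_sub_div m t u).const_mul m)
    (Continuous.intervalIntegrable (by fun_prop) _ _)]
  simp [velocityCoeff, mul_sub]

/-- Integrate `e^{(u-t)/m}` against the velocity equation by parts: the exponential is the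
integrating factor that removes the friction term. -/
lemma integral_velocity_eq [CompleteSpace F] (hm : m ≠ 0) {v w : ℝ → F}
    (hv : ContinuousOn v (Icc 0 T)) (hw : ContinuousOn w (Icc 0 T))
    (hvw : ∀ t ∈ Icc 0 T, m • v t = m • v 0 - (∫ s in (0 : ℝ)..t, v s) + w t)
    (ht : t ∈ Icc 0 T) :
    ∫ s in (0 : ℝ)..t, v s =
      velocityCoeff m t • v 0 + ∫ u in Icc 0 T, noiseKernel m t u • w u := by
  have hsub : Icc 0 t ⊆ Icc 0 T := Icc_subset_Icc_right ht.2
  set U : ℝ → F := fun u => ∫ s in (0 : ℝ)..u, v s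
  have hU : IsPrimitiveOn t U v :=
    ⟨(hv.mono hsub).integrableOn_Icc, fun u _ => by simp [U]⟩
  have hexp : IsPrimitiveOn t (fun u => Real.exp ((u - t) / m))
      fun u => m⁻¹ * Real.exp ((u - t) / m) :=
    .of_hasDerivAt (hasDerivAt_exp_sub_div m t) (by fun_prop)
  have hparts := hexp.integral_bilin ht.1 hU (ContinuousLinearMap.lsmul ℝ ℝ)
  have hvelocity : ∀ u ∈ Icc 0 t, v u = v 0 - m⁻¹ • U u + m⁻¹ • w u := fun u hu => by
    simpa only [smul_add, smul_sub, inv_smul_smul₀ hm] using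
      congrArg (m⁻¹ • ·) (hvw u (hsub hu))
  have hUc := hU.continuousOn
  have hvc := hv.mono hsub
  have hwc := hw.mono hsub
  calc U t = (∫ u in Icc 0 t, (m⁻¹ * Real.exp ((u - t) / m)) • U u) +
        ∫ u in Icc 0 t, Real.exp ((u - t) / m) • v u := by
        simpa [U] using hparts.symm
    _ = ∫ u in Icc 0 t, (Real.exp ((u - t) / m) • v 0 +
          (m⁻¹ * Real.exp ((u - t) / m)) • w u) := by
        rw [← integral_add (ContinuousOn.integrableOn_Icc (by fun_prop))
          (ContinuousOn.integrableOn_Icc (by fun_prop))]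
        refine setIntegral_congr_fun measurableSet_Icc fun u hu => ?_
        simp only [hvelocity u hu]
        module
    _ = velocityCoeff m t • v 0 + ∫ u in Icc 0 T, noiseKernel m t u • w u := by
        rw [integral_add (ContinuousOn.integrableOn_Icc (by fun_prop))
          (ContinuousOn.integrableOn_Icc (by fun_prop)), integral_smul_const,
          setIntegral_Icc_eq_intervalIntegral ht.1, setIntegral_Icc_eq_intervalIntegral ht.1,
          integral_exp_sub_div hm, integral_noiseKernel_smul ht]

lemma measurable_noiseKernel (m t : ℝ) : Measurable (noiseKernel m t) :=
  Measurable.indicator (by fun_prop) measurableSet_Iic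

lemma abs_noiseKernel_le (hm : 0 ≤ m) (t u : ℝ) : |noiseKernel m t u| ≤ m⁻¹ := by
  by_cases h : u ∈ Iic t
  · have hexp : Real.exp ((u - t) / m) ≤ 1 :=
      Real.exp_le_one_iff.2 (div_nonpos_of_nonpos_of_nonneg (sub_nonpos.2 h) hm)
    rw [noiseKernel, indicator_of_mem h, abs_of_nonneg (by positivity)]
    exact mul_le_of_le_one_right (by positivity) hexp
  · rw [noiseKernel, indicator_of_notMem h, abs_zero]
    positivity

lemma memLp_noiseKernel_smul (hm : 0 ≤ m) (t : ℝ) (a : F) (p : ENNReal) :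
    MemLp (fun u => noiseKernel m t u • a) p (volume.restrict (Icc 0 T)) := by
  have hmeas := (measurable_noiseKernel m t).stronglyMeasurable.smul_const a
  refine .of_bound hmeas.aestronglyMeasurable (m⁻¹ * ‖a‖) (Eventually.of_forall fun u => ?_)
  rw [norm_smul]
  exact mul_le_mul_of_nonneg_right (abs_noiseKernel_le hm t u) (norm_nonneg _)

lemma inner_toL2_noiseKernel (hm : 0 ≤ m) {w : ℝ → E d} (hw : ContinuousOn w (Icc 0 T)) (t : ℝ)
    (a : E d) :
    ⟪toL2 T w, toL2 T fun u => noiseKernel m t u • a⟫ =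
      ⟪∫ u in Icc 0 T, noiseKernel m t u • w u, a⟫ := by
  have hint : IntegrableOn (fun u => noiseKernel m t u • w u) (Icc 0 T) :=
    hw.integrableOn_Icc.bdd_smul m⁻¹ (measurable_noiseKernel m t).aestronglyMeasurable
      (Eventually.of_forall (abs_noiseKernel_le hm t))
  rw [inner_toL2 (memLp_Icc_of_continuousOn hw 2), real_inner_comm, ← integral_inner hint]
  refine integral_congr_ae ?_
  filter_upwards [coeFn_toL2 (memLp_noiseKernel_smul hm t a 2)] with u hu
  rw [hu, real_inner_smul_right, real_inner_smul_right, real_inner_comm]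

end Path

/-! ### The covariance of the free path -/

section FreeCovariance

variable {d : ℕ} {m T s t : ℝ}

lemma integral_noiseKernel_mul_min (hm : m ≠ 0) (hs : s ∈ Icc 0 T) {u : ℝ} (hu : u ∈ Icc 0 s) :
    ∫ r in Icc 0 T, noiseKernel m s r * min r u =
      u + m * Real.exp (-s / m) - m * Real.exp ((u - s) / m) := by
  have hcont : Continuous fun r => m⁻¹ * Real.exp ((r - s) / m) * min r u := by fun_prop
  have hleft : ∫ r in (0 : ℝ)..u, m⁻¹ * Real.exp ((r - s) / m) * min r u =
      Real.exp ((u - s) / m) * (u - m) - Real.exp ((0 - s) / m) * (0 - m) := by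
    rw [intervalIntegral.integral_congr (g := fun r => m⁻¹ * Real.exp ((r - s) / m) * r)
        fun r hr => by simp only [min_eq_left ((uIcc_of_le hu.1 ▸ hr).2)],
      intervalIntegral.integral_eq_sub_of_hasDerivAt
        (f := fun r => Real.exp ((r - s) / m) * (r - m)) (fun r _ => ?_)
        (Continuous.intervalIntegrable (by fun_prop) _ _)]
    refine ((hasDerivAt_exp_sub_div m s r).mul ((hasDerivAt_id r).sub_const m)).congr_deriv ?_
    simp only [id]
    field_simp
    ring
  have hright : ∫ r in u..s, m⁻¹ * Real.exp ((r - s) / m) * min r u =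
      Real.exp ((s - s) / m) * u - Real.exp ((u - s) / m) * u := by
    rw [intervalIntegral.integral_congr (g := fun r => m⁻¹ * Real.exp ((r - s) / m) * u)
        fun r hr => by simp only [min_eq_right ((uIcc_of_le hu.2 ▸ hr).1)],
      intervalIntegral.integral_eq_sub_of_hasDerivAt (f := fun r => Real.exp ((r - s) / m) * u)
        (fun r _ => (hasDerivAt_exp_sub_div m s r).mul_const u)
        (Continuous.intervalIntegrable (by fun_prop) _ _)]
  have hsplit := integral_noiseKernel_smul (m := m) hs fun r => min r u
  simp only [smul_eq_mul] at hsplit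
  rw [hsplit, ← intervalIntegral.integral_add_adjacent_intervals (b := u)
    (hcont.intervalIntegrable _ _) (hcont.intervalIntegrable _ _), hleft, hright, sub_self,
    zero_div, Real.exp_zero, zero_sub]
  ring

lemma integral_noiseKernel_noiseKernel_min (hm : m ≠ 0) (hs : s ∈ Icc 0 T) (ht : t ∈ Icc 0 s) :
    ∫ u in Icc 0 T, noiseKernel m t u * ∫ r in Icc 0 T, noiseKernel m s r * min r u =
      freeCov m s t - velocityCoeff m s * velocityCoeff m t / (2 * m) := by
  have hsplit := integral_noiseKernel_smul (m := m) (T := T) ⟨ht.1, ht.2.trans hs.2⟩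
    fun u => ∫ r in Icc 0 T, noiseKernel m s r * min r u
  simp only [smul_eq_mul] at hsplit
  rw [hsplit, intervalIntegral.integral_congr (g := fun u => m⁻¹ * Real.exp ((u - t) / m) *
      (u + m * Real.exp (-s / m) - m * Real.exp ((u - s) / m))) fun u hu => ?_,
    intervalIntegral.integral_eq_sub_of_hasDerivAt (f := fun u => Real.exp ((u - t) / m) *
      (u - m + m * Real.exp (-s / m) - m / 2 * Real.exp ((u - s) / m))) (fun u _ => ?_)
      (Continuous.intervalIntegrable (by fun_prop) _ _)]
  · simp only [freeCov, velocityCoeff, min_eq_right ht.2, abs_of_nonneg (sub_nonneg.2 ht.2),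
      sub_self, zero_div, Real.exp_zero, zero_sub, neg_sub]
    field_simp
    ring
  · refine ((hasDerivAt_exp_sub_div m t u).mul ((((hasDerivAt_id u).sub_const m).add_const
      (m * Real.exp (-s / m))).sub
        ((hasDerivAt_exp_sub_div m s u).const_mul (m / 2)))).congr_deriv ?_
    simp only [id, Pi.sub_apply]
    field_simp
    ring
  · rw [uIcc_of_le ht.1] at hu
    simp only [integral_noiseKernel_mul_min hm hs ⟨hu.1, hu.2.trans ht.2⟩]

lemma inner_toCLM_noiseKernel (hm : 0 < m) (hs : s ∈ Icc 0 T) (ht : t ∈ Icc 0 T)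
    (hmin : IsBoundedKernel (volume.restrict (Icc 0 T)) min) (a b : E d) :
    ⟪hmin.toCLM (E d) (toL2 T fun u => noiseKernel m s u • a),
        toL2 T fun u => noiseKernel m t u • b⟫ =
      (freeCov m s t - velocityCoeff m s * velocityCoeff m t / (2 * m)) * ⟪a, b⟫ := by
  wlog h : t ≤ s generalizing s t a b
  · rw [hmin.inner_toCLM_comm min_comm, real_inner_comm, this ht hs b a (le_of_not_ge h),
      freeCov_comm, real_inner_comm]
    ring
  rw [hmin.inner_toCLM, integral_prod _ (hmin.integrable_mul_inner (integrable_lp_two _)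
      (integrable_lp_two _)), ← integral_noiseKernel_noiseKernel_min hm.ne' hs ⟨ht.1, h⟩,
    ← integral_mul_const]
  refine integral_congr_ae ?_
  filter_upwards [coeFn_toL2 (memLp_noiseKernel_smul (T := T) hm.le t b 2)] with u hu
  rw [mul_assoc, ← integral_mul_const, ← integral_const_mul]
  refine integral_congr_ae ?_
  filter_upwards [coeFn_toL2 (memLp_noiseKernel_smul (T := T) hm.le s a 2)] with r hr
  rw [hu, hr, real_inner_smul_left, real_inner_smul_right, min_comm]
  ring

variable {Ω ι : Type*} [MeasurableSpace Ω] {P : Measure Ω} {x₀ : E d} {W : ℝ≥0 → Ω → E d}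
  {x v : ℝ → Ω → E d}

lemma IsLangevinSolution.ae_inner_displacement_eq (hm : 0 < m)
    (hsol : IsLangevinSolution m T (fun _ => 0) x₀ P W x v) (ht : t ∈ Icc 0 T) (a : E d) :
    ∀ᵐ ω ∂P, ⟪x t ω - x₀, a⟫ =
      ⟪toL2 T fun u => W u.toNNReal ω, toL2 T fun u => noiseKernel m t u • a⟫ +
        ⟪v 0 ω, velocityCoeff m t • a⟫ := by
  filter_upwards [hsol.continuous_velocity, hsol.position_eq, hsol.velocity_eq,
    hsol.brownian.continuous] with ω hv hx hvw hW
  have hw : ContinuousOn (fun u : ℝ => W u.toNNReal ω) (Icc 0 T) :=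
    (hW.comp continuous_real_toNNReal).continuousOn
  rw [hx t ht, add_sub_cancel_left,
    integral_velocity_eq hm.ne' hv hw (fun u hu => by simpa using hvw u hu) ht, inner_add_left,
    real_inner_smul_left, real_inner_smul_right, inner_toL2_noiseKernel hm.le hw, add_comm]

lemma IsLangevinSolution.hasGaussianTransform_sum [IsProbabilityMeasure P] (hm : 0 < m)
    (hT : 0 ≤ T) (hsol : IsLangevinSolution m T (fun _ => 0) x₀ P W x v) (s : Finset ι)
    {τ : ι → ℝ} (hτ : ∀ i ∈ s, τ i ∈ Icc 0 T) (a : ι → E d) :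
    HasGaussianTransform P (fun ω => ∑ i ∈ s, ⟪x (τ i) ω - x₀, a i⟫)
      (∑ i ∈ s, ∑ j ∈ s, freeCov m (τ i) (τ j) * ⟪a j, a i⟫) := by
  have hfield := (hsol.isGaussianField_noise hm.le).transform_toL2 hT continuous_min
    (∑ i ∈ s, toL2 T fun u => noiseKernel m (τ i) u • a i) (∑ i ∈ s, velocityCoeff m (τ i) • a i)
  convert hfield.congr_ae ?_ using 1
  · simp only [← real_inner_self_eq_norm_sq, map_sum, inner_sum, sum_inner, Finset.mul_sum,
      ← Finset.sum_add_distrib]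
    refine Finset.sum_congr rfl fun i hi => Finset.sum_congr rfl fun j hj => ?_
    rw [inner_toCLM_noiseKernel hm (hτ j hj) (hτ i hi), real_inner_smul_left,
      real_inner_smul_right, freeCov_comm]
    ring
  · filter_upwards [s.eventually_all.2 fun i hi =>
      hsol.ae_inner_displacement_eq hm (hτ i hi) (a i)] with ω hω
    rw [Finset.sum_congr rfl hω, Finset.sum_add_distrib, inner_sum, inner_sum]

end FreeCovariance

/-! ### The law of the bridge -/

section Regression

variable {ι V : Type*} [NormedAddCommGroup V] [InnerProductSpace ℝ V]

lemma sum_inner_sub_smul_add_inner (s : Finset ι) (y : ι → V) (z : V) (b : ι → ℝ) (a : ι → V)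
    (c : V) :
    ∑ i ∈ s, ⟪y i - b i • z, a i⟫ + ⟪z, c⟫ =
      ⟪z, c - ∑ i ∈ s, b i • a i⟫ + ∑ i ∈ s, ⟪y i, a i⟫ := by
  simp only [inner_sub_left, inner_sub_right, inner_sum, real_inner_smul_left,
    real_inner_smul_right, Finset.sum_sub_distrib]
  ring

/-- Both sides are the quadratic form of the family and its endpoint at the same functional, on the
right in terms of the residuals of the regression on the endpoint. -/
lemma quadraticForm_regression (s : Finset ι) (K : ι → ι → ℝ) (b : ι → ℝ) (r : ℝ) (a : ι → V)
    (c : V) :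
    r * ⟪c - ∑ i ∈ s, b i • a i, c - ∑ i ∈ s, b i • a i⟫ +
        ∑ i ∈ s, r * b i * ⟪a i, c - ∑ i ∈ s, b i • a i⟫ +
        ∑ i ∈ s, (r * b i * ⟪c - ∑ i ∈ s, b i • a i, a i⟫ + ∑ j ∈ s, K i j * ⟪a j, a i⟫) =
      ∑ i ∈ s, ∑ j ∈ s, (K i j - r * b i * b j) * ⟪a j, a i⟫ + r * ‖c‖ ^ 2 := by
  set S := ∑ i ∈ s, b i • a i with hS
  have hcross (e : V) : ∑ i ∈ s, r * b i * ⟪a i, e⟫ = r * ⟪S, e⟫ := by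
    simp only [hS, sum_inner, real_inner_smul_left, Finset.mul_sum, mul_assoc]
  have hsquare : ∑ i ∈ s, ∑ j ∈ s, r * b i * b j * ⟪a j, a i⟫ = r * ⟪S, S⟫ := by
    rw [← hcross S]
    refine Finset.sum_congr rfl fun i _ => ?_
    rw [hS, inner_sum, Finset.mul_sum]
    refine Finset.sum_congr rfl fun j _ => ?_
    rw [real_inner_smul_right, real_inner_comm]
    ring
  simp only [real_inner_comm _ (c - S), Finset.sum_add_distrib, hcross, sub_mul,
    Finset.sum_sub_distrib, hsquare]
  simp only [inner_sub_left, inner_sub_right, ← real_inner_self_eq_norm_sq, real_inner_comm S c]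
  ring

end Regression

section Bridge

variable {Ω : Type*} [MeasurableSpace Ω] {d : ℕ} {P : Measure Ω} [IsProbabilityMeasure P]
  {m T : ℝ} {x₀ : E d} {W : ℝ≥0 → Ω → E d} {x v : ℝ → Ω → E d}

lemma IsLangevinSolution.isGaussianField_bridge (hm : 0 < m) (hT : 0 < T)
    (hsol : IsLangevinSolution m T (fun _ => 0) x₀ P W x v) :
    IsGaussianField P T
      (fun t ω => x t ω - bridgeMean m T x₀ (x T ω) t)
      (fun ω => x T ω - x₀) (bridgeCov m T) (endpointCov m T T) where
  continuousOn := by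
    filter_upwards [hsol.continuous_position] with ω hω
    have := continuous_bridgeMean m T x₀ (x T ω)
    fun_prop
  transform s hs a c := by
    have hr := (endpointCov_self_pos hm hT).ne'
    have hbridge (t t' : ℝ) : bridgeCov m T t t' = freeCov m t t' - endpointCov m T T *
        (endpointCov m T t / endpointCov m T T) * (endpointCov m T t' / endpointCov m T T) := by
      rw [bridgeCov]
      field_simp
    have hend (t) (ht : t ∈ s) : freeCov m t T =
        endpointCov m T T * (endpointCov m T t / endpointCov m T T) := by
      rw [freeCov_endpoint (hs ht).2, mul_div_cancel₀ _ hr]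
    have hfree := hsol.hasGaussianTransform_sum hm hT.le (Finset.insertNone s)
      (τ := fun o => o.getD T)
      (fun o ho => by
        rcases o with _ | t
        · exact right_mem_Icc.2 hT.le
        · exact hs (Finset.some_mem_insertNone.1 ho))
      (fun o => o.elim (c - ∑ t ∈ s, (endpointCov m T t / endpointCov m T T) • a t) a)
    simp only [Finset.sum_insertNone, Option.getD_some, Option.getD_none, Option.elim_some,
      Option.elim_none] at hfree
    simp only [bridgeMean, sub_add_eq_sub_sub, sum_inner_sub_smul_add_inner]
    convert hfree using 1
    simp only [hbridge]
    rw [← quadraticForm_regression s (freeCov m)]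
    refine congrArg₂ _ (congrArg₂ _ ?_ ?_) ?_
    · rw [freeCov_endpoint le_rfl]
    · exact Finset.sum_congr rfl fun t ht => by rw [freeCov_comm, hend t ht]
    · exact Finset.sum_congr rfl fun t ht => by rw [hend t ht]

end Bridge

section BridgeMean

variable {d : ℕ} {T : ℝ}

lemma toL2_const_smul {F : ℝ → E d} (hF : MemLp F 2 (volume.restrict (Icc 0 T))) (a : ℝ) :
    toL2 T (fun t => a • F t) = a • toL2 T F := by
  rw [toL2_eq_toLp hF, ← MemLp.toLp_const_smul a hF, ← toL2_eq_toLp (hF.const_smul a)]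
  rfl

lemma continuous_toL2_smul {b : ℝ → ℝ} (hb : Continuous b) :
    Continuous fun c : E d => toL2 T fun t => b t • c := by
  have hmem (c : E d) : MemLp (fun t => b t • c) 2 (volume.restrict (Icc 0 T)) :=
    memLp_Icc_of_continuousOn (hb.smul continuous_const).continuousOn 2
  let L : E d →ₗ[ℝ] L2 d T :=
    { toFun c := toL2 T fun t => b t • c
      map_add' c c' := by simp only [smul_add, toL2_add (hmem c) (hmem c')]
      map_smul' a c := by
        simp only [smul_comm _ a, toL2_const_smul (hmem c), RingHom.id_apply] }
  exact L.continuous_of_finiteDimensional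

lemma continuous_toL2_bridgeMean (m T : ℝ) (xminus : E d) :
    Continuous fun y => toL2 T (bridgeMean m T xminus y) := by
  have hb : Continuous fun t => endpointCov m T t / endpointCov m T T :=
    (continuous_endpointCov m T).div_const _
  have hsplit (y : E d) : toL2 T (bridgeMean m T xminus y) = toL2 T (fun _ => xminus) +
      toL2 T fun t => (endpointCov m T t / endpointCov m T T) • (y - xminus) :=
    toL2_add (memLp_const xminus)
      (memLp_Icc_of_continuousOn (hb.smul continuous_const).continuousOn 2)
  simp only [hsplit]
  exact continuous_const.add ((continuous_toL2_smul hb).comp (continuous_sub_right xminus))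

end BridgeMean

section BridgeLaw

variable {Ω : Type*} [MeasurableSpace Ω] {d : ℕ} {P : Measure Ω} [IsProbabilityMeasure P]
  {m T : ℝ} {x₀ : E d} {W : ℝ≥0 → Ω → E d} {x v : ℝ → Ω → E d}

lemma IsLangevinSolution.isOpenPosMeasure_map_endpoint (hm : 0 < m) (hT : 0 < T)
    (hsol : IsLangevinSolution m T (fun _ => 0) x₀ P W x v) :
    (P.map (x T)).IsOpenPosMeasure := by
  have hfield := hsol.isGaussianField_bridge hm hT
  have := isOpenPosMeasure_of_charFun (endpointCov_self_pos hm hT) hfield.charFun_vector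
  have hmap : P.map (x T) = (P.map fun ω => x T ω - x₀).map (· + x₀) := by
    rw [AEMeasurable.map_map_of_aemeasurable (by fun_prop) hfield.aemeasurable_vector]
    simp only [Function.comp_def, sub_add_cancel]
  rw [hmap]
  exact (continuous_add_const x₀).isOpenPosMeasure_map (add_right_surjective x₀)

/-- The law of the bridge before its mean is added: that of the residual of the regression of the
path on its endpoint. -/
def bridgeNoiseLaw (m T : ℝ) (x₀ : E d) (P : Measure Ω) (x : ℝ → Ω → E d) : Measure (L2 d T) :=
  P.map fun ω => toL2 T fun t => x t ω - bridgeMean m T x₀ (x T ω) t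

lemma IsLangevinSolution.charFun_bridgeNoiseLaw (hm : 0 < m) (hT : 0 < T)
    (hsol : IsLangevinSolution m T (fun _ => 0) x₀ P W x v) (g : L2 d T) :
    charFun (bridgeNoiseLaw m T x₀ P x) g =
      Complex.exp (-(⟪greenOperator d m T g, g⟫ / 2 : ℝ)) :=
  (hsol.isGaussianField_bridge hm hT).charFun_toL2 hT.le (continuous_bridgeCov m T) g

lemma IsLangevinSolution.isGaussianWith_bridgeNoiseLaw (hm : 0 < m) (hT : 0 < T)
    (hsol : IsLangevinSolution m T (fun _ => 0) x₀ P W x v) (a : L2 d T) :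
    IsGaussianWith ((bridgeNoiseLaw m T x₀ P x).map fun u => u + a) a (greenOperator d m T) := by
  have : IsProbabilityMeasure (bridgeNoiseLaw m T x₀ P x) :=
    Measure.isProbabilityMeasure_map
      ((hsol.isGaussianField_bridge hm hT).aemeasurable_toL2 hT.le (continuous_bridgeCov m T))
  exact isGaussianWith_map_add (hsol.charFun_bridgeNoiseLaw hm hT) inner_greenOperator_comm a

lemma IsLangevinSolution.isTargetLaw_bridgeNoiseLaw (hm : 0 < m) (hT : 0 < T)
    (hsol : IsLangevinSolution m T (fun _ => 0) x₀ P W x v) (y : E d) :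
    IsTargetLaw T P x y
      ((bridgeNoiseLaw m T x₀ P x).map fun u => u + toL2 T (bridgeMean m T x₀ y)) := by
  have hfield := hsol.isGaussianField_bridge hm hT
  have hcont := continuous_bridgeCov m T
  have hindep :
      IndepFun (x T) (fun ω => toL2 T fun t => x t ω - bridgeMean m T x₀ (x T ω) t) P := by
    have := (hfield.indepFun hT.le hcont).symm.comp (measurable_id.add_const x₀) measurable_id
    simpa only [Function.comp_def, id, sub_add_cancel] using this
  refine isConditionedLaw_of_indepFun (hfield.aemeasurable_toL2 hT.le hcont)
    (hsol.aemeasurable_position T (right_mem_Icc.2 hT.le)) hindep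
    (continuous_toL2_bridgeMean m T x₀) ?_ y
  filter_upwards [hfield.continuousOn] with ω hω
  rw [← toL2_add (memLp_Icc_of_continuousOn hω 2)
    (memLp_Icc_of_continuousOn (continuous_bridgeMean m T x₀ _).continuousOn 2)]
  simp only [sub_add_cancel]

end BridgeLaw

end LangevinBridge

end

open LangevinBridge in
theorem lemma4p1 {d : ℕ} {m T : ℝ} (hm : 0 < m) (hT : 0 < T) (xminus xplus : E d)
    {Ω : Type*} [MeasurableSpace Ω] (P : Measure Ω) [IsProbabilityMeasure P]
    (W : ℝ≥0 → Ω → E d) (x v : ℝ → Ω → E d)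
    (hsol : IsLangevinSolution m T (fun _ => 0) xminus P W x v) :
    -- the operator is self-adjoint and negative definite
    IsSelfAdjoint (operatorL d m T) ∧
    (∀ u : (operatorL d m T).domain, u ≠ 0 → ⟪operatorL d m T u, (u : L2 d T)⟫ < 0) ∧
    -- the boundary value problem for the mean has exactly one solution on `[0,T]`
    ∃ xbar : ℝ → E d, IsMeanPath m T xminus xplus xbar ∧
      (∀ y, IsMeanPath m T xminus xplus y → EqOn y xbar (Icc 0 T)) ∧
    -- the inverse `-𝓛⁻¹` exists and is the integral operator of the Green's function
    ∃ C : L2 d T →L[ℝ] L2 d T, IsBoundedInverse (-operatorL d m T) C ∧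
      (∃ G : ℝ → ℝ → ℝ, IsGreenFunction m T G ∧
        ∀ g : L2 d T, C g =ᵐ[volume.restrict (Icc (0 : ℝ) T)]
          fun s => ∫ t in Icc (0 : ℝ) T, G s t • g t) ∧
    -- the target distribution exists, is unique, and is `𝒩(x̄, -𝓛⁻¹)`
    ∃ Q : Measure (L2 d T), IsGaussianWith Q (toL2 T xbar) C ∧
      ∀ Q' : Measure (L2 d T), IsTargetLaw T P x xplus Q' ↔ Q' = Q := by
  set Q := (bridgeNoiseLaw m T xminus P x).map fun u =>
    u + toL2 T (bridgeMean m T xminus xplus)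
  have hQ : IsTargetLaw T P x xplus Q := hsol.isTargetLaw_bridgeNoiseLaw hm hT xplus
  have hmean := isMeanPath_bridgeMean hm hT xminus xplus
  exact ⟨isSelfAdjoint_operatorL hm hT, fun u hu => operatorL_inner_neg hm.le hT hu,
    bridgeMean m T xminus xplus, hmean, fun y hy => hy.eqOn hm.le hT hmean,
    greenOperator d m T, isBoundedInverse_greenOperator hm hT,
    ⟨bridgeCov m T, isGreenFunction_bridgeCov hm hT, (isBoundedKernel_bridgeCov m T).coeFn_toCLM⟩,
    Q, hsol.isGaussianWith_bridgeNoiseLaw hm hT _,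
    fun Q' => ⟨fun hQ' => hQ'.unique (hsol.isOpenPosMeasure_map_endpoint hm hT) hQ,
      fun h => h ▸ hQ⟩⟩
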